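/- **Theorem (Inner-loop sample complexity of the zeroth-order natural policy gradient).** *Setting.* Let $m,n,d,N\ge 1$. Consider $x_{t+1}=A_tx_t+B_tu_t+D_tw_t+\xi_t$, $t=0,\dots,N-1$, with $x_t\in\mathbb R^m$, $u_t\in\mathbb R^d$, $w_t\in\mathbb R^n$, where $x_0,\xi_0,\dots,\xi_{N-1}$ are i.i.d. with a law $\mathcal D$ that has mean zero, positive definite covariance, and satisfies $\|x\|\le\vartheta$ almost surely. Let $Q_t\ge0$ ($0\le t\le N$), $R^u_t>0$, $R^w_t>0$ be symmetric weights. Gains $K=(K_t)_{t<N}$ with $K_t\in\mathbb R^{d\times m}$ and $L=(L_t)_{t<N}$ with $L_t\in\mathbb R^{n\times m}$ carry the Frobenius norms $\|K\|_F^2=\sum_t\|K_t\|_F^2$, $\|L\|_F^2=\sum_t\|L_t\|_F^2$; likewise $\|A\|_F,\|B\|_F,\|D\|_F$ for the sequences $(A_t),(B_t),(D_t)$. With $u_t=-K_tx_t$, $w_t=-L_tx_t$, let $$\mathcal G(K,L)=\mathbb E\Big[\sum_{t<N}x_t^\top(Q_t+K_t^\top R^u_tK_t-L_t^\top R^w_tL_t)x_t+x_N^\top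 Q_Nx_N\Big].$$ Let $\Sigma_0=\mathbb E[\mathrm{diag}(x_0x_0^\top,\xi_0\xi_0^\top,\dots,\xi_{N-1}\xi_{N-1}^\top)]$, $\phi=\lambda_{\min}(\Sigma_0)$, $c_0=(N+1)\vartheta^2$, $d_1=nmN$, $d_\Sigma=m^2(N+1)$. For a gain $K$ define $P_N=Q_N$ and $P_t=Q_t+K_t^\top R^u_tK_t+(A_t-B_tK_t)^\top\big(P_{t+1}+P_{t+1}D_t(R^w_t-D_t^\top P_{t+1}D_t)^{-1}D_t^\top P_{t+1}\big)(A_t-B_tK_t)$. Let $\mathcal K$ be the set of all $K$ for which this recursion is well defined with $P_t\ge0$ for all $t\le N$ and $R^w_t-D_t^\top P_{t+1}D_t>0$ for all $t<N$. For $K\in\mathcal K$ put $L(K)_t=(-R^w_t+D_t^\top P_{t+1}D_t)^{-1}D_t^\top P_{t+1}(A_t-B_tK_t)$ and $\mathcal L_K(a)=\{L:\mathcal G(K,L)\ge a\}$. Further let $H_{K,L}=\mathrm{diag}_{t<N}(R^w_t-D_t^\top P^{K,L}_{t+1}D_t)$, where $P^{K,L}_N=Q_N$ and $P^{K,L}_t=(A_t-B_tK_t-D_tL_t)^\top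 P^{K,L}_{t+1}(A_t-B_tK_t-D_tL_t)+Q_t+K_t^\top R^u_tK_t-L_t^\top R^w_tL_t$. *Algorithm.* Given $L_0$, a smoothing radius $r_1>0$, a batchsize $M_1\ge1$, a stepsize $\eta>0$ and a number of iterations $T$, for $l=0,\dots,T-1$ draw independently, for $i<M_1$, a gain $U^i_l$ uniformly distributed on the unit Frobenius sphere of the space of gains $L$, a trajectory of $(K,L_l+r_1U_l^i)$ with total cost $\overline{\mathcal G}^i_l$, and a trajectory $(x_t^{i})_{t\le N}$ of the unperturbed pair $(K,L_l)$, with fresh independent noises. Set $$\overline\nabla_l=\frac1{M_1}\sum_{i<M_1}\frac{d_1}{r_1}\overline{\mathcal G}^i_lU^i_l,\qquad \overline\Sigma_l=\frac1{M_1}\sum_{i<M_1}\mathrm{diag}\big(x_0^i(x_0^i)^\top,\dots,x_N^i(x_N^i)^\top\big),\qquad L_{l+1}=L_l+\eta\,\overline\nabla_l\overline\Sigma_l^{-1}$$ (blockwise, the $t$-th block of $L_{l+1}$ being $(L_l)_t+\eta(\overline\nabla_l)_t(\overline\Sigma_l)_{t}^{-1}$). One run uses $2M_1T$ trajectories. *Claim.*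 There is a real polynomial $p$ in five variables, depending only on $m,n,d,N$, such that for every such system and every $K\in\mathcal K$, with $c_{\Sigma_{K,L}}=c_0\,p(\|A\|_F,\|B\|_F,\|D\|_F,\|K\|_F,\|L\|_F)$ and $\varkappa_{K,L}=c_{\Sigma_{K,L}}+\phi/2$: 1. $L(K)$ is the unique maximizer of $\mathcal G(K,\cdot)$, and for every $L$ the trajectory of $(K,L)$ satisfies $\|\mathrm{diag}(x_0x_0^\top,\dots,x_Nx_N^\top)\|_F\le c_{\Sigma_{K,L}}$ almost surely. 2. There is $\mu_K>0$, depending only on $K$ and the system, with $\|\nabla_L\mathcal G(K,L)\|_F^2\ge\mu_K(\mathcal G(K,L(K))-\mathcal G(K,L))$ for all $L$, such that for every $a$ with $\mathcal L_K(a)\ne\varnothing$ the numbers $\overline\varkappa_a=\sup_{\mathcal L_K(a)}\varkappa_{K,L}$ and $\underline\varkappa_a=\inf_{\mathcal L_K(a)}\varkappa_{K,L}$ satisfy $0<\underline\varkappa_a\le\overline\varkappa_a<\infty$, and there are $l_{K,a},\psi_{K,a},\rho_{K,a}>0$, depending only on $K$, $a$ and the system, with $$|\mathcal G(K,L')-\mathcal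 G(K,L)|\le l_{K,a}\|L'-L\|_F,\qquad \|\nabla_L\mathcal G(K,L')-\nabla_L\mathcal G(K,L)\|_F\le\psi_{K,a}\|L'-L\|_F$$ whenever $L\in\mathcal L_K(a)$ and either $L'\in\mathcal L_K(a)$ or $\|L'-L\|_F\le\rho_{K,a}$, for which the following holds. Put $\theta_{K,a}=\min\{1/(2\psi_{K,a}),\rho_{K,a}/l_{K,a}\}$ and let $$0<\eta\le\min\Big\{\tfrac{\phi^2}{32\psi_{K,a}\overline\varkappa_a},\ \tfrac1{2\psi_{K,a}},\ \rho_{K,a}\Big[\tfrac{\sqrt{\mu_K}}{4(\underline\varkappa_a+1)}+\tfrac{2\psi_{K,a}}{\phi}+l_{K,a}+\tfrac{\phi\, l_{K,a}}2\Big]^{-1}\Big\}.$$ For $\epsilon_1\in(0,1)$ let $T=\big\lceil\frac{8\overline\varkappa_a}{\eta\mu_K}\log\frac2{\epsilon_1}\big\rceil$, and for $\delta_1\in(0,1)$ call $(r_1,M_1)$ admissible if $r_1>0$, $M_1\ge1$ and $$r_1\le\min\Big\{\tfrac{\phi\sqrt{\mu_K\epsilon_1}}{16\overline\varkappa_a\psi_{K,a}},\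 \tfrac{\phi\mu_K\theta_{K,a}\sqrt{\epsilon_1/2}}{32\overline\varkappa_a\psi_{K,a}},\ \rho_{K,a}\Big\},$$ $$M_1\ge\max\Big\{\Big(\mathcal G(K,L(K))+\tfrac{l_{K,a}}{\rho_{K,a}}\Big)^2\tfrac{64d_1^2(\overline\varkappa_a+1)^2}{\phi^2r_1^2\mu_K\epsilon_1},\ \tfrac{2\overline\varkappa_a^2}{\phi^2}\Big\}\log\Big(\tfrac{4T\max\{d_1,d_\Sigma\}}{\delta_1}\Big).$$ (a) For every $L_0$ with $\mathcal G(K,L_0)\ge a$, all $\epsilon_1,\delta_1\in(0,1)$ and every admissible $(r_1,M_1)$, with probability at least $1-\delta_1$ all $\overline\Sigma_l$, $l<T$, are invertible and the output $\overline L(K)=L_T$ satisfies $$\mathcal G(K,L_T)\ge\mathcal G(K,L(K))-\epsilon_1,\qquad \|L(K)-L_T\|_F\le\sqrt{\lambda_{\min}^{-1}(H_{K,L(K)})\,\epsilon_1}.$$ (b) There is a constant $C$, independent of $L_0$, $\epsilon_1$ and $\delta_1$, such that for all $\epsilon_1,\delta_1\in(0,1)$ there is an admissible $(r_1,M_1)$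 whose total number of sampled trajectories satisfies $2M_1T\le C\,\epsilon_1^{-2}\,\log^2(2/\epsilon_1)\,\log(2/\delta_1)$; that is, the total sample complexity is $\tilde O(\epsilon_1^{-2}\log(1/\delta_1))$. -/

import Mathlib

open MeasureTheory Matrix

/-- Sequences of `N` gain matrices of size `n × m`, i.e. the sparse compact gains
`[diag(L₀, …, L_{N-1}) 0]`. It is a Euclidean space of dimension `n * m * N` whose norm is the
Frobenius norm of the compact gain. -/
abbrev Gain (n m N : ℕ) : Type := EuclideanSpace ℝ (Fin N × Fin n × Fin m)

/-- The block `L_t` of a gain. -/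
def Gain.block {n m N : ℕ} (L : Gain n m N) (t : Fin N) : Matrix (Fin n) (Fin m) ℝ :=
  Matrix.of fun i j => L (t, i, j)

/-- The gain with prescribed blocks. -/
def Gain.ofBlocks {n m N : ℕ} (X : Fin N → Matrix (Fin n) (Fin m) ℝ) : Gain n m N :=
  WithLp.toLp 2 fun q => X q.1 q.2.1 q.2.2

/-- Frobenius norm of the block matrix whose nonzero blocks are `X 0, …, X (N-1)`. -/
noncomputable def frobNorm {k p q : ℕ} (X : Fin k → Matrix (Fin p) (Fin q) ℝ) : ℝ :=
  Real.sqrt (∑ t, ∑ i, ∑ j, X t i j ^ 2)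

/-- Smallest eigenvalue of a symmetric matrix. -/
noncomputable def lambdaMin {ι : Type*} [Fintype ι] [DecidableEq ι] (M : Matrix ι ι ℝ) : ℝ :=
  sInf (spectrum ℝ M)

/-- Uniform probability distribution on the unit Frobenius sphere of the space of gains. -/
noncomputable def sphereLaw (n m N : ℕ) : Measure (Gain n m N) :=
  (ProbabilityTheory.cond (volume : Measure (Gain n m N)).toSphere Set.univ).map Subtype.val

/-- A finite-horizon zero-sum linear-quadratic stochastic dynamic game
`x_{t+1} = A_t x_t + B_t u_t + D_t w_t + ξ_t`, where `x₀, ξ₀, …, ξ_{N-1}` are independent with the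
law `noise`, which is centred, has a positive definite covariance and is supported in the Euclidean
ball of radius `ϑ`. -/
structure LQGame (m n d N : ℕ) where
  A : Fin N → Matrix (Fin m) (Fin m) ℝ
  B : Fin N → Matrix (Fin m) (Fin d) ℝ
  D : Fin N → Matrix (Fin m) (Fin n) ℝ
  Q : Fin (N + 1) → Matrix (Fin m) (Fin m) ℝ
  Ru : Fin N → Matrix (Fin d) (Fin d) ℝ
  Rw : Fin N → Matrix (Fin n) (Fin n) ℝ
  Q_posSemidef : ∀ t, (Q t).PosSemidef
  Ru_posDef : ∀ t, (Ru t).PosDef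
  Rw_posDef : ∀ t, (Rw t).PosDef
  noise : Measure (Fin m → ℝ)
  isProbabilityMeasure_noise : IsProbabilityMeasure noise
  ϑ : ℝ
  noise_bounded : ∀ᵐ x ∂noise, ‖WithLp.toLp 2 x‖ ≤ ϑ
  noise_mean : ∀ i, ∫ x, x i ∂noise = 0
  noise_cov : (Matrix.of fun i j => ∫ x, x i * x j ∂noise).PosDef

attribute [instance] LQGame.isProbabilityMeasure_noise

namespace LQGame

variable {m n d N : ℕ} (S : LQGame m n d N)

/-- The law of the primitive noise vector `(x₀, ξ₀, …, ξ_{N-1})`. -/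
noncomputable def pathLaw : Measure (Fin (N + 1) → Fin m → ℝ) :=
  Measure.pi fun _ => S.noise

/-- `Σ₀ = E[diag(x₀x₀ᵀ, ξ₀ξ₀ᵀ, …, ξ_{N-1}ξ_{N-1}ᵀ)]`. -/
noncomputable def Sigma0 : Matrix (Fin m × Fin (N + 1)) (Fin m × Fin (N + 1)) ℝ :=
  Matrix.blockDiagonal fun _ => Matrix.of fun i j => ∫ x, x i * x j ∂S.noise

/-- `φ = λ_min(Σ₀)`. -/
noncomputable def phi : ℝ := lambdaMin S.Sigma0

/-- `c₀ = (N + 1) ϑ²`. -/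
def c0 : ℝ := (N + 1 : ℝ) * S.ϑ ^ 2

/-- `A_t - B_t K_t`. -/
def AK (K : Gain d m N) (t : Fin N) : Matrix (Fin m) (Fin m) ℝ :=
  S.A t - S.B t * K.block t

/-- `A_t - B_t K_t - D_t L_t`. -/
def AKL (K : Gain d m N) (L : Gain n m N) (t : Fin N) : Matrix (Fin m) (Fin m) ℝ :=
  S.AK K t - S.D t * L.block t

/-- `Q_t + K_tᵀ Rᵘ_t K_t`, for `t < N`. -/
def QK (K : Gain d m N) (t : Fin N) : Matrix (Fin m) (Fin m) ℝ :=
  S.Q t.castSucc + (K.block t)ᵀ * S.Ru t * K.block t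

/-- `Q_t + K_tᵀ Rᵘ_t K_t - L_tᵀ Rʷ_t L_t`, for `t < N`. -/
def QKL (K : Gain d m N) (L : Gain n m N) (t : Fin N) : Matrix (Fin m) (Fin m) ℝ :=
  S.QK K t - (L.block t)ᵀ * S.Rw t * L.block t

/-- The state trajectory `x₀, …, x_N` under `u_t = -K_t x_t`, `w_t = -L_t x_t`, driven by
`ξ = (x₀, ξ₀, …, ξ_{N-1})`. -/
def traj (K : Gain d m N) (L : Gain n m N) (ξ : Fin (N + 1) → Fin m → ℝ) :
    Fin (N + 1) → Fin m → ℝ :=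
  Fin.induction (ξ 0) fun t x => S.AKL K L t *ᵥ x + ξ t.succ

/-- Total cost along one trajectory. -/
def cost (K : Gain d m N) (L : Gain n m N) (ξ : Fin (N + 1) → Fin m → ℝ) : ℝ :=
  (∑ t : Fin N, S.traj K L ξ t.castSucc ⬝ᵥ S.QKL K L t *ᵥ S.traj K L ξ t.castSucc)
    + S.traj K L ξ (Fin.last N) ⬝ᵥ S.Q (Fin.last N) *ᵥ S.traj K L ξ (Fin.last N)

/-- The objective `𝒢(K, L)`: the expected total cost. -/
noncomputable def G (K : Gain d m N) (L : Gain n m N) : ℝ := ∫ ξ, S.cost K L ξ ∂S.pathLaw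

/-- The superlevel set `{L | 𝒢(K, L) ≥ a}`. -/
def superlevel (K : Gain d m N) (a : ℝ) : Set (Gain n m N) := {L | a ≤ S.G K L}

/-- The cost-to-go matrices `P_{K_t, L_t}`, from the backward Lyapunov recursion. -/
def P (K : Gain d m N) (L : Gain n m N) : Fin (N + 1) → Matrix (Fin m) (Fin m) ℝ :=
  Fin.reverseInduction (S.Q (Fin.last N))
    fun t Pnext => (S.AKL K L t)ᵀ * Pnext * S.AKL K L t + S.QKL K L t

/-- `H_{K,L} = Rʷ - Dᵀ P_{K,L} D`, a block-diagonal matrix. -/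
def H (K : Gain d m N) (L : Gain n m N) : Matrix (Fin n × Fin N) (Fin n × Fin N) ℝ :=
  Matrix.blockDiagonal fun t => S.Rw t - (S.D t)ᵀ * S.P K L t.succ * S.D t

/-- The matrices `P_{K_t, L(K_t)}`, from the backward Riccati recursion
`P_N = Q_N`, `P_t = Q_t + K_tᵀRᵘ_tK_t + (A_t - B_tK_t)ᵀ
  (P_{t+1} + P_{t+1}D_t(Rʷ_t - D_tᵀP_{t+1}D_t)⁻¹D_tᵀP_{t+1})(A_t - B_tK_t)`. -/
noncomputable def riccati (K : Gain d m N) : Fin (N + 1) → Matrix (Fin m) (Fin m) ℝ :=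
  Fin.reverseInduction (S.Q (Fin.last N))
    fun t Pnext => S.QK K t + (S.AK K t)ᵀ *
      (Pnext + Pnext * S.D t * (S.Rw t - (S.D t)ᵀ * Pnext * S.D t)⁻¹ * (S.D t)ᵀ * Pnext) * S.AK K t

/-- The feasible set `𝒦`: the Riccati equation has a positive semidefinite solution with
`Rʷ - DᵀPD > 0`. -/
def Feasible (K : Gain d m N) : Prop :=
  (∀ t, (S.riccati K t).PosSemidef) ∧
    ∀ t : Fin N, (S.Rw t - (S.D t)ᵀ * S.riccati K t.succ * S.D t).PosDef

/-- The inner-loop solution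
`L(K)_t = (-Rʷ_t + D_tᵀ P_{t+1} D_t)⁻¹ D_tᵀ P_{t+1} (A_t - B_t K_t)`. -/
noncomputable def innerSol (K : Gain d m N) : Gain n m N :=
  Gain.ofBlocks fun t =>
    (-S.Rw t + (S.D t)ᵀ * S.riccati K t.succ * S.D t)⁻¹ * (S.D t)ᵀ * S.riccati K t.succ * S.AK K t

/-- `(l, ψ, ρ)` are Lipschitz and smoothness constants of `𝒢(K, ·)`, both over the superlevel set of
level `a` and within distance `ρ` of each of its points. -/
def IsCurvature (K : Gain d m N) (a l ψ ρ : ℝ) : Prop :=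
  0 < l ∧ 0 < ψ ∧ 0 < ρ ∧
    ∀ L ∈ S.superlevel K a, ∀ L', (‖L' - L‖ ≤ ρ ∨ L' ∈ S.superlevel K a) →
      |S.G K L' - S.G K L| ≤ l * ‖L' - L‖ ∧
        ‖gradient (S.G K) L' - gradient (S.G K) L‖ ≤ ψ * ‖L' - L‖

/-- `𝒢(K, ·)` is `μ`-PL. -/
def IsPL (K : Gain d m N) (μ : ℝ) : Prop :=
  0 < μ ∧ ∀ L : Gain n m N,
    μ * (S.G K (S.innerSol K) - S.G K L) ≤ ‖gradient (S.G K) L‖ ^ 2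

/-- `c_{Σ_{K,L}} = c₀ p(‖A‖_F, ‖B‖_F, ‖D‖_F, ‖K‖_F, ‖L‖_F)`. -/
noncomputable def cSigma (p : MvPolynomial (Fin 5) ℝ) (K : Gain d m N) (L : Gain n m N) : ℝ :=
  S.c0 * MvPolynomial.eval ![frobNorm S.A, frobNorm S.B, frobNorm S.D, ‖K‖, ‖L‖] p

/-- `c_{Σ_{K,L}}` bounds `‖diag(x₀x₀ᵀ, …, x_Nx_Nᵀ)‖_F` almost surely, for every `L`. -/
def IsCovBound (p : MvPolynomial (Fin 5) ℝ) (K : Gain d m N) : Prop :=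
  ∀ L : Gain n m N, ∀ᵐ ξ ∂S.pathLaw,
    frobNorm (fun t => vecMulVec (S.traj K L ξ t) (S.traj K L ξ t)) ≤ S.cSigma p K L

/-- `ϰ = c_{Σ_{K,L}} + φ/2`. -/
noncomputable def kappa (p : MvPolynomial (Fin 5) ℝ) (K : Gain d m N) (L : Gain n m N) : ℝ :=
  S.cSigma p K L + S.phi / 2

/-- The largest value of `ϰ` on the superlevel set. -/
noncomputable def kappaSup (p : MvPolynomial (Fin 5) ℝ) (K : Gain d m N) (a : ℝ) : ℝ :=
  sSup (S.kappa p K '' S.superlevel K a)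

/-- The smallest value of `ϰ` on the superlevel set. -/
noncomputable def kappaInf (p : MvPolynomial (Fin 5) ℝ) (K : Gain d m N) (a : ℝ) : ℝ :=
  sInf (S.kappa p K '' S.superlevel K a)

/-- What one pass of the sampling loop draws: a direction `U` and the primitive noises of two
trajectories (perturbed and unperturbed). -/
abbrev Draw (m n N : ℕ) : Type :=
  Gain n m N × (Fin (N + 1) → Fin m → ℝ) × (Fin (N + 1) → Fin m → ℝ)

/-- The law of one draw: the three components are independent. -/
noncomputable def drawLaw : Measure (Draw m n N) :=
  (sphereLaw n m N).prod (S.pathLaw.prod S.pathLaw)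

/-- The law of all the draws of a run with `T` iterations and batchsize `M`: they are i.i.d. -/
noncomputable def runLaw (T M : ℕ) : Measure (Fin T → Fin M → Draw m n N) :=
  Measure.pi fun _ => Measure.pi fun _ => S.drawLaw

/-- The one-point minibatch gradient estimate
`(1/M) ∑ᵢ (d₁/r) 𝒢̄(K, L + r Uⁱ) Uⁱ`, `d₁ = nmN`. -/
noncomputable def gradEst (K : Gain d m N) (r : ℝ) {M : ℕ} (L : Gain n m N)
    (z : Fin M → Draw m n N) : Gain n m N :=
  (1 / M : ℝ) • ∑ i, (((n * m * N : ℕ) : ℝ) / r * S.cost K (L + r • (z i).1) (z i).2.1) • (z i).1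

/-- The `t`-th diagonal block of the estimate `Σ̄_{K,L}`, from the unperturbed trajectories. -/
noncomputable def covEst (K : Gain d m N) {M : ℕ} (L : Gain n m N) (z : Fin M → Draw m n N)
    (t : Fin (N + 1)) : Matrix (Fin m) (Fin m) ℝ :=
  (1 / M : ℝ) • ∑ i, vecMulVec (S.traj K L (z i).2.2 t) (S.traj K L (z i).2.2 t)

/-- One zeroth-order natural PG step `L + η ∇̄ Σ̄⁻¹` (`Σ̄` is block diagonal). -/
noncomputable def npgStep (K : Gain d m N) (r η : ℝ) {M : ℕ} (L : Gain n m N)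
    (z : Fin M → Draw m n N) : Gain n m N :=
  L + η • Gain.ofBlocks fun t => (S.gradEst K r L z).block t * (S.covEst K L z t.castSucc)⁻¹

/-- The iterates `L₀, …, L_T` of the zeroth-order natural PG method. -/
noncomputable def iterate (K : Gain d m N) (r η : ℝ) {T M : ℕ} (L₀ : Gain n m N)
    (ω : Fin T → Fin M → Draw m n N) : Fin (T + 1) → Gain n m N :=
  Fin.induction L₀ fun l L => S.npgStep K r η L (ω l)

end LQGame

/-- The number of iterations `⌈(8 ϰ̄ / (η μ)) log (2/ε)⌉`. -/
noncomputable def iterCount (κ η μ ε : ℝ) : ℕ :=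
  ⌈8 * κ / (η * μ) * Real.log (2 / ε)⌉₊

/-- The lower bound required of the batchsize; `d₁ = nmN` and `d₂ = m²(N+1)` are dimensions, `T` is the number of
iterations, `Gopt = 𝒢(K, L(K))`. -/
noncomputable def batchBound (d₁ d₂ T : ℕ) (Gopt φ μ l ρ κ r ε δ : ℝ) : ℝ :=
  max ((Gopt + l / ρ) ^ 2 * (64 * (d₁ : ℝ) ^ 2 * (κ + 1) ^ 2 / (φ ^ 2 * r ^ 2 * μ * ε)))
      (2 * κ ^ 2 / φ ^ 2)
    * Real.log (4 * (T : ℝ) * ((max d₁ d₂ : ℕ) : ℝ) / δ)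

/-- `θ = min {1/(2ψ), ρ/l}`. -/
noncomputable def thetaConst (l ψ ρ : ℝ) : ℝ := min (1 / (2 * ψ)) (ρ / l)

/-- The upper bound required of the smoothing radius. -/
noncomputable def radiusBound (φ μ l ψ ρ κ ε : ℝ) : ℝ :=
  min (φ * Real.sqrt (μ * ε) / (16 * κ * ψ))
    (min (φ * μ * thetaConst l ψ ρ * Real.sqrt (ε / 2) / (32 * κ * ψ)) ρ)

/-- The upper bound required of the stepsize. -/
noncomputable def stepBound (φ μ l ψ ρ κ κ' : ℝ) : ℝ :=
  min (φ ^ 2 / (32 * ψ * κ))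
    (min (1 / (2 * ψ))
      (ρ * (Real.sqrt μ / (4 * (κ' + 1)) + 2 * ψ / φ + l + φ * l / 2)⁻¹))

/-!
Expanding the stage values around a gain `L` gives the performance difference identity: with
`Δ_t = L'_t - L_t`, the difference `𝒢(K, L') - 𝒢(K, L)` equals
`∑ tr ((Δᵀ F + Fᵀ Δ - Δᵀ H Δ) Σ'_t)`, where `F` and `H` are taken at `L` and `Σ'_t = E[x_t x_tᵀ]` at
`L'` (`G_sub_G`). Everything about the landscape follows from it. The Riccati solution makes `F = 0`
at `L(K)`, so that the optimality gap is `∑ tr (Δᵀ H Δ Σ'_t)`; since `H > 0` and `Σ'_t ≥ φ`, the gap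
grows quadratically (`mul_norm_sq_le_gap`), the maximizer is unique and superlevel sets are compact.
The first order term gives the gradient `2 F_t Σ_t` (`gradient_G`), and completing the square in `Δ`
gives gradient domination (`phi_sq_mul_gap_le_norm_gradient_sq`). The objective is polynomial
in `L`, hence Lipschitz and smooth on balls (`exists_smoothness_constants`).

For the algorithm, the noise is bounded, so on a compact set of gains all costs and states are
bounded. The one-point gradient estimate is biased by `O(r)`, which needs only the first two moments
of the sphere (`abs_integral_one_point_sub_le`), and Hoeffding's inequality with a union bound over
entries controls the deviations (`measureReal_not_accurate_le`). As the draws of one iteration are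
independent of the current iterate, a union bound over iterations shows that with high probability
all estimates are accurate along the run (`one_sub_le_runLaw_accurate`). Accurate estimates make a
natural gradient step contract the gap by `1 - η μ₀ / (4 s)` up to the estimation error, where `μ₀`
is a gradient domination constant and `s` bounds the squared state (`gap_npgStep_le`); in particular
the iterates do not leave a slightly enlarged superlevel set.

It remains to choose the constants. The polynomial `p` is the square of a polynomial `y` for which
`ϑ² y` already bounds the squared state. The prescribed number of iterations is proportional to the
supremum `ϰ̄` of `ϰ`, and `ϰ̄ / s` is at least the largest value `y` of the root. The total
contraction exponent is therefore at least a multiple of `y log (2/ε)`, and this multiple is as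
large as one likes after replacing `μ₀` by a smaller admissible `μ`. Since the gap on a superlevel
set is at most a constant times `y²` (`exists_gap_le`), every initial gap is contracted below
`ε min(1, φ) / 2` (`one_sub_pow_mul_le`). Enlarging `ψ` makes stepsize and bias small enough, and
enlarging `l` makes the batchsize large enough (`exists_curvature_and_convergence`). A final gap of
at most `ε min(1, φ)` yields both the value and, by quadratic growth, the distance estimate. For the
number of trajectories, a radius of order `√ε` requires batches of order `ε⁻²` up to logarithms
(`exists_sample_complexity`).
-/

/-! ### Positive semidefinite matrices -/

section PosSemidefinite

variable {ι κ : Type*} [Fintype ι] [Fintype κ]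

open scoped MatrixOrder in
lemma Matrix.PosSemidef.trace_mul_nonneg [DecidableEq ι] {X C : Matrix ι ι ℝ} (hX : X.PosSemidef)
    (hC : C.PosSemidef) : 0 ≤ (X * C).trace := by
  obtain ⟨B, rfl⟩ := CStarAlgebra.nonneg_iff_eq_star_mul_self.mp hC.nonneg
  rw [star_eq_conjTranspose, ← Matrix.mul_assoc, Matrix.trace_mul_comm, ← Matrix.mul_assoc]
  exact (hX.mul_mul_conjTranspose_same B).trace_nonneg

lemma Matrix.trace_mul_le_of_sub_posSemidef [DecidableEq ι] {X Y C : Matrix ι ι ℝ}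
    (h : (Y - X).PosSemidef) (hC : C.PosSemidef) : (X * C).trace ≤ (Y * C).trace := by
  have := h.trace_mul_nonneg hC
  rw [Matrix.sub_mul, Matrix.trace_sub] at this
  linarith

lemma Matrix.mul_trace_le_trace_mul [DecidableEq ι] {X C : Matrix ι ι ℝ} {c : ℝ}
    (hX : X.PosSemidef) (hC : (C - c • (1 : Matrix ι ι ℝ)).PosSemidef) :
    c * X.trace ≤ (X * C).trace := by
  have := hX.trace_mul_nonneg hC
  rw [Matrix.mul_sub, Matrix.trace_sub, Matrix.mul_smul, Matrix.trace_smul, Matrix.mul_one,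
    smul_eq_mul] at this
  linarith

lemma Matrix.trace_mul_le_mul_trace [DecidableEq ι] {X C : Matrix ι ι ℝ} {c : ℝ}
    (hX : X.PosSemidef) (hC : (c • (1 : Matrix ι ι ℝ) - C).PosSemidef) :
    (X * C).trace ≤ c * X.trace := by
  have := hX.trace_mul_nonneg hC
  rw [Matrix.mul_sub, Matrix.trace_sub, Matrix.mul_smul, Matrix.trace_smul, Matrix.mul_one,
    smul_eq_mul] at this
  linarith

lemma Matrix.posSemidef_of_quadForm_nonneg {M : Matrix ι ι ℝ} (hM : Mᵀ = M)
    (h : ∀ v : ι → ℝ, 0 ≤ v ⬝ᵥ M *ᵥ v) : M.PosSemidef :=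
  .of_dotProduct_mulVec_nonneg (by simpa [IsHermitian] using hM) (by simpa using h)

lemma Matrix.PosSemidef.quadForm_nonneg {M : Matrix ι ι ℝ} (hM : M.PosSemidef) (v : ι → ℝ) :
    0 ≤ v ⬝ᵥ M *ᵥ v := by
  simpa using hM.dotProduct_mulVec_nonneg v

lemma Matrix.PosSemidef.transpose_eq {σ : Type*} {M : Matrix σ σ ℝ} (hM : M.PosSemidef) :
    Mᵀ = M := by
  simpa [IsHermitian] using hM.isHermitian

lemma Matrix.PosSemidef.transpose_mul_mul_same {M : Matrix ι ι ℝ} (hM : M.PosSemidef)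
    (B : Matrix ι κ ℝ) : (Bᵀ * M * B).PosSemidef := by
  simpa using hM.conjTranspose_mul_mul_same B

lemma Matrix.PosSemidef.mul_mul_transpose_same {M : Matrix ι ι ℝ} (hM : M.PosSemidef)
    (B : Matrix κ ι ℝ) : (B * M * Bᵀ).PosSemidef := by
  simpa using hM.mul_mul_conjTranspose_same B

lemma Matrix.posSemidef_transpose_mul_self (B : Matrix ι κ ℝ) : (Bᵀ * B).PosSemidef := by
  simpa using posSemidef_conjTranspose_mul_self B

lemma Matrix.trace_transpose_mul_self_eq (B : Matrix ι κ ℝ) :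
    (Bᵀ * B).trace = ∑ i, ∑ j, B i j ^ 2 := by
  simp only [Matrix.trace, Matrix.diag, Matrix.mul_apply, Matrix.transpose_apply]
  rw [Finset.sum_comm]
  simp [sq]

/-- A symmetric real matrix dominates its smallest eigenvalue. -/
lemma sub_lambdaMin_posSemidef [DecidableEq ι] {M : Matrix ι ι ℝ} (hM : M.IsHermitian) :
    (M - lambdaMin M • (1 : Matrix ι ι ℝ)).PosSemidef := by
  rw [posSemidef_iff_isHermitian_and_spectrum_nonneg]
  refine ⟨hM.sub ?_, ?_⟩
  · simp [IsHermitian]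
  · intro a ha
    rw [← Algebra.algebraMap_eq_smul_one, ← spectrum.sub_singleton_eq] at ha
    obtain ⟨b, hb, c, hc, rfl⟩ := Set.mem_sub.1 ha
    rw [Set.mem_singleton_iff] at hc
    subst hc
    have hfin : (spectrum ℝ M).Finite := by
      rw [hM.spectrum_real_eq_range_eigenvalues]
      exact Set.finite_range _
    exact sub_nonneg.2 (csInf_le hfin.bddBelow hb)

lemma lambdaMin_pos [DecidableEq ι] [Nonempty ι] {M : Matrix ι ι ℝ} (hM : M.PosDef) :
    0 < lambdaMin M := by
  have hs := hM.isHermitian.spectrum_real_eq_range_eigenvalues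
  have hmem : lambdaMin M ∈ spectrum ℝ M := by
    refine Set.Nonempty.csInf_mem ?_ ?_
    · rw [hs]; exact Set.range_nonempty _
    · rw [hs]; exact Set.finite_range _
  rw [hs] at hmem
  obtain ⟨i, hi⟩ := hmem
  rw [← hi]
  exact hM.eigenvalues_pos i

lemma Matrix.blockDiagonal_posDef [DecidableEq ι] [DecidableEq κ] {X : κ → Matrix ι ι ℝ}
    (hX : ∀ t, (X t).PosDef) : (blockDiagonal X).PosDef := by
  refine .of_dotProduct_mulVec_pos
    (isHermitian_blockDiagonal_iff.2 fun t => (hX t).isHermitian) fun v hv => ?_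
  have key : star v ⬝ᵥ blockDiagonal X *ᵥ v
      = ∑ t, (fun i => v (i, t)) ⬝ᵥ X t *ᵥ (fun i => v (i, t)) := by
    simp only [dotProduct, mulVec, Fintype.sum_prod_type, blockDiagonal_apply, star_trivial]
    rw [Finset.sum_comm]
    refine Finset.sum_congr rfl fun t _ => Finset.sum_congr rfl fun i _ => ?_
    congr 1
    refine Finset.sum_congr rfl fun j _ => ?_
    simp
  rw [key]
  have hnn : ∀ t, 0 ≤ (fun i => v (i, t)) ⬝ᵥ X t *ᵥ (fun i => v (i, t)) := fun t =>
    (hX t).posSemidef.quadForm_nonneg _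
  obtain ⟨⟨i, t⟩, hit⟩ : ∃ q, v q ≠ 0 := by
    by_contra! h
    exact hv (funext h)
  refine Finset.sum_pos' (fun t _ => hnn t) ⟨t, Finset.mem_univ _, ?_⟩
  have := (hX t).dotProduct_mulVec_pos (x := fun i => v (i, t)) (fun h => hit (congrFun h i))
  simpa using this

/-- Each block of a block diagonal matrix dominates the smallest eigenvalue of the whole matrix. -/
lemma block_sub_lambdaMin_posSemidef [DecidableEq ι] [DecidableEq κ] {X : κ → Matrix ι ι ℝ}
    (hX : ∀ t, (X t).PosDef) (t : κ) :
    (X t - lambdaMin (blockDiagonal X) • (1 : Matrix ι ι ℝ)).PosSemidef := by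
  have h := (sub_lambdaMin_posSemidef (Matrix.blockDiagonal_posDef hX).isHermitian).submatrix
    (fun i => (i, t))
  convert h using 1
  ext i j
  simp [Matrix.one_apply, blockDiagonal_apply]

lemma Matrix.abs_quadForm_le_of_entries {E : Matrix ι ι ℝ} {s : ℝ} (hE : ∀ i j, |E i j| ≤ s)
    (v : ι → ℝ) : |v ⬝ᵥ E *ᵥ v| ≤ Fintype.card ι * s * (v ⬝ᵥ v) := by
  have h1 : v ⬝ᵥ E *ᵥ v = ∑ i, ∑ j, v i * E i j * v j := by
    simp only [dotProduct, mulVec, Finset.mul_sum, mul_assoc]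
  rw [h1]
  calc |∑ i, ∑ j, v i * E i j * v j| ≤ ∑ i, ∑ j, |v i * E i j * v j| :=
        (Finset.abs_sum_le_sum_abs _ _).trans
          (Finset.sum_le_sum fun i _ => Finset.abs_sum_le_sum_abs _ _)
    _ ≤ ∑ i, ∑ j, s * ((v i ^ 2 + v j ^ 2) / 2) := by
        refine Finset.sum_le_sum fun i _ => Finset.sum_le_sum fun j _ => ?_
        rw [abs_mul, abs_mul]
        have h2 := two_mul_le_add_sq |v i| |v j|
        rw [sq_abs, sq_abs] at h2
        calc |v i| * |E i j| * |v j| = |E i j| * (|v i| * |v j|) := by ring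
          _ ≤ s * ((v i ^ 2 + v j ^ 2) / 2) :=
            mul_le_mul (hE i j) (by linarith) (by positivity) ((abs_nonneg _).trans (hE i j))
    _ = Fintype.card ι * s * (v ⬝ᵥ v) := by
        simp only [← Finset.mul_sum, ← Finset.sum_div, Finset.sum_add_distrib, Finset.sum_const,
          Finset.card_univ, nsmul_eq_mul, dotProduct, ← sq]
        ring

lemma Matrix.posSemidef_smul_one_sub_of_entries [DecidableEq ι] {E : Matrix ι ι ℝ} {s : ℝ}
    (hsymm : Eᵀ = E) (hE : ∀ i j, |E i j| ≤ s) :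
    ((Fintype.card ι * s) • (1 : Matrix ι ι ℝ) - E).PosSemidef := by
  refine posSemidef_of_quadForm_nonneg (by simp [hsymm]) fun v => ?_
  have := (abs_le.1 (abs_quadForm_le_of_entries hE v)).2
  simp only [sub_mulVec, smul_mulVec, one_mulVec, dotProduct_sub, dotProduct_smul, smul_eq_mul]
  linarith

end PosSemidefinite

/-! ### The performance difference identity -/

@[simp] lemma Gain.block_ofBlocks {n m N : ℕ} (X : Fin N → Matrix (Fin n) (Fin m) ℝ) (t : Fin N) :
    (Gain.ofBlocks X).block t = X t := rfl

@[simp] lemma Gain.block_zero {n m N : ℕ} (t : Fin N) : (0 : Gain n m N).block t = 0 := rfl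

lemma Gain.block_sub {n m N : ℕ} (L L' : Gain n m N) (t : Fin N) :
    (L - L').block t = L.block t - L'.block t := rfl

lemma Gain.norm_sq_eq {n m N : ℕ} (L : Gain n m N) :
    ‖L‖ ^ 2 = ∑ t, ((L.block t)ᵀ * L.block t).trace := by
  rw [EuclideanSpace.norm_sq_eq, Fintype.sum_prod_type]
  refine Finset.sum_congr rfl fun t _ => ?_
  rw [Matrix.trace_transpose_mul_self_eq, Fintype.sum_prod_type]
  simp [Gain.block]

namespace LQGame

variable {m n d N : ℕ} (S : LQGame m n d N)

/-- The covariance of the noise. -/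
noncomputable def noiseCov : Matrix (Fin m) (Fin m) ℝ :=
  Matrix.of fun i j => ∫ x, x i * x j ∂S.noise

/-- The second moments `E[x_t x_tᵀ]` of the state, from the forward Lyapunov recursion. -/
noncomputable def stateCov (K : Gain d m N) (L : Gain n m N) :
    Fin (N + 1) → Matrix (Fin m) (Fin m) ℝ :=
  Fin.induction S.noiseCov fun t C => S.AKL K L t * C * (S.AKL K L t)ᵀ + S.noiseCov

/-- The `t`-th block of `H_{K,L}`. -/
def Hblock (K : Gain d m N) (L : Gain n m N) (t : Fin N) : Matrix (Fin n) (Fin n) ℝ :=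
  S.Rw t - (S.D t)ᵀ * S.P K L t.succ * S.D t

/-- Half the derivative of the stage value `-|L_t x|²_{Rʷ} + |(A_t - B_tK_t - D_tL_t) x|²_{P_{t+1}}`
with respect to the action, as a matrix acting on the state `x`; it vanishes for all `t` exactly
when `L` is stationary. -/
def actionGrad (K : Gain d m N) (L : Gain n m N) (t : Fin N) : Matrix (Fin n) (Fin m) ℝ :=
  -(S.Hblock K L t * L.block t + (S.D t)ᵀ * S.P K L t.succ * S.AK K t)

lemma P_last (K : Gain d m N) (L : Gain n m N) : S.P K L (Fin.last N) = S.Q (Fin.last N) := by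
  simp [P]

lemma P_castSucc (K : Gain d m N) (L : Gain n m N) (t : Fin N) : S.P K L t.castSucc
    = (S.AKL K L t)ᵀ * S.P K L t.succ * S.AKL K L t + S.QKL K L t := by
  simp [P]

lemma riccati_last (K : Gain d m N) : S.riccati K (Fin.last N) = S.Q (Fin.last N) := by
  simp [riccati]

lemma riccati_castSucc (K : Gain d m N) (t : Fin N) : S.riccati K t.castSucc
    = S.QK K t + (S.AK K t)ᵀ * (S.riccati K t.succ + S.riccati K t.succ * S.D t *
        (S.Rw t - (S.D t)ᵀ * S.riccati K t.succ * S.D t)⁻¹ * (S.D t)ᵀ * S.riccati K t.succ)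
          * S.AK K t := by
  simp [riccati]

lemma stateCov_zero (K : Gain d m N) (L : Gain n m N) : S.stateCov K L 0 = S.noiseCov := by
  simp [stateCov]

lemma stateCov_succ (K : Gain d m N) (L : Gain n m N) (t : Fin N) : S.stateCov K L t.succ
    = S.AKL K L t * S.stateCov K L t.castSucc * (S.AKL K L t)ᵀ + S.noiseCov := by
  simp [stateCov]

lemma Q_transpose (t : Fin (N + 1)) : (S.Q t)ᵀ = S.Q t := (S.Q_posSemidef t).transpose_eq

lemma Ru_transpose (t : Fin N) : (S.Ru t)ᵀ = S.Ru t := (S.Ru_posDef t).posSemidef.transpose_eq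

lemma Rw_transpose (t : Fin N) : (S.Rw t)ᵀ = S.Rw t := (S.Rw_posDef t).posSemidef.transpose_eq

lemma P_transpose (K : Gain d m N) (L : Gain n m N) (t : Fin (N + 1)) :
    (S.P K L t)ᵀ = S.P K L t := by
  induction t using Fin.reverseInduction with
  | last => rw [P_last, Q_transpose]
  | cast t ih =>
    rw [P_castSucc]
    simp [QKL, QK, Matrix.mul_assoc, ih, Q_transpose, Ru_transpose, Rw_transpose]

/-- Completion of the stage value around the gain `L`. -/
lemma stage_expansion (K : Gain d m N) (L L' : Gain n m N) (t : Fin N) :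
    S.QKL K L' t + (S.AKL K L' t)ᵀ * S.P K L t.succ * S.AKL K L' t - S.P K L t.castSucc
      = ((L' - L).block t)ᵀ * S.actionGrad K L t + (S.actionGrad K L t)ᵀ * (L' - L).block t
        - ((L' - L).block t)ᵀ * S.Hblock K L t * (L' - L).block t := by
  rw [P_castSucc, Gain.block_sub]
  simp only [actionGrad, Hblock, QKL, AKL, transpose_sub, transpose_add, transpose_neg,
    transpose_mul, transpose_transpose, P_transpose, Rw_transpose]
  simp only [Matrix.mul_add, Matrix.add_mul, Matrix.mul_sub, Matrix.sub_mul, Matrix.mul_neg,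
    Matrix.neg_mul, Matrix.mul_assoc]
  abel

/-- The stage expansions at `L`, summed along the second moments of the gain `L'`. The matrices
`P` and `Hblock` are taken at `L`, and the terms in `P` telescope. -/
lemma sum_trace_P_mul (K : Gain d m N) (L L' : Gain n m N) :
    (∑ t : Fin N, (S.QKL K L' t * S.stateCov K L' t.castSucc).trace)
        + (S.Q (Fin.last N) * S.stateCov K L' (Fin.last N)).trace
      = (∑ t : Fin (N + 1), (S.P K L t * S.noiseCov).trace)
        + ∑ t : Fin N, ((((L' - L).block t)ᵀ * S.actionGrad K L t
            + (S.actionGrad K L t)ᵀ * (L' - L).block t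
            - ((L' - L).block t)ᵀ * S.Hblock K L t * (L' - L).block t)
            * S.stateCov K L' t.castSucc).trace := by
  have h1 := Fin.sum_univ_succ fun t => (S.P K L t * S.stateCov K L' t).trace
  have h2 := Fin.sum_univ_castSucc fun t => (S.P K L t * S.stateCov K L' t).trace
  have h3 := Fin.sum_univ_succ fun t => (S.P K L t * S.noiseCov).trace
  simp only [stateCov_succ, stateCov_zero, Matrix.mul_add, Matrix.trace_add,
    Finset.sum_add_distrib] at h1
  have h4 : ∀ t : Fin N, (S.P K L t.succ * (S.AKL K L' t * S.stateCov K L' t.castSucc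
      * (S.AKL K L' t)ᵀ)).trace = ((S.AKL K L' t)ᵀ * S.P K L t.succ * S.AKL K L' t
        * S.stateCov K L' t.castSucc).trace := by
    intro t
    rw [← Matrix.mul_assoc, Matrix.trace_mul_comm]
    simp only [Matrix.mul_assoc]
  simp only [h4] at h1
  simp only [← stage_expansion, Matrix.sub_mul, Matrix.add_mul, Matrix.trace_sub,
    Matrix.trace_add, Finset.sum_add_distrib, Finset.sum_sub_distrib]
  rw [P_last] at h2
  linarith

end LQGame

/-! ### Trajectory bounds -/

section Frobenius

attribute [local instance] Matrix.frobeniusNormedAddCommGroup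

lemma Matrix.frobenius_norm_sq_eq {p q : ℕ} (M : Matrix (Fin p) (Fin q) ℝ) :
    ‖M‖ ^ 2 = ∑ i, ∑ j, M i j ^ 2 := by
  rw [Matrix.frobenius_norm_def, ← Real.sqrt_eq_rpow, Real.sq_sqrt (by positivity)]
  simp

lemma norm_toLp_mulVec_le {p q : ℕ} (M : Matrix (Fin p) (Fin q) ℝ) (x : Fin q → ℝ) :
    ‖WithLp.toLp 2 (M *ᵥ x)‖ ≤ ‖M‖ * ‖WithLp.toLp 2 x‖ := by
  refine le_of_sq_le_sq ?_ (by positivity)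
  rw [mul_pow, frobenius_norm_sq_eq, EuclideanSpace.norm_sq_eq, EuclideanSpace.norm_sq_eq,
    Finset.sum_mul]
  refine Finset.sum_le_sum fun i _ => ?_
  simpa [mulVec, dotProduct] using Finset.sum_mul_sq_le_sq_mul_sq Finset.univ (M i) x

lemma frobenius_norm_le_frobNorm {k p q : ℕ} (X : Fin k → Matrix (Fin p) (Fin q) ℝ) (t : Fin k) :
    ‖X t‖ ≤ frobNorm X := by
  refine Real.le_sqrt_of_sq_le ?_
  rw [frobenius_norm_sq_eq]
  exact Finset.single_le_sum (f := fun t => ∑ i, ∑ j, X t i j ^ 2)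
    (fun t _ => by positivity) (Finset.mem_univ t)

lemma Gain.frobenius_norm_block_le {n m N : ℕ} (L : Gain n m N) (t : Fin N) :
    ‖L.block t‖ ≤ ‖L‖ := by
  refine le_of_sq_le_sq ?_ (by positivity)
  rw [Gain.norm_sq_eq, frobenius_norm_sq_eq, ← Matrix.trace_transpose_mul_self_eq]
  exact Finset.single_le_sum (f := fun t => ((L.block t)ᵀ * L.block t).trace)
    (fun t _ => (posSemidef_transpose_mul_self _).trace_nonneg) (Finset.mem_univ t)

lemma frobNorm_nonneg {k p q : ℕ} (X : Fin k → Matrix (Fin p) (Fin q) ℝ) : 0 ≤ frobNorm X :=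
  Real.sqrt_nonneg _

end Frobenius

namespace LQGame

variable {m n d N : ℕ} (S : LQGame m n d N)

/-- The growth factor `1 + ‖A‖ + ‖B‖‖K‖ + ‖D‖ℓ`: a bound on how much one step of the closed loop
stretches the state (relative to the noise bound) when `‖L‖ ≤ ℓ`. -/
noncomputable def growth (K : Gain d m N) (ℓ : ℝ) : ℝ :=
  1 + frobNorm S.A + frobNorm S.B * ‖K‖ + frobNorm S.D * ℓ

lemma one_le_growth (K : Gain d m N) {ℓ : ℝ} (hℓ : 0 ≤ ℓ) : 1 ≤ S.growth K ℓ := by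
  have h1 := frobNorm_nonneg S.A
  have h2 := mul_nonneg (frobNorm_nonneg S.B) (norm_nonneg K)
  have h3 := mul_nonneg (frobNorm_nonneg S.D) hℓ
  rw [growth]; linarith

section
attribute [local instance] Matrix.frobeniusNormedAddCommGroup

lemma frobenius_norm_AKL_le (K : Gain d m N) (L : Gain n m N) (t : Fin N) :
    ‖S.AKL K L t‖ ≤ S.growth K ‖L‖ - 1 := by
  have hB : ‖S.B t * K.block t‖ ≤ frobNorm S.B * ‖K‖ :=
    (frobenius_norm_mul _ _).trans (mul_le_mul (frobenius_norm_le_frobNorm _ _)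
      (Gain.frobenius_norm_block_le _ _) (norm_nonneg _) (frobNorm_nonneg _))
  have hD : ‖S.D t * L.block t‖ ≤ frobNorm S.D * ‖L‖ :=
    (frobenius_norm_mul _ _).trans (mul_le_mul (frobenius_norm_le_frobNorm _ _)
      (Gain.frobenius_norm_block_le _ _) (norm_nonneg _) (frobNorm_nonneg _))
  have hA := frobenius_norm_le_frobNorm S.A t
  have h1 := norm_sub_le (S.A t - S.B t * K.block t) (S.D t * L.block t)
  have h2 := norm_sub_le (S.A t) (S.B t * K.block t)
  rw [AKL, AK, growth]
  linarith

lemma norm_AKL_mulVec_le (K : Gain d m N) (L : Gain n m N) (t : Fin N) (x : Fin m → ℝ) :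
    ‖WithLp.toLp 2 (S.AKL K L t *ᵥ x)‖ ≤ (S.growth K ‖L‖ - 1) * ‖WithLp.toLp 2 x‖ :=
  (norm_toLp_mulVec_le _ _).trans
    (mul_le_mul_of_nonneg_right (S.frobenius_norm_AKL_le K L t) (norm_nonneg _))

end

@[simp] lemma traj_zero (K : Gain d m N) (L : Gain n m N) (ξ : Fin (N + 1) → Fin m → ℝ) :
    S.traj K L ξ 0 = ξ 0 := rfl

@[simp] lemma traj_succ (K : Gain d m N) (L : Gain n m N) (ξ : Fin (N + 1) → Fin m → ℝ)
    (t : Fin N) : S.traj K L ξ t.succ = S.AKL K L t *ᵥ S.traj K L ξ t.castSucc + ξ t.succ := by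
  simp [traj]

/-- The set of noise paths obeying the almost sure bound. -/
def boundedPaths : Set (Fin (N + 1) → Fin m → ℝ) := {ξ | ∀ t, ‖WithLp.toLp 2 (ξ t)‖ ≤ S.ϑ}

lemma norm_traj_le (K : Gain d m N) (L : Gain n m N) {ξ : Fin (N + 1) → Fin m → ℝ}
    (hξ : ξ ∈ S.boundedPaths) (t : Fin (N + 1)) :
    ‖WithLp.toLp 2 (S.traj K L ξ t)‖ ≤ S.ϑ * S.growth K ‖L‖ ^ (t : ℕ) := by
  induction t using Fin.induction with
  | zero => simpa using hξ 0
  | succ t ih =>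
    have hg := S.one_le_growth K (norm_nonneg L)
    have h0 : 0 ≤ S.ϑ := (norm_nonneg _).trans (hξ 0)
    have hp : 1 ≤ S.growth K ‖L‖ ^ (t : ℕ) := one_le_pow₀ hg
    rw [traj_succ, WithLp.toLp_add]
    refine (norm_add_le _ _).trans ?_
    calc _ ≤ (S.growth K ‖L‖ - 1) * (S.ϑ * S.growth K ‖L‖ ^ (t : ℕ)) + S.ϑ :=
          add_le_add ((S.norm_AKL_mulVec_le K L t _).trans
            (mul_le_mul_of_nonneg_left ih (by linarith))) (hξ _)
      _ ≤ S.ϑ * S.growth K ‖L‖ ^ (t.succ : ℕ) := by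
          rw [Fin.val_succ, pow_succ]
          nlinarith [mul_nonneg h0 (sub_nonneg.2 hp)]

lemma norm_traj_sq_le (K : Gain d m N) (L : Gain n m N) {ξ : Fin (N + 1) → Fin m → ℝ}
    (hξ : ξ ∈ S.boundedPaths) (t : Fin (N + 1)) :
    ‖WithLp.toLp 2 (S.traj K L ξ t)‖ ^ 2 ≤ S.ϑ ^ 2 * S.growth K ‖L‖ ^ (2 * N) := by
  have h0 : 0 ≤ S.ϑ := (norm_nonneg _).trans (hξ 0)
  have hg := S.one_le_growth K (norm_nonneg L)
  have h : ‖WithLp.toLp 2 (S.traj K L ξ t)‖ ≤ S.ϑ * S.growth K ‖L‖ ^ N :=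
    (S.norm_traj_le K L hξ t).trans (mul_le_mul_of_nonneg_left
      (pow_le_pow_right₀ hg (Nat.lt_succ_iff.1 t.2)) h0)
  calc _ ≤ (S.ϑ * S.growth K ‖L‖ ^ N) ^ 2 := by gcongr
    _ = _ := by rw [mul_pow, ← pow_mul, mul_comm N]

lemma ae_mem_boundedPaths : ∀ᵐ ξ ∂S.pathLaw, ξ ∈ S.boundedPaths := by
  refine ae_all_iff.2 fun t => ?_
  exact (measurePreserving_eval (fun _ : Fin (N + 1) => S.noise) t).quasiMeasurePreserving.ae
    S.noise_bounded

instance : IsProbabilityMeasure S.pathLaw := by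
  unfold pathLaw; infer_instance

lemma isCompact_boundedPaths : IsCompact S.boundedPaths := by
  refine Metric.isCompact_of_isClosed_isBounded ?_ ?_
  · have : S.boundedPaths = ⋂ t, {ξ | ‖WithLp.toLp 2 (ξ t)‖ ≤ S.ϑ} := by
      ext; simp [boundedPaths]
    rw [this]
    refine isClosed_iInter fun t => isClosed_le (Continuous.norm ?_) continuous_const
    exact (PiLp.continuous_toLp 2 _).comp (continuous_apply t)
  · refine (Metric.isBounded_closedBall (x := 0) (r := S.ϑ)).subset fun ξ hξ => ?_
    have h0 : 0 ≤ S.ϑ := (norm_nonneg _).trans (hξ 0)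
    rw [mem_closedBall_zero_iff, pi_norm_le_iff_of_nonneg h0]
    intro t
    rw [pi_norm_le_iff_of_nonneg h0]
    intro i
    exact (PiLp.norm_apply_le (WithLp.toLp 2 (ξ t)) i).trans (hξ t)

lemma boundedPaths_nonempty : S.boundedPaths.Nonempty := S.ae_mem_boundedPaths.exists

/-! ### Second moments of the state and the cost as a trace -/

lemma integrable_of_continuous {f : (Fin (N + 1) → Fin m → ℝ) → ℝ} (hf : Continuous f) :
    Integrable f S.pathLaw := by
  obtain ⟨C, hC⟩ := S.isCompact_boundedPaths.exists_bound_of_continuousOn hf.continuousOn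
  refine Integrable.of_bound hf.aestronglyMeasurable C ?_
  filter_upwards [S.ae_mem_boundedPaths] with ξ hξ using hC ξ hξ

lemma continuous_block (t : Fin N) : Continuous fun L : Gain n m N => L.block t := by
  refine continuous_matrix fun i j => ?_
  simp only [Gain.block, of_apply]
  fun_prop

lemma continuous_AKL (K : Gain d m N) (t : Fin N) :
    Continuous fun L : Gain n m N => S.AKL K L t := by
  unfold AKL
  exact continuous_const.sub (continuous_const.matrix_mul (continuous_block t))

lemma continuous_QKL (K : Gain d m N) (t : Fin N) :
    Continuous fun L : Gain n m N => S.QKL K L t := by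
  unfold QKL
  exact continuous_const.sub (((continuous_block t).matrix_transpose.matrix_mul
    continuous_const).matrix_mul (continuous_block t))

lemma continuous_traj (K : Gain d m N) (t : Fin (N + 1)) :
    Continuous fun p : Gain n m N × (Fin (N + 1) → Fin m → ℝ) => S.traj K p.1 p.2 t := by
  induction t using Fin.induction with
  | zero => simp only [traj_zero]; fun_prop
  | succ t ih =>
    simp only [traj_succ]
    refine Continuous.add (Continuous.matrix_mulVec ?_ ih) (by fun_prop)
    exact (S.continuous_AKL K t).comp continuous_fst

lemma continuous_cost (K : Gain d m N) :
    Continuous fun p : Gain n m N × (Fin (N + 1) → Fin m → ℝ) => S.cost K p.1 p.2 := by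
  unfold cost
  refine Continuous.add (continuous_finsetSum _ fun t _ => ?_) ?_
  · exact (S.continuous_traj K _).dotProduct (Continuous.matrix_mulVec
      ((S.continuous_QKL K t).comp continuous_fst) (S.continuous_traj K _))
  · exact (S.continuous_traj K _).dotProduct (continuous_const.matrix_mulVec
      (S.continuous_traj K _))

lemma continuous_traj_right (K : Gain d m N) (L : Gain n m N) (t : Fin (N + 1)) (i : Fin m) :
    Continuous fun ξ => S.traj K L ξ t i :=
  (continuous_apply i).comp
    ((S.continuous_traj K t).comp (Continuous.prodMk continuous_const continuous_id))

lemma integral_noise_mul_noise_same (t : Fin (N + 1)) (i j : Fin m) :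
    ∫ ξ, ξ t i * ξ t j ∂S.pathLaw = S.noiseCov i j := by
  have h := measurePreserving_eval (fun _ : Fin (N + 1) => S.noise) t
  have hm : AEStronglyMeasurable (fun x : Fin m → ℝ => x i * x j)
      (Measure.map (Function.eval t) (Measure.pi fun _ : Fin (N + 1) => S.noise)) :=
    Continuous.aestronglyMeasurable (by fun_prop)
  have := integral_map h.measurable.aemeasurable hm
  rw [h.map_eq] at this
  exact this.symm

lemma integral_noise_mul_noise_of_ne {s t : Fin (N + 1)} (hst : s ≠ t) (i j : Fin m) :
    ∫ ξ, ξ s i * ξ t j ∂S.pathLaw = 0 := by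
  have hind : ProbabilityTheory.iIndepFun (fun (s : Fin (N + 1)) (ξ : Fin (N + 1) → Fin m → ℝ) =>
      ξ s) S.pathLaw :=
    ProbabilityTheory.iIndepFun_pi (μ := fun _ : Fin (N + 1) => S.noise)
      (X := fun _ => (id : (Fin m → ℝ) → _)) fun _ => aemeasurable_id
  have h2 := (hind.indepFun hst).comp (measurable_pi_apply i) (measurable_pi_apply j)
  have h3 : ∫ ξ, ξ t j ∂S.pathLaw = 0 := by
    have h := measurePreserving_eval (fun _ : Fin (N + 1) => S.noise) t
    have hm : AEStronglyMeasurable (fun x : Fin m → ℝ => x j)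
        (Measure.map (Function.eval t) (Measure.pi fun _ : Fin (N + 1) => S.noise)) :=
      Continuous.aestronglyMeasurable (by fun_prop)
    have := integral_map h.measurable.aemeasurable hm
    rw [h.map_eq, S.noise_mean] at this
    exact this.symm
  have h4 := h2.integral_fun_mul_eq_mul_integral
    (Continuous.aestronglyMeasurable (by fun_prop)) (Continuous.aestronglyMeasurable (by fun_prop))
  simp only [Function.comp_apply] at h4
  rw [h4, h3, mul_zero]

/-- The state at time `t` is uncorrelated with the later noises. -/
lemma integral_traj_mul_noise (K : Gain d m N) (L : Gain n m N) (t s : Fin (N + 1)) (hts : t < s)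
    (i j : Fin m) : ∫ ξ, S.traj K L ξ t i * ξ s j ∂S.pathLaw = 0 := by
  induction t using Fin.induction generalizing i with
  | zero =>
    simp only [traj_zero]
    exact S.integral_noise_mul_noise_of_ne hts.ne i j
  | succ t ih =>
    have ih' := ih (lt_trans t.castSucc_lt_succ hts)
    simp only [traj_succ, Pi.add_apply, add_mul, mulVec, dotProduct, Finset.sum_mul, mul_assoc]
    have hc := S.continuous_traj_right K L
    rw [integral_add (S.integrable_of_continuous (by fun_prop))
      (S.integrable_of_continuous (by fun_prop)),
      integral_finsetSum _ (fun k _ => S.integrable_of_continuous (by fun_prop)),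
      S.integral_noise_mul_noise_of_ne hts.ne]
    simp [integral_const_mul, ih']

lemma integral_traj_mul_traj (K : Gain d m N) (L : Gain n m N) (t : Fin (N + 1)) (i j : Fin m) :
    ∫ ξ, S.traj K L ξ t i * S.traj K L ξ t j ∂S.pathLaw = S.stateCov K L t i j := by
  induction t using Fin.induction generalizing i j with
  | zero =>
    simp only [traj_zero, stateCov_zero]
    exact S.integral_noise_mul_noise_same 0 i j
  | succ t ih =>
    have hc := S.continuous_traj_right K L
    have hz := fun k j => S.integral_traj_mul_noise K L t.castSucc t.succ t.castSucc_lt_succ k j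
    have hexp : ∀ ξ : Fin (N + 1) → Fin m → ℝ,
        S.traj K L ξ t.succ i * S.traj K L ξ t.succ j
        = (∑ k, ∑ l, S.AKL K L t i k * S.AKL K L t j l *
            (S.traj K L ξ t.castSucc k * S.traj K L ξ t.castSucc l))
          + (∑ k, S.AKL K L t i k * (S.traj K L ξ t.castSucc k * ξ t.succ j))
          + (∑ k, S.AKL K L t j k * (S.traj K L ξ t.castSucc k * ξ t.succ i))
          + ξ t.succ i * ξ t.succ j := by
      intro ξ
      simp only [traj_succ, Pi.add_apply, mulVec, dotProduct]
      rw [add_mul, mul_add, mul_add, Finset.sum_mul_sum, Finset.sum_mul, Finset.mul_sum]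
      have e1 : ∀ k l, S.AKL K L t i k * S.traj K L ξ t.castSucc k
          * (S.AKL K L t j l * S.traj K L ξ t.castSucc l) = S.AKL K L t i k * S.AKL K L t j l *
            (S.traj K L ξ t.castSucc k * S.traj K L ξ t.castSucc l) := fun k l => by ring
      have e2 : ∀ k, ξ t.succ i * (S.AKL K L t j k * S.traj K L ξ t.castSucc k)
          = S.AKL K L t j k * (S.traj K L ξ t.castSucc k * ξ t.succ i) := fun k => by ring
      simp only [e1, e2, mul_assoc]
      ring
    simp only [hexp]
    rw [integral_add (S.integrable_of_continuous (by fun_prop))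
        (S.integrable_of_continuous (by fun_prop)),
      integral_add (S.integrable_of_continuous (by fun_prop))
        (S.integrable_of_continuous (by fun_prop)),
      integral_add (S.integrable_of_continuous (by fun_prop))
        (S.integrable_of_continuous (by fun_prop)),
      integral_finsetSum _ (fun k _ => S.integrable_of_continuous (by fun_prop)),
      integral_finsetSum _ (fun k _ => S.integrable_of_continuous (by fun_prop)),
      integral_finsetSum _ (fun k _ => S.integrable_of_continuous (by fun_prop))]
    have e3 : ∀ k, ∫ ξ, ∑ l, S.AKL K L t i k * S.AKL K L t j l *
            (S.traj K L ξ t.castSucc k * S.traj K L ξ t.castSucc l) ∂S.pathLaw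
        = ∑ l, S.AKL K L t i k * S.AKL K L t j l * S.stateCov K L t.castSucc k l := by
      intro k
      rw [integral_finsetSum _ (fun l _ => S.integrable_of_continuous (by fun_prop))]
      simp [integral_const_mul, ih]
    simp only [e3, integral_const_mul, hz, S.integral_noise_mul_noise_same, mul_zero,
      Finset.sum_const_zero, add_zero, stateCov_succ, Matrix.add_apply, Matrix.mul_apply,
      Matrix.transpose_apply, Finset.sum_mul]
    rw [Finset.sum_comm]
    congr 1
    exact Finset.sum_congr rfl fun l _ => Finset.sum_congr rfl fun k _ => by ring

lemma integral_quadForm_traj (K : Gain d m N) (L : Gain n m N) (t : Fin (N + 1))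
    (X : Matrix (Fin m) (Fin m) ℝ) :
    ∫ ξ, S.traj K L ξ t ⬝ᵥ X *ᵥ S.traj K L ξ t ∂S.pathLaw = (X * S.stateCov K L t).trace := by
  have hc := S.continuous_traj_right K L
  have hexp : ∀ ξ : Fin (N + 1) → Fin m → ℝ, S.traj K L ξ t ⬝ᵥ X *ᵥ S.traj K L ξ t
      = ∑ i, ∑ j, X i j * (S.traj K L ξ t j * S.traj K L ξ t i) := by
    intro ξ
    simp only [dotProduct, mulVec, Finset.mul_sum]
    exact Finset.sum_congr rfl fun i _ => Finset.sum_congr rfl fun j _ => by ring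
  simp only [hexp]
  rw [integral_finsetSum _ (fun k _ => S.integrable_of_continuous (by fun_prop))]
  simp only [Matrix.trace, Matrix.diag, Matrix.mul_apply]
  refine Finset.sum_congr rfl fun i _ => ?_
  rw [integral_finsetSum _ (fun k _ => S.integrable_of_continuous (by fun_prop))]
  simp [integral_const_mul, S.integral_traj_mul_traj]

lemma G_eq_trace (K : Gain d m N) (L : Gain n m N) : S.G K L
    = (∑ t : Fin N, (S.QKL K L t * S.stateCov K L t.castSucc).trace)
      + (S.Q (Fin.last N) * S.stateCov K L (Fin.last N)).trace := by
  have hc := S.continuous_traj_right K L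
  have hc' : ∀ t, Continuous fun ξ => S.traj K L ξ t := fun t => continuous_pi (hc t)
  unfold G cost
  have hq : ∀ t (X : Matrix (Fin m) (Fin m) ℝ),
      Continuous fun ξ => S.traj K L ξ t ⬝ᵥ X *ᵥ S.traj K L ξ t := fun t X =>
    (hc' t).dotProduct (continuous_const.matrix_mulVec (hc' t))
  rw [integral_add (S.integrable_of_continuous (continuous_finsetSum _ fun t _ => hq _ _))
      (S.integrable_of_continuous (hq _ _)),
    integral_finsetSum _ (fun k _ => S.integrable_of_continuous (hq _ _))]
  simp only [integral_quadForm_traj]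

lemma G_eq_sum_trace_P (K : Gain d m N) (L : Gain n m N) :
    S.G K L = ∑ t : Fin (N + 1), (S.P K L t * S.noiseCov).trace := by
  rw [G_eq_trace, S.sum_trace_P_mul K L L]
  simp

/-- **Performance difference**: the change of the objective is the expectation, along the
trajectories of the new gain `L'`, of a quadratic whose coefficients are those of `L`. -/
lemma G_sub_G (K : Gain d m N) (L L' : Gain n m N) : S.G K L' - S.G K L
    = ∑ t : Fin N, ((((L' - L).block t)ᵀ * S.actionGrad K L t
            + (S.actionGrad K L t)ᵀ * (L' - L).block t
            - ((L' - L).block t)ᵀ * S.Hblock K L t * (L' - L).block t)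
            * S.stateCov K L' t.castSucc).trace := by
  rw [G_eq_trace, S.sum_trace_P_mul K L L', G_eq_sum_trace_P]
  ring

end LQGame

namespace LQGame

variable {m n d N : ℕ} (S : LQGame m n d N)

/-! ### The inner maximizer -/

lemma noiseCov_posDef : S.noiseCov.PosDef := S.noise_cov

lemma phi_pos (hm : 0 < m) : 0 < S.phi := by
  have : Nonempty (Fin m) := ⟨⟨0, hm⟩⟩
  exact lambdaMin_pos (blockDiagonal_posDef fun _ => S.noise_cov)

lemma noiseCov_sub_phi_posSemidef :
    (S.noiseCov - S.phi • (1 : Matrix (Fin m) (Fin m) ℝ)).PosSemidef :=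
  block_sub_lambdaMin_posSemidef (X := fun _ : Fin (N + 1) => S.noiseCov)
    (fun _ => S.noise_cov) 0

lemma stateCov_posSemidef (K : Gain d m N) (L : Gain n m N) (t : Fin (N + 1)) :
    (S.stateCov K L t).PosSemidef := by
  induction t using Fin.induction with
  | zero => rw [stateCov_zero]; exact S.noiseCov_posDef.posSemidef
  | succ t ih =>
    rw [stateCov_succ]
    exact (ih.mul_mul_transpose_same _).add S.noiseCov_posDef.posSemidef

/-- Every state receives a fresh noise, so its second moments dominate those of the noise. -/
lemma stateCov_sub_phi_posSemidef (K : Gain d m N) (L : Gain n m N) (t : Fin (N + 1)) :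
    (S.stateCov K L t - S.phi • (1 : Matrix (Fin m) (Fin m) ℝ)).PosSemidef := by
  induction t using Fin.induction with
  | zero => rw [stateCov_zero]; exact S.noiseCov_sub_phi_posSemidef
  | succ t ih =>
    rw [stateCov_succ, add_sub_assoc]
    exact ((S.stateCov_posSemidef K L _).mul_mul_transpose_same _).add
      S.noiseCov_sub_phi_posSemidef

variable {S} {K : Gain d m N}

lemma innerSol_block (hK : S.Feasible K) (t : Fin N) : (S.innerSol K).block t
    = -((S.Rw t - (S.D t)ᵀ * S.riccati K t.succ * S.D t)⁻¹ * (S.D t)ᵀ * S.riccati K t.succ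
      * S.AK K t) := by
  have hdet := (Matrix.isUnit_iff_isUnit_det _).1 (hK.2 t).isUnit
  set H := S.Rw t - (S.D t)ᵀ * S.riccati K t.succ * S.D t with hHdef
  have hH : -S.Rw t + (S.D t)ᵀ * S.riccati K t.succ * S.D t = -H := by rw [hHdef]; abel
  have hneg : (-H)⁻¹ = -H⁻¹ := by
    refine Matrix.inv_eq_left_inv ?_
    rw [neg_mul_neg, Matrix.nonsing_inv_mul _ hdet]
  rw [innerSol, Gain.block_ofBlocks, hH, hneg]
  simp only [Matrix.neg_mul]

lemma mul_innerSol_block (hK : S.Feasible K) (t : Fin N) :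
    (S.Rw t - (S.D t)ᵀ * S.riccati K t.succ * S.D t) * (S.innerSol K).block t
      = -((S.D t)ᵀ * S.riccati K t.succ * S.AK K t) := by
  have hdet := (Matrix.isUnit_iff_isUnit_det _).1 (hK.2 t).isUnit
  rw [innerSol_block hK, Matrix.mul_neg]
  simp only [← Matrix.mul_assoc]
  rw [Matrix.mul_nonsing_inv _ hdet, Matrix.one_mul]

/-- The cost-to-go matrices of the inner solution solve the Riccati recursion. -/
lemma P_innerSol (hK : S.Feasible K) (t : Fin (N + 1)) :
    S.P K (S.innerSol K) t = S.riccati K t := by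
  induction t using Fin.reverseInduction with
  | last => rw [P_last, riccati_last]
  | cast t ih =>
    set H := S.Rw t - (S.D t)ᵀ * S.riccati K t.succ * S.D t with hHdef
    have hL := innerSol_block hK t
    have hHL := mul_innerSol_block hK t
    rw [← hHdef] at hL hHL
    rw [P_castSucc, riccati_castSucc, ih, ← hHdef]
    have hR : S.Rw t = H + (S.D t)ᵀ * S.riccati K t.succ * S.D t := by rw [hHdef]; abel
    have e1 : ((S.innerSol K).block t)ᵀ * H * (S.innerSol K).block t
        = -(((S.innerSol K).block t)ᵀ * (S.D t)ᵀ * S.riccati K t.succ * S.AK K t) := by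
      rw [Matrix.mul_assoc, hHL]
      simp only [Matrix.mul_neg, Matrix.mul_assoc]
    have e2 : (S.AK K t)ᵀ * (S.riccati K t.succ * S.D t * H⁻¹ * (S.D t)ᵀ * S.riccati K t.succ)
        * S.AK K t = -((S.AK K t)ᵀ * S.riccati K t.succ * S.D t * (S.innerSol K).block t) := by
      rw [hL]
      simp only [Matrix.mul_neg, Matrix.mul_assoc, neg_neg]
    rw [QKL, hR, AKL, Matrix.mul_add (S.AK K t)ᵀ, Matrix.add_mul _ _ (S.AK K t), e2,
      Matrix.mul_add, Matrix.add_mul, e1]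
    simp only [transpose_sub, transpose_mul, Matrix.mul_sub, Matrix.sub_mul, Matrix.mul_assoc]
    abel

lemma Hblock_innerSol_posDef (hK : S.Feasible K) (t : Fin N) :
    (S.Hblock K (S.innerSol K) t).PosDef := by
  rw [Hblock, P_innerSol hK]
  exact hK.2 t

/-- The inner solution is stationary. -/
lemma actionGrad_innerSol (hK : S.Feasible K) (t : Fin N) :
    S.actionGrad K (S.innerSol K) t = 0 := by
  rw [actionGrad, Hblock, P_innerSol hK, mul_innerSol_block hK, neg_add_cancel, neg_zero]

/-- The optimality gap `𝒢(K, L(K)) - 𝒢(K, L)`. -/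
noncomputable def gap (S : LQGame m n d N) (K : Gain d m N) (L : Gain n m N) : ℝ :=
  S.G K (S.innerSol K) - S.G K L

lemma gap_eq (hK : S.Feasible K) (L : Gain n m N) : S.gap K L
    = ∑ t : Fin N, (((L - S.innerSol K).block t)ᵀ * S.Hblock K (S.innerSol K) t
        * (L - S.innerSol K).block t * S.stateCov K L t.castSucc).trace := by
  have h := S.G_sub_G K (S.innerSol K) L
  rw [gap, ← neg_sub, h, ← Finset.sum_neg_distrib]
  refine Finset.sum_congr rfl fun t _ => ?_
  rw [actionGrad_innerSol hK]
  simp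

/-- The smallest eigenvalue of `H_{K, L(K)}`. -/
noncomputable def lamH (S : LQGame m n d N) (K : Gain d m N) : ℝ :=
  lambdaMin (S.H K (S.innerSol K))

lemma lamH_pos (hn : 0 < n) (hN : 0 < N) (hK : S.Feasible K) : 0 < S.lamH K := by
  have : Nonempty (Fin n) := ⟨⟨0, hn⟩⟩
  have : Nonempty (Fin N) := ⟨⟨0, hN⟩⟩
  exact lambdaMin_pos (blockDiagonal_posDef (Hblock_innerSol_posDef hK))

lemma Hblock_innerSol_sub_lamH (hK : S.Feasible K) (t : Fin N) :
    (S.Hblock K (S.innerSol K) t - S.lamH K • (1 : Matrix (Fin n) (Fin n) ℝ)).PosSemidef :=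
  block_sub_lambdaMin_posSemidef (Hblock_innerSol_posDef hK) t

/-- Quadratic growth of the optimality gap. -/
lemma mul_norm_sq_le_gap (hK : S.Feasible K) (hn : 0 < n) (hN : 0 < N)
    (L : Gain n m N) : S.phi * S.lamH K * ‖L - S.innerSol K‖ ^ 2 ≤ S.gap K L := by
  rw [gap_eq hK, Gain.norm_sq_eq, Finset.mul_sum]
  refine Finset.sum_le_sum fun t _ => ?_
  set Δ := (L - S.innerSol K).block t
  have hC := S.stateCov_sub_phi_posSemidef K L t.castSucc
  have h1 : (Δᵀ * S.Hblock K (S.innerSol K) t * Δ - S.lamH K • (Δᵀ * Δ)).PosSemidef := by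
    have := (Hblock_innerSol_sub_lamH hK t).transpose_mul_mul_same Δ
    simpa [Matrix.mul_sub, Matrix.sub_mul] using this
  have h2 := trace_mul_le_of_sub_posSemidef h1 (S.stateCov_posSemidef K L t.castSucc)
  have h3 := mul_trace_le_trace_mul (posSemidef_transpose_mul_self Δ) hC
  rw [Matrix.smul_mul, trace_smul, smul_eq_mul] at h2
  calc _ = S.lamH K * (S.phi * (Δᵀ * Δ).trace) := by ring
    _ ≤ S.lamH K * (Δᵀ * Δ * S.stateCov K L t.castSucc).trace :=
        mul_le_mul_of_nonneg_left h3 (lamH_pos hn hN hK).le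
    _ ≤ _ := h2

lemma gap_nonneg (hm : 0 < m) (hK : S.Feasible K) (hn : 0 < n) (hN : 0 < N) (L : Gain n m N) :
    0 ≤ S.gap K L :=
  le_trans (mul_nonneg (mul_nonneg (S.phi_pos hm).le (lamH_pos hn hN hK).le) (sq_nonneg _))
    (mul_norm_sq_le_gap hK hn hN L)

lemma G_lt_G_innerSol (hm : 0 < m) (hK : S.Feasible K) (hn : 0 < n) (hN : 0 < N)
    {L : Gain n m N} (hL : L ≠ S.innerSol K) : S.G K L < S.G K (S.innerSol K) := by
  have h : 0 < ‖L - S.innerSol K‖ := norm_pos_iff.2 (sub_ne_zero.2 hL)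
  have h1 := mul_norm_sq_le_gap hK hn hN L
  have h2 : 0 < S.phi * S.lamH K * ‖L - S.innerSol K‖ ^ 2 :=
    mul_pos (mul_pos (S.phi_pos hm) (lamH_pos hn hN hK)) (by positivity)
  rw [gap] at h1
  linarith

/-- Any gain has a smaller cost-to-go than the maximizing one. -/
lemma P_innerSol_sub_P_posSemidef (hK : S.Feasible K) (L : Gain n m N) (t : Fin (N + 1)) :
    (S.P K (S.innerSol K) t - S.P K L t).PosSemidef := by
  induction t using Fin.reverseInduction with
  | last => rw [P_last, P_last, sub_self]; exact PosSemidef.zero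
  | cast t ih =>
    have h := S.stage_expansion K (S.innerSol K) L t
    rw [actionGrad_innerSol hK] at h
    have h1 := ((Hblock_innerSol_posDef hK t).posSemidef).transpose_mul_mul_same
      ((L - S.innerSol K).block t)
    have h2 := ih.transpose_mul_mul_same (S.AKL K L t)
    convert h1.add h2 using 1
    simp only [transpose_zero, Matrix.mul_zero, Matrix.zero_mul, add_zero, zero_sub] at h
    have h3 := congrArg Neg.neg h
    rw [neg_neg] at h3
    rw [← h3, S.P_castSucc K L, Matrix.mul_sub, Matrix.sub_mul]
    abel

lemma Hblock_sub_lamH (hK : S.Feasible K) (L : Gain n m N) (t : Fin N) :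
    (S.Hblock K L t - S.lamH K • (1 : Matrix (Fin n) (Fin n) ℝ)).PosSemidef := by
  have h1 := (P_innerSol_sub_P_posSemidef hK L t.succ).transpose_mul_mul_same (S.D t)
  convert (Hblock_innerSol_sub_lamH hK t).add h1 using 1
  simp only [Hblock, Matrix.mul_sub, Matrix.sub_mul]
  abel

/-- The optimality gap is controlled by the size of the action gradients. -/
lemma gap_le_sum_actionGrad (hK : S.Feasible K) (hn : 0 < n) (hN : 0 < N) {s : ℝ}
    (hs : ∀ t, (s • (1 : Matrix (Fin m) (Fin m) ℝ)
      - S.stateCov K (S.innerSol K) t).PosSemidef) (L : Gain n m N) :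
    S.gap K L ≤ s / S.lamH K * ∑ t, ((S.actionGrad K L t)ᵀ * S.actionGrad K L t).trace := by
  have hl := lamH_pos hn hN hK
  rw [gap, G_sub_G, Finset.mul_sum]
  refine Finset.sum_le_sum fun t _ => ?_
  set Δ := (S.innerSol K - L).block t
  set F := S.actionGrad K L t
  set lam := S.lamH K
  set C := S.stateCov K (S.innerSol K) t.castSucc
  have hC : C.PosSemidef := S.stateCov_posSemidef K _ _
  have h1 : (lam⁻¹ • (Fᵀ * F) - (Δᵀ * F + Fᵀ * Δ - Δᵀ * S.Hblock K L t * Δ)).PosSemidef := by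
    have e1 := (posSemidef_transpose_mul_self (F - lam • Δ)).smul (inv_nonneg.2 hl.le)
    have e2 := (Hblock_sub_lamH hK L t).transpose_mul_mul_same Δ
    convert e1.add e2 using 1
    simp only [transpose_sub, transpose_smul, Matrix.mul_sub, Matrix.sub_mul, Matrix.smul_mul,
      Matrix.mul_smul, smul_sub, smul_smul, Matrix.mul_one, inv_mul_cancel₀ hl.ne',
      inv_mul_cancel_left₀ hl.ne', one_smul]
    abel
  refine (trace_mul_le_of_sub_posSemidef h1 hC).trans ?_
  rw [Matrix.smul_mul, trace_smul, smul_eq_mul]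
  have h2 := trace_mul_le_mul_trace (posSemidef_transpose_mul_self F) (hs t.castSucc)
  calc _ ≤ lam⁻¹ * (s * (Fᵀ * F).trace) := mul_le_mul_of_nonneg_left h2 (inv_nonneg.2 hl.le)
    _ = _ := by rw [div_eq_mul_inv]; ring

/-! ### Smoothness and the gradient -/

lemma contDiff_gain_block (t : Fin N) (i : Fin n) (j : Fin m) :
    ContDiff ℝ 2 fun L : Gain n m N => L.block t i j := by
  simp only [Gain.block, of_apply]
  fun_prop

end LQGame

section MatrixContDiff

variable {E : Type*} [NormedAddCommGroup E] [NormedSpace ℝ E] {k : WithTop ℕ∞} {a b c : Type*}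

lemma contDiff_matrix_mul [Fintype b] {f : E → Matrix a b ℝ} {g : E → Matrix b c ℝ}
    (hf : ∀ i j, ContDiff ℝ k fun x => f x i j) (hg : ∀ i j, ContDiff ℝ k fun x => g x i j)
    (i : a) (j : c) : ContDiff ℝ k fun x => (f x * g x) i j := by
  simp only [Matrix.mul_apply]
  exact ContDiff.sum fun l _ => (hf i l).mul (hg l j)

end MatrixContDiff

namespace LQGame

variable {m n d N : ℕ} {S : LQGame m n d N} {K : Gain d m N}

lemma contDiff_AKL (t : Fin N) (i j : Fin m) :
    ContDiff ℝ 2 fun L : Gain n m N => S.AKL K L t i j := by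
  simp only [AKL, Matrix.sub_apply]
  exact contDiff_const.sub (contDiff_matrix_mul (f := fun _ => S.D t)
    (fun _ _ => contDiff_const) (contDiff_gain_block t) i j)

lemma contDiff_QKL (t : Fin N) (i j : Fin m) :
    ContDiff ℝ 2 fun L : Gain n m N => S.QKL K L t i j := by
  simp only [QKL, Matrix.sub_apply]
  refine contDiff_const.sub (contDiff_matrix_mul (contDiff_matrix_mul
    (f := fun L : Gain n m N => (L.block t)ᵀ) (g := fun _ => S.Rw t)
    (fun i j => ?_) fun _ _ => contDiff_const) (contDiff_gain_block t) i j)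
  exact contDiff_gain_block t j i

lemma contDiff_P (t : Fin (N + 1)) (i j : Fin m) :
    ContDiff ℝ 2 fun L : Gain n m N => S.P K L t i j := by
  induction t using Fin.reverseInduction generalizing i j with
  | last => simp only [P_last]; exact contDiff_const
  | cast t ih =>
    simp only [P_castSucc, Matrix.add_apply]
    exact (contDiff_matrix_mul (contDiff_matrix_mul
      (f := fun L : Gain n m N => (S.AKL K L t)ᵀ) (fun i j => contDiff_AKL t j i) ih)
      (contDiff_AKL t) i j).add (contDiff_QKL t i j)

lemma contDiff_G : ContDiff ℝ 2 fun L : Gain n m N => S.G K L := by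
  simp only [G_eq_sum_trace_P, Matrix.trace, Matrix.diag]
  exact ContDiff.sum fun t _ => ContDiff.sum fun i _ =>
    contDiff_matrix_mul (g := fun _ => S.noiseCov) (contDiff_P t) (fun _ _ => contDiff_const) i i

lemma continuous_G : Continuous fun L : Gain n m N => S.G K L := contDiff_G.continuous

lemma continuous_stateCov (t : Fin (N + 1)) :
    Continuous fun L : Gain n m N => S.stateCov K L t := by
  induction t using Fin.induction with
  | zero => simp only [stateCov_zero]; exact continuous_const
  | succ t ih =>
    simp only [stateCov_succ]
    have h := S.continuous_AKL K (n := n) t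
    exact ((h.matrix_mul ih).matrix_mul h.matrix_transpose).add continuous_const

lemma trace_transpose_mul_add (X Δ : Matrix (Fin n) (Fin m) ℝ) {C : Matrix (Fin m) (Fin m) ℝ}
    (hC : Cᵀ = C) : ((Δᵀ * X + Xᵀ * Δ) * C).trace = 2 * ∑ i, ∑ j, (X * C) i j * Δ i j := by
  have h1 : (Δᵀ * X * C).trace = ∑ i, ∑ j, (X * C) i j * Δ i j := by
    rw [Matrix.mul_assoc, Matrix.trace, Finset.sum_comm]
    refine Finset.sum_congr rfl fun j _ => ?_
    rw [Matrix.diag, Matrix.mul_apply]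
    exact Finset.sum_congr rfl fun i _ => by rw [transpose_apply]; ring
  have h2 : (Xᵀ * Δ * C).trace = (Δᵀ * X * C).trace := by
    rw [← Matrix.trace_transpose (Xᵀ * Δ * C), transpose_mul, hC, Matrix.trace_mul_comm]
    simp
  rw [Matrix.add_mul, trace_add, h2, h1]
  ring

/-- The gradient of the objective. Its blocks are `2 F_t Σ_t`, with `F` the action gradient and `Σ`
the second moments of the state. -/
lemma gradient_G (L : Gain n m N) : gradient (S.G K) L
    = Gain.ofBlocks fun t => (2 : ℝ) • (S.actionGrad K L t * S.stateCov K L t.castSucc) := by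
  set g : Gain n m N :=
    Gain.ofBlocks fun t => (2 : ℝ) • (S.actionGrad K L t * S.stateCov K L t.castSucc) with hg
  have hd : DifferentiableAt ℝ (S.G K) L := (contDiff_G.differentiable (by norm_num)) L
  -- the directional derivatives are read off the performance difference identity
  refine ext_inner_right ℝ fun v => ?_
  have hgr : HasGradientAt (S.G K) (gradient (S.G K) L) L := hd.hasGradientAt
  have h1 : HasDerivAt (fun r : ℝ => S.G K (L + r • v)) (inner ℝ (gradient (S.G K) L) v) 0 := by
    have hl : HasDerivAt (fun r : ℝ => L + r • v) v 0 := by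
      simpa using ((hasDerivAt_id (0 : ℝ)).smul_const v).const_add L
    have := HasFDerivAt.comp_hasDerivAt (x := (0 : ℝ)) (f := fun r : ℝ => L + r • v)
      (l := S.G K) (l' := InnerProductSpace.toDual ℝ _ (gradient (S.G K) L))
      (by simpa using hgr.hasFDerivAt) hl
    simpa [Function.comp_def] using this
  have h2 : HasDerivAt (fun r : ℝ => S.G K (L + r • v)) (inner ℝ g v) 0 := by
    rw [hasDerivAt_iff_tendsto_slope_zero]
    have hcont : Continuous fun r : ℝ => ∑ t : Fin N, (((v.block t)ᵀ * S.actionGrad K L t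
            + (S.actionGrad K L t)ᵀ * v.block t
            - r • ((v.block t)ᵀ * S.Hblock K L t * v.block t))
            * S.stateCov K (L + r • v) t.castSucc).trace := by
      refine continuous_finsetSum _ fun t _ => Continuous.matrix_trace (Continuous.matrix_mul ?_ ?_)
      · fun_prop
      · exact (continuous_stateCov _).comp (by fun_prop)
    have h3 := hcont.tendsto 0
    have h4 : (∑ t : Fin N, (((v.block t)ᵀ * S.actionGrad K L t
            + (S.actionGrad K L t)ᵀ * v.block t
            - (0 : ℝ) • ((v.block t)ᵀ * S.Hblock K L t * v.block t))
            * S.stateCov K (L + (0 : ℝ) • v) t.castSucc).trace) = inner ℝ g v := by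
      simp only [zero_smul, sub_zero, add_zero]
      rw [PiLp.inner_apply, Fintype.sum_prod_type]
      refine Finset.sum_congr rfl fun t _ => ?_
      rw [trace_transpose_mul_add _ _ (S.stateCov_posSemidef K L _).transpose_eq,
        Fintype.sum_prod_type, Finset.mul_sum]
      refine Finset.sum_congr rfl fun i _ => ?_
      rw [Finset.mul_sum]
      refine Finset.sum_congr rfl fun j _ => ?_
      simp [hg, Gain.ofBlocks, Gain.block]
      ring
    rw [h4] at h3
    refine (h3.mono_left nhdsWithin_le_nhds).congr' ?_
    filter_upwards [self_mem_nhdsWithin] with r hr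
    have hr' : r ≠ 0 := hr
    have hb : ∀ t, (L + r • v - L).block t = r • v.block t := by
      intro t; rw [add_sub_cancel_left]; rfl
    simp only [zero_add, zero_smul, add_zero, G_sub_G, hb]
    rw [smul_eq_mul, Finset.mul_sum]
    refine Finset.sum_congr rfl fun t _ => ?_
    rw [← smul_eq_mul r⁻¹, ← trace_smul, ← Matrix.smul_mul r⁻¹]
    congr 2
    simp only [transpose_smul, Matrix.smul_mul, Matrix.mul_smul, smul_add, smul_sub, smul_smul,
      inv_mul_cancel₀ hr', inv_mul_cancel_left₀ hr', one_smul]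
  exact h1.unique h2

/-- A gradient domination (Polyak–Łojasiewicz) inequality. -/
lemma phi_sq_mul_gap_le_norm_gradient_sq (hm : 0 < m) (hK : S.Feasible K) (hn : 0 < n)
    (hN : 0 < N) {s : ℝ} (hs0 : 0 < s) (hs : ∀ t, (s • (1 : Matrix (Fin m) (Fin m) ℝ)
      - S.stateCov K (S.innerSol K) t).PosSemidef) (L : Gain n m N) :
    4 * S.phi ^ 2 * S.lamH K / s * S.gap K L ≤ ‖gradient (S.G K) L‖ ^ 2 := by
  have hl := lamH_pos hn hN hK
  have hφ := S.phi_pos hm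
  have h1 := gap_le_sum_actionGrad hK hn hN hs L
  have h2 : 4 * S.phi ^ 2 * ∑ t, ((S.actionGrad K L t)ᵀ * S.actionGrad K L t).trace
      ≤ ‖gradient (S.G K) L‖ ^ 2 := by
    rw [gradient_G, Gain.norm_sq_eq, Finset.mul_sum]
    refine Finset.sum_le_sum fun t _ => ?_
    rw [Gain.block_ofBlocks]
    set F := S.actionGrad K L t
    set C := S.stateCov K L t.castSucc
    have hC : C.PosSemidef := S.stateCov_posSemidef K L _
    have hCφ : (C - S.phi • (1 : Matrix (Fin m) (Fin m) ℝ)).PosSemidef :=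
      S.stateCov_sub_phi_posSemidef K L _
    -- `C² ⪰ φ C ⪰ φ²`, as `C ⪰ φ`
    have e1 : (F * C * Fᵀ).trace * S.phi ≤ (F * C * C * Fᵀ).trace := by
      have hsq : (C * C - S.phi • C).PosSemidef := by
        refine posSemidef_of_quadForm_nonneg ?_ fun v => ?_
        · simp [hC.transpose_eq]
        · have a1 := hCφ.quadForm_nonneg v
          simp only [sub_mulVec, smul_mulVec, one_mulVec, dotProduct_sub, dotProduct_smul,
            smul_eq_mul] at a1 ⊢
          have a2 : v ⬝ᵥ (C * C) *ᵥ v = (C *ᵥ v) ⬝ᵥ (C *ᵥ v) := by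
            rw [← mulVec_mulVec, dotProduct_mulVec, ← mulVec_transpose, hC.transpose_eq]
          have a3 : 0 ≤ (C *ᵥ v - S.phi • v) ⬝ᵥ (C *ᵥ v - S.phi • v) := by
            simpa using dotProduct_star_self_nonneg (C *ᵥ v - S.phi • v)
          simp only [sub_dotProduct, dotProduct_sub, smul_dotProduct, dotProduct_smul,
            smul_eq_mul, dotProduct_comm (C *ᵥ v) v] at a3
          rw [a2]
          nlinarith [mul_nonneg hφ.le a1]
      have := (hsq.mul_mul_transpose_same F).trace_nonneg
      simp only [Matrix.mul_sub, Matrix.sub_mul, trace_sub, Matrix.mul_smul, Matrix.smul_mul,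
        trace_smul, smul_eq_mul, ← Matrix.mul_assoc] at this
      linarith
    have e2 : (F * Fᵀ).trace * S.phi ≤ (F * C * Fᵀ).trace := by
      have := (hCφ.mul_mul_transpose_same F).trace_nonneg
      simp only [Matrix.mul_sub, Matrix.sub_mul, trace_sub, Matrix.mul_smul, Matrix.smul_mul,
        trace_smul, smul_eq_mul, Matrix.mul_one] at this
      linarith
    have e3 : (((2 : ℝ) • (F * C))ᵀ * ((2 : ℝ) • (F * C))).trace = 4 * (F * C * C * Fᵀ).trace := by
      rw [Matrix.trace_mul_comm]
      simp only [transpose_smul, transpose_mul, hC.transpose_eq, Matrix.smul_mul, Matrix.mul_smul,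
        trace_smul, smul_eq_mul, Matrix.mul_assoc]
      ring
    rw [e3, Matrix.trace_mul_comm Fᵀ F]
    nlinarith [mul_le_mul_of_nonneg_right e2 hφ.le]
  calc _ ≤ 4 * S.phi ^ 2 * S.lamH K / s
        * (s / S.lamH K * ∑ t, ((S.actionGrad K L t)ᵀ * S.actionGrad K L t).trace) :=
        mul_le_mul_of_nonneg_left h1 (by positivity)
    _ = 4 * S.phi ^ 2 * ∑ t, ((S.actionGrad K L t)ᵀ * S.actionGrad K L t).trace := by
        field_simp
    _ ≤ _ := h2

end LQGame

/-! ### The uniform distribution on the sphere -/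

section Sphere

variable {n m N : ℕ}

lemma nontrivial_gain (hn : 0 < n) (hm : 0 < m) (hN : 0 < N) : Nontrivial (Gain n m N) := by
  have : Nonempty (Fin N × Fin n × Fin m) := ⟨⟨0, hN⟩, ⟨0, hn⟩, ⟨0, hm⟩⟩
  infer_instance

lemma isProbabilityMeasure_sphereLaw (hn : 0 < n) (hm : 0 < m) (hN : 0 < N) :
    IsProbabilityMeasure (sphereLaw n m N) := by
  have := nontrivial_gain hn hm hN
  have h0 : (volume : Measure (Gain n m N)).toSphere Set.univ ≠ 0 := by
    rw [Measure.measure_univ_ne_zero]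
    exact Measure.toSphere_ne_zero _
  have := ProbabilityTheory.cond_isProbabilityMeasure h0
  exact Measure.isProbabilityMeasure_map measurable_subtype_coe.aemeasurable

lemma ae_norm_eq_one_sphereLaw : ∀ᵐ U ∂sphereLaw n m N, ‖U‖ = 1 := by
  rw [sphereLaw, ae_map_iff measurable_subtype_coe.aemeasurable
    (measurableSet_eq_fun (by fun_prop) (by fun_prop))]
  exact Filter.Eventually.of_forall fun U => by simp

/-- The uniform distribution on the sphere is invariant under linear isometries. -/
lemma measurePreserving_sphereLaw (e : Gain n m N ≃ₗᵢ[ℝ] Gain n m N) :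
    MeasurePreserving e (sphereLaw n m N) (sphereLaw n m N) := by
  refine ⟨e.continuous.measurable, ?_⟩
  ext s hs
  have hes : MeasurableSet (e ⁻¹' s) := e.continuous.measurable hs
  rw [Measure.map_apply e.continuous.measurable hs, sphereLaw,
    Measure.map_apply measurable_subtype_coe hs, Measure.map_apply measurable_subtype_coe hes,
    ProbabilityTheory.cond_apply MeasurableSet.univ,
    ProbabilityTheory.cond_apply MeasurableSet.univ, Set.univ_inter, Set.univ_inter,
    Measure.toSphere_apply' _ (measurable_subtype_coe hs),
    Measure.toSphere_apply' _ (measurable_subtype_coe hes)]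
  congr 2
  have hvol := (e.measurePreserving.measure_preimage_emb
    e.toHomeomorph.measurableEmbedding)
  refine Eq.trans ?_ (hvol _)
  congr 1
  ext x
  simp only [Set.mem_smul, Set.mem_image, Set.mem_preimage, Subtype.exists, exists_and_right,
    exists_eq_right, mem_sphere_zero_iff_norm]
  constructor
  · rintro ⟨a, ha, y, ⟨hy, hys⟩, rfl⟩
    exact ⟨a, ha, e y, ⟨by simpa using hy, hys⟩, by simp⟩
  · rintro ⟨a, ha, y, ⟨hy, hys⟩, hx⟩
    refine ⟨a, ha, e.symm y, ⟨by simpa using hy, by simpa using hys⟩, ?_⟩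
    apply e.injective
    simp [hx]

lemma integrable_sphereLaw_of_continuous (hn : 0 < n) (hm : 0 < m) (hN : 0 < N)
    {f : Gain n m N → ℝ} (hf : Continuous f) : Integrable f (sphereLaw n m N) := by
  have := isProbabilityMeasure_sphereLaw hn hm hN
  obtain ⟨C, hC⟩ := (isCompact_sphere (0 : Gain n m N) 1).exists_bound_of_continuousOn
    hf.continuousOn
  refine Integrable.of_bound hf.aestronglyMeasurable C ?_
  filter_upwards [ae_norm_eq_one_sphereLaw] with U hU using hC U (by simpa using hU)

lemma integral_sphereLaw_comp (e : Gain n m N ≃ₗᵢ[ℝ] Gain n m N) (f : Gain n m N → ℝ) :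
    ∫ U, f (e U) ∂sphereLaw n m N = ∫ U, f U ∂sphereLaw n m N :=
  (measurePreserving_sphereLaw e).integral_comp e.toHomeomorph.measurableEmbedding f

lemma integral_sphereLaw_apply (q : Fin N × Fin n × Fin m) :
    ∫ U, U q ∂sphereLaw n m N = 0 := by
  have h := integral_sphereLaw_comp (LinearIsometryEquiv.neg ℝ) fun U : Gain n m N => U q
  simp only [LinearIsometryEquiv.coe_neg, PiLp.neg_apply, integral_neg] at h
  linarith

lemma inner_reflection_right (a v : Gain n m N) (T : Submodule ℝ (Gain n m N)) :
    inner ℝ a (T.reflection v) = inner ℝ (T.reflection a) v := by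
  rw [← T.reflection.inner_map_map, Submodule.reflection_reflection]

lemma integral_sphereLaw_apply_mul_apply_of_ne {q q' : Fin N × Fin n × Fin m} (h : q ≠ q') :
    ∫ U, U q * U q' ∂sphereLaw n m N = 0 := by
  set a : Gain n m N := EuclideanSpace.single q 1
  set b : Gain n m N := EuclideanSpace.single q' 1
  have ha : ∀ U : Gain n m N, U q = inner ℝ a U := fun U => by
    simp only [a, EuclideanSpace.inner_single_left, map_one, one_mul]
  have hb : ∀ U : Gain n m N, U q' = inner ℝ b U := fun U => by
    simp only [b, EuclideanSpace.inner_single_left, map_one, one_mul]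
  have hab : inner ℝ a b = (0 : ℝ) := by
    rw [← ha]
    simp [b, h]
  have h1 := integral_sphereLaw_comp (Submodule.reflection (ℝ ∙ a)ᗮ)
    fun U : Gain n m N => U q * U q'
  have hbr : Submodule.reflection (ℝ ∙ a)ᗮ b = b :=
    Submodule.reflection_mem_subspace_eq_self (Submodule.mem_orthogonal_singleton_iff_inner_right.2
      hab)
  simp only [ha, hb, inner_reflection_right, Submodule.reflection_orthogonalComplement_singleton_eq_neg,
    hbr, inner_neg_left, neg_mul, integral_neg] at h1 ⊢
  linarith

lemma integral_sphereLaw_apply_sq_eq (q q' : Fin N × Fin n × Fin m) :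
    ∫ U, U q * U q ∂sphereLaw n m N = ∫ U, U q' * U q' ∂sphereLaw n m N := by
  set a : Gain n m N := EuclideanSpace.single q 1
  set b : Gain n m N := EuclideanSpace.single q' 1
  have ha : ∀ U : Gain n m N, U q = inner ℝ a U := fun U => by
    simp only [a, EuclideanSpace.inner_single_left, map_one, one_mul]
  have hb : ∀ U : Gain n m N, U q' = inner ℝ b U := fun U => by
    simp only [b, EuclideanSpace.inner_single_left, map_one, one_mul]
  have h1 := integral_sphereLaw_comp (Submodule.reflection (ℝ ∙ (a - b))ᗮ)
    fun U : Gain n m N => U q * U q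
  have hr : Submodule.reflection (ℝ ∙ (a - b))ᗮ a = b :=
    Submodule.reflection_sub (by simp [a, b])
  simp only [ha, hb, inner_reflection_right, hr] at h1 ⊢
  exact h1.symm

lemma integral_sphereLaw_apply_sq (hn : 0 < n) (hm : 0 < m) (hN : 0 < N)
    (q : Fin N × Fin n × Fin m) :
    ((n * m * N : ℕ) : ℝ) * ∫ U, U q * U q ∂sphereLaw n m N = 1 := by
  have := isProbabilityMeasure_sphereLaw hn hm hN
  have h1 : ∫ U, ∑ q' : Fin N × Fin n × Fin m, U q' * U q' ∂sphereLaw n m N = 1 := by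
    have : ∀ᵐ U ∂sphereLaw n m N, ∑ q' : Fin N × Fin n × Fin m, U q' * U q' = 1 := by
      filter_upwards [ae_norm_eq_one_sphereLaw] with U hU
      have h2 := EuclideanSpace.norm_sq_eq U
      rw [hU] at h2
      simp only [Real.norm_eq_abs, sq_abs, one_pow] at h2
      simp [h2, ← sq]
    rw [integral_congr_ae this]
    simp
  rw [integral_finsetSum _ fun q' _ => integrable_sphereLaw_of_continuous hn hm hN (by fun_prop),
    Finset.sum_congr rfl fun q' _ => integral_sphereLaw_apply_sq_eq q' q] at h1
  rw [← h1]
  simp only [Finset.sum_const, Finset.card_univ, Fintype.card_prod, Fintype.card_fin, nsmul_eq_mul]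
  congr 2
  ring

lemma integral_sphereLaw_inner_mul_apply (hn : 0 < n) (hm : 0 < m) (hN : 0 < N)
    (v : Gain n m N) (q : Fin N × Fin n × Fin m) :
    ((n * m * N : ℕ) : ℝ) * ∫ U, inner ℝ v U * U q ∂sphereLaw n m N = v q := by
  have hexp : ∀ U : Gain n m N, inner ℝ v U * U q = ∑ q', v q' * (U q' * U q) := by
    intro U
    rw [PiLp.inner_apply, Finset.sum_mul]
    exact Finset.sum_congr rfl fun q' _ => by simp; ring
  simp only [hexp]
  rw [integral_finsetSum _ fun q' _ => integrable_sphereLaw_of_continuous hn hm hN (by fun_prop)]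
  simp only [integral_const_mul]
  rw [Finset.sum_eq_single q
    (fun q' _ hq' => by rw [integral_sphereLaw_apply_mul_apply_of_ne hq', mul_zero]) (by simp),
    mul_left_comm, integral_sphereLaw_apply_sq hn hm hN, mul_one]

/-- The bias of the one-point gradient estimate of `f` at smoothing radius `r`. Only the first two
moments of the direction enter: the value and the linear part of `f` contribute `0` and the exact
gradient `g`, and the second order remainder is of size `r²`. -/
lemma abs_integral_one_point_sub_le (hn : 0 < n) (hm : 0 < m) (hN : 0 < N)
    {f : Gain n m N → ℝ} (hf : Continuous f) {L g : Gain n m N} {c r : ℝ} (hr : 0 < r)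
    (hfr : ∀ U : Gain n m N, ‖U‖ = 1 → |f (L + r • U) - f L - r * inner ℝ g U| ≤ c * r ^ 2)
    (q : Fin N × Fin n × Fin m) :
    |∫ U, (((n * m * N : ℕ) : ℝ) / r * f (L + r • U)) * U q ∂sphereLaw n m N - g q|
      ≤ ((n * m * N : ℕ) : ℝ) * (c * r) := by
  have := isProbabilityMeasure_sphereLaw hn hm hN
  set d₁ : ℝ := ((n * m * N : ℕ) : ℝ)
  have hd₁ : 0 ≤ d₁ := Nat.cast_nonneg _
  have hint : ∀ {h : Gain n m N → ℝ}, Continuous h → Integrable h (sphereLaw n m N) :=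
    fun hh => integrable_sphereLaw_of_continuous hn hm hN hh
  have hsplit : ∀ U : Gain n m N, (d₁ / r * f (L + r • U)) * U q
      = d₁ / r * ((f (L + r • U) - f L - r * inner ℝ g U) * U q)
        + (d₁ / r * f L * U q + d₁ * (inner ℝ g U * U q)) := by
    intro U; field_simp; ring
  have h1 : ∫ U, (d₁ / r * f (L + r • U)) * U q ∂sphereLaw n m N - g q
      = ∫ U, d₁ / r * ((f (L + r • U) - f L - r * inner ℝ g U) * U q) ∂sphereLaw n m N := by
    simp only [hsplit]
    rw [integral_add (hint (by fun_prop)) (hint (by fun_prop)),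
      integral_add (hint (by fun_prop)) (hint (by fun_prop)), integral_const_mul (d₁ / r * f L),
      integral_sphereLaw_apply, integral_const_mul d₁,
      integral_sphereLaw_inner_mul_apply hn hm hN]
    ring
  rw [h1]
  have h2 : ∀ᵐ U ∂sphereLaw n m N,
      ‖d₁ / r * ((f (L + r • U) - f L - r * inner ℝ g U) * U q)‖ ≤ d₁ * (c * r) := by
    filter_upwards [ae_norm_eq_one_sphereLaw] with U hU
    have hq : |U q| ≤ 1 := by
      have := PiLp.norm_apply_le U q
      rwa [hU] at this
    rw [Real.norm_eq_abs, abs_mul, abs_mul, abs_of_nonneg (by positivity : 0 ≤ d₁ / r)]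
    calc _ ≤ d₁ / r * (c * r ^ 2 * 1) := by
          gcongr
          · exact (abs_nonneg _).trans (hfr U hU)
          · exact hfr U hU
      _ = d₁ * (c * r) := by field_simp
  simpa using norm_integral_le_of_norm_le_const h2

end Sphere

/-! ### Concentration of the estimates of one iteration -/

section Hoeffding

variable {X : Type*} [MeasurableSpace X] {μ : Measure X} [IsProbabilityMeasure μ]

open ProbabilityTheory in
lemma hoeffding_sum_ge {f : X → ℝ} (hf : Measurable f) {b : ℝ} (hb : 0 < b)
    (hfb : ∀ᵐ x ∂μ, |f x| ≤ b) {M : ℕ} (hM : 0 < M) {s : ℝ} (hs : 0 ≤ s) :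
    (Measure.pi fun _ : Fin M => μ).real {z | s ≤ 1 / M * ∑ i, f (z i) - ∫ x, f x ∂μ}
      ≤ Real.exp (-(M * s ^ 2 / (2 * b ^ 2))) := by
  set Pr := Measure.pi fun _ : Fin M => μ
  have hM' : (0 : ℝ) < M := Nat.cast_pos.2 hM
  have hind : iIndepFun (fun (i : Fin M) (z : Fin M → X) => f (z i) - ∫ x, f x ∂μ) Pr :=
    iIndepFun_pi (μ := fun _ : Fin M => μ) (X := fun _ x => f x - ∫ x, f x ∂μ)
      fun _ => (hf.sub_const _).aemeasurable
  have hsub : ∀ i ∈ (Finset.univ : Finset (Fin M)),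
      HasSubgaussianMGF (fun z : Fin M → X => f (z i) - ∫ x, f x ∂μ)
        ((‖b - -b‖₊ / 2) ^ 2) Pr := by
    intro i _
    have hp := measurePreserving_eval (fun _ : Fin M => μ) i
    have h1 : HasSubgaussianMGF (fun x => f x - ∫ x, f x ∂μ) ((‖b - -b‖₊ / 2) ^ 2)
        (Pr.map (Function.eval i)) := by
      rw [hp.map_eq]
      refine hasSubgaussianMGF_of_mem_Icc hf.aemeasurable ?_
      filter_upwards [hfb] with x hx using abs_le.1 hx
    exact HasSubgaussianMGF.of_map hp.measurable.aemeasurable h1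
  have h := HasSubgaussianMGF.measure_sum_ge_le_of_iIndepFun hind hsub
    (mul_nonneg hM'.le hs)
  have hc : ((∑ i ∈ (Finset.univ : Finset (Fin M)), (‖b - -b‖₊ / 2) ^ 2 : NNReal) : ℝ)
      = M * b ^ 2 := by
    push_cast
    rw [Finset.sum_const, Finset.card_univ, Fintype.card_fin, nsmul_eq_mul, Real.norm_eq_abs,
      abs_of_pos (by linarith)]
    ring
  rw [hc] at h
  have hset : {z : Fin M → X | s ≤ 1 / M * ∑ i, f (z i) - ∫ x, f x ∂μ}
      = {z | M * s ≤ ∑ i, (f (z i) - ∫ x, f x ∂μ)} := by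
    ext z
    simp only [Set.mem_ofPred_eq, Finset.sum_sub_distrib, Finset.sum_const, Finset.card_univ,
      Fintype.card_fin, nsmul_eq_mul]
    rw [← mul_le_mul_iff_of_pos_left hM', mul_sub, ← mul_assoc, mul_one_div_cancel hM'.ne',
      one_mul]
  rw [hset]
  refine h.trans (le_of_eq ?_)
  congr 1
  field_simp

/-- **Hoeffding's inequality** for the empirical mean of a bounded function. -/
lemma hoeffding_abs_mean_sub_ge {f : X → ℝ} (hf : Measurable f) {b : ℝ} (hb : 0 < b)
    (hfb : ∀ᵐ x ∂μ, |f x| ≤ b) {M : ℕ} (hM : 0 < M) {s : ℝ} (hs : 0 ≤ s) :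
    (Measure.pi fun _ : Fin M => μ).real {z | s ≤ |1 / M * ∑ i, f (z i) - ∫ x, f x ∂μ|}
      ≤ 2 * Real.exp (-(M * s ^ 2 / (2 * b ^ 2))) := by
  have h1 := hoeffding_sum_ge hf hb hfb hM hs
  have h2 := hoeffding_sum_ge (f := fun x => -f x) hf.neg hb (by simpa using hfb) hM hs
  have hsub : {z : Fin M → X | s ≤ |1 / M * ∑ i, f (z i) - ∫ x, f x ∂μ|}
      ⊆ {z | s ≤ 1 / M * ∑ i, f (z i) - ∫ x, f x ∂μ}
        ∪ {z | s ≤ 1 / M * ∑ i, -f (z i) - ∫ x, -f x ∂μ} := by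
    intro z hz
    rcases le_abs.1 (Set.mem_ofPred_eq ▸ hz) with h | h
    · exact Or.inl h
    · right
      simp only [Set.mem_ofPred_eq, Finset.sum_neg_distrib, integral_neg]
      linarith
  linarith [measureReal_mono (μ := Measure.pi fun _ : Fin M => μ) hsub,
    measureReal_union_le (μ := Measure.pi fun _ : Fin M => μ)
      {z : Fin M → X | s ≤ 1 / M * ∑ i, f (z i) - ∫ x, f x ∂μ}
      {z | s ≤ 1 / M * ∑ i, -f (z i) - ∫ x, -f x ∂μ}]

end Hoeffding

namespace LQGame

variable {m n d N : ℕ} (S : LQGame m n d N) (K : Gain d m N)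

lemma isProbabilityMeasure_drawLaw (hn : 0 < n) (hm : 0 < m) (hN : 0 < N) :
    IsProbabilityMeasure (S.drawLaw : Measure (Draw m n N)) := by
  have := isProbabilityMeasure_sphereLaw hn hm hN
  unfold drawLaw
  infer_instance

lemma ae_drawLaw (hn : 0 < n) (hm : 0 < m) (hN : 0 < N) :
    ∀ᵐ z ∂(S.drawLaw : Measure (Draw m n N)),
      ‖z.1‖ = 1 ∧ z.2.1 ∈ S.boundedPaths ∧ z.2.2 ∈ S.boundedPaths := by
  have := isProbabilityMeasure_sphereLaw hn hm hN
  have h1 := (Measure.quasiMeasurePreserving_fst (μ := sphereLaw n m N)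
    (ν := S.pathLaw.prod S.pathLaw)).ae ae_norm_eq_one_sphereLaw
  have hsnd := Measure.quasiMeasurePreserving_snd (μ := sphereLaw n m N)
    (ν := S.pathLaw.prod S.pathLaw)
  have h2 := hsnd.ae (Measure.quasiMeasurePreserving_fst.ae S.ae_mem_boundedPaths)
  have h3 := hsnd.ae (Measure.quasiMeasurePreserving_snd.ae S.ae_mem_boundedPaths)
  filter_upwards [h1, h2, h3] with z a b c using ⟨a, b, c⟩

variable {S K}

lemma covEst_apply {M : ℕ} (L : Gain n m N) (z : Fin M → Draw m n N) (t : Fin (N + 1))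
    (i j : Fin m) : S.covEst K L z t i j
      = 1 / M * ∑ k, S.traj K L (z k).2.2 t i * S.traj K L (z k).2.2 t j := by
  simp [covEst, Matrix.sum_apply, vecMulVec_apply]

lemma gradEst_apply {M : ℕ} (r : ℝ) (L : Gain n m N) (z : Fin M → Draw m n N)
    (q : Fin N × Fin n × Fin m) : S.gradEst K r L z q
      = 1 / M * ∑ k, (((n * m * N : ℕ) : ℝ) / r * S.cost K (L + r • (z k).1) (z k).2.1)
          * (z k).1 q := by
  simp [gradEst]

lemma abs_traj_mul_traj_le {L : Gain n m N} {ξ : Fin (N + 1) → Fin m → ℝ} {s : ℝ}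
    {t : Fin (N + 1)} (h : ‖WithLp.toLp 2 (S.traj K L ξ t)‖ ^ 2 ≤ s) (i j : Fin m) :
    |S.traj K L ξ t i * S.traj K L ξ t j| ≤ s := by
  have hi := PiLp.norm_apply_le (WithLp.toLp 2 (S.traj K L ξ t)) i
  have hj := PiLp.norm_apply_le (WithLp.toLp 2 (S.traj K L ξ t)) j
  rw [abs_mul]
  calc _ ≤ ‖WithLp.toLp 2 (S.traj K L ξ t)‖ * ‖WithLp.toLp 2 (S.traj K L ξ t)‖ :=
        mul_le_mul hi hj (abs_nonneg _) (norm_nonneg _)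
    _ ≤ s := by rwa [← sq]

/-- Concentration of one entry of the covariance estimate. -/
lemma measureReal_covEst_ge_le (hn : 0 < n) (hm : 0 < m) (hN : 0 < N) {L : Gain n m N} {s : ℝ}
    (hs : 0 < s) (hL : ∀ ξ ∈ S.boundedPaths, ∀ t, ‖WithLp.toLp 2 (S.traj K L ξ t)‖ ^ 2 ≤ s)
    {M : ℕ} (hM : 0 < M) {σ : ℝ} (hσ : 0 ≤ σ) (t : Fin (N + 1)) (i j : Fin m) :
    (Measure.pi fun _ : Fin M => (S.drawLaw : Measure (Draw m n N))).real
      {z | σ ≤ |S.covEst K L z t i j - S.stateCov K L t i j|}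
      ≤ 2 * Real.exp (-(M * σ ^ 2 / (2 * s ^ 2))) := by
  have := S.isProbabilityMeasure_drawLaw hn hm hN
  have := isProbabilityMeasure_sphereLaw hn hm hN
  set f : Draw m n N → ℝ := fun z => S.traj K L z.2.2 t i * S.traj K L z.2.2 t j with hf
  have hc := S.continuous_traj_right K L t
  have hfm : Measurable f := by
    have : Continuous f := by
      have h1 := (hc i).comp (continuous_snd.comp continuous_snd :
        Continuous fun z : Draw m n N => z.2.2)
      have h2 := (hc j).comp (continuous_snd.comp continuous_snd :
        Continuous fun z : Draw m n N => z.2.2)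
      exact h1.mul h2
    exact this.measurable
  have hfb : ∀ᵐ z ∂(S.drawLaw : Measure (Draw m n N)), |f z| ≤ s := by
    filter_upwards [S.ae_drawLaw hn hm hN] with z hz
    exact abs_traj_mul_traj_le (hL _ hz.2.2 t) i j
  have hfi : ∫ z, f z ∂(S.drawLaw : Measure (Draw m n N)) = S.stateCov K L t i j := by
    rw [← S.integral_traj_mul_traj]
    unfold drawLaw
    have e1 := integral_fun_snd (μ := sphereLaw n m N) (ν := S.pathLaw.prod S.pathLaw)
      (fun w => S.traj K L w.2 t i * S.traj K L w.2 t j)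
    have e2 := integral_fun_snd (μ := S.pathLaw) (ν := S.pathLaw)
      (fun w => S.traj K L w t i * S.traj K L w t j)
    simp only [probReal_univ, one_smul] at e1 e2
    rw [hf, e1, e2]
  have h := hoeffding_abs_mean_sub_ge hfm hs hfb hM hσ
  rw [hfi] at h
  simpa only [covEst_apply] using h

/-- Concentration of one entry of the gradient estimate around the true gradient: the bias
contributes `d₁ c r` and Hoeffding's inequality the deviation. -/
lemma measureReal_gradEst_ge_le (hn : 0 < n) (hm : 0 < m) (hN : 0 < N) {L g : Gain n m N}
    {gmax c r : ℝ} (hg : 0 < gmax) (hr : 0 < r)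
    (hcost : ∀ ξ ∈ S.boundedPaths, ∀ U : Gain n m N, ‖U‖ = 1 → |S.cost K (L + r • U) ξ| ≤ gmax)
    (hfr : ∀ U : Gain n m N, ‖U‖ = 1 →
      |S.G K (L + r • U) - S.G K L - r * inner ℝ g U| ≤ c * r ^ 2)
    {M : ℕ} (hM : 0 < M) {σ : ℝ} (hσ : 0 ≤ σ) (q : Fin N × Fin n × Fin m) :
    (Measure.pi fun _ : Fin M => (S.drawLaw : Measure (Draw m n N))).real
      {z | σ + ((n * m * N : ℕ) : ℝ) * (c * r) ≤ |S.gradEst K r L z q - g q|}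
      ≤ 2 * Real.exp (-(M * σ ^ 2 / (2 * (((n * m * N : ℕ) : ℝ) / r * gmax) ^ 2))) := by
  have := S.isProbabilityMeasure_drawLaw hn hm hN
  have := isProbabilityMeasure_sphereLaw hn hm hN
  have hd₁ : 0 < ((n * m * N : ℕ) : ℝ) := by positivity
  set d₁ : ℝ := ((n * m * N : ℕ) : ℝ)
  set f : Draw m n N → ℝ := fun z => (d₁ / r * S.cost K (L + r • z.1) z.2.1) * z.1 q with hf
  have hcc := S.continuous_cost (n := n) K
  have hfc : Continuous f := by
    have h1 : Continuous fun z : Draw m n N => S.cost K (L + r • z.1) z.2.1 :=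
      hcc.comp (f := fun z : Draw m n N => (L + r • z.1, z.2.1)) (by fun_prop)
    have h2 : Continuous fun z : Draw m n N => z.1 q := by fun_prop
    exact (continuous_const.mul h1).mul h2
  have hfb : ∀ᵐ z ∂(S.drawLaw : Measure (Draw m n N)), |f z| ≤ d₁ / r * gmax := by
    filter_upwards [S.ae_drawLaw hn hm hN] with z hz
    have hq : |z.1 q| ≤ 1 := by
      have := PiLp.norm_apply_le z.1 q
      rwa [hz.1] at this
    rw [hf]
    simp only [abs_mul, abs_of_pos (div_pos hd₁ hr)]
    calc _ ≤ d₁ / r * gmax * 1 := by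
          gcongr
          exact hcost _ hz.2.1 _ hz.1
      _ = _ := mul_one _
  have hfi : ∫ z, f z ∂(S.drawLaw : Measure (Draw m n N))
      = ∫ U, (d₁ / r * S.G K (L + r • U)) * U q ∂sphereLaw n m N := by
    have hint : Integrable f S.drawLaw := Integrable.of_bound hfc.aestronglyMeasurable _ hfb
    unfold drawLaw at hint ⊢
    rw [integral_prod _ hint]
    refine integral_congr_ae (Filter.Eventually.of_forall fun U => ?_)
    have e2 := integral_fun_fst (μ := S.pathLaw) (ν := S.pathLaw)
      (fun w => (d₁ / r * S.cost K (L + r • U) w) * U q)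
    simp only [probReal_univ, one_smul] at e2
    simp only [hf]
    rw [e2, integral_mul_const, integral_const_mul]
    rfl
  have hbias := abs_integral_one_point_sub_le hn hm hN (S.contDiff_G (K := K)).continuous hr hfr q
  have h := hoeffding_abs_mean_sub_ge hfc.measurable (by positivity) hfb hM hσ
  rw [hfi] at h
  refine (measureReal_mono ?_).trans h
  intro z hz
  simp only [Set.mem_ofPred_eq, gradEst_apply] at hz ⊢
  have := abs_sub_le (1 / (M : ℝ) * ∑ k, f (z k))
    (∫ U, (d₁ / r * S.G K (L + r • U)) * U q ∂sphereLaw n m N) (g q)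
  linarith

/-- The estimates of one iteration are accurate: entrywise for the gradient and for the covariance,
and all the unperturbed trajectories obey the bound `‖x_t‖² ≤ s`. -/
def Accurate (S : LQGame m n d N) (K : Gain d m N) (r σ₁ σ₂ s : ℝ) {M : ℕ} (L : Gain n m N)
    (z : Fin M → Draw m n N) : Prop :=
  (∀ q, |S.gradEst K r L z q - gradient (S.G K) L q| < σ₁) ∧
  (∀ t i j, |S.covEst K L z t i j - S.stateCov K L t i j| < σ₂) ∧
  ∀ k t, ‖WithLp.toLp 2 (S.traj K L (z k).2.2 t)‖ ^ 2 ≤ s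

/-- A union bound over the entries of the two estimates. -/
lemma measureReal_not_accurate_le (hn : 0 < n) (hm : 0 < m) (hN : 0 < N) {L : Gain n m N}
    {gmax c r s : ℝ} (hg : 0 < gmax) (hr : 0 < r) (hs : 0 < s)
    (hL : ∀ ξ ∈ S.boundedPaths, ∀ t, ‖WithLp.toLp 2 (S.traj K L ξ t)‖ ^ 2 ≤ s)
    (hcost : ∀ ξ ∈ S.boundedPaths, ∀ U : Gain n m N, ‖U‖ = 1 → |S.cost K (L + r • U) ξ| ≤ gmax)
    (hfr : ∀ U : Gain n m N, ‖U‖ = 1 →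
      |S.G K (L + r • U) - S.G K L - r * inner ℝ (gradient (S.G K) L) U| ≤ c * r ^ 2)
    {M : ℕ} (hM : 0 < M) {σ σ₂ b : ℝ} (hσ : 0 ≤ σ) (hσ₂ : 0 ≤ σ₂)
    (hb₁ : b ≤ M * σ ^ 2 / (2 * (((n * m * N : ℕ) : ℝ) / r * gmax) ^ 2))
    (hb₂ : b ≤ M * σ₂ ^ 2 / (2 * s ^ 2)) :
    (Measure.pi fun _ : Fin M => (S.drawLaw : Measure (Draw m n N))).real
      {z | ¬ S.Accurate K r (σ + ((n * m * N : ℕ) : ℝ) * (c * r)) σ₂ s L z}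
      ≤ 4 * ((max (n * m * N) (m ^ 2 * (N + 1)) : ℕ) : ℝ) * Real.exp (-b) := by
  have := S.isProbabilityMeasure_drawLaw hn hm hN
  set Pr := Measure.pi fun _ : Fin M => (S.drawLaw : Measure (Draw m n N))
  set A := fun q => {z : Fin M → Draw m n N |
    σ + ((n * m * N : ℕ) : ℝ) * (c * r) ≤ |S.gradEst K r L z q - gradient (S.G K) L q|}
  set B := fun p : Fin (N + 1) × Fin m × Fin m => {z : Fin M → Draw m n N |
    σ₂ ≤ |S.covEst K L z p.1 p.2.1 p.2.2 - S.stateCov K L p.1 p.2.1 p.2.2|}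
  set Z := {z : Fin M → Draw m n N |
    ¬ ∀ k t, ‖WithLp.toLp 2 (S.traj K L (z k).2.2 t)‖ ^ 2 ≤ s}
  have hZ : Pr.real Z = 0 := by
    rw [measureReal_eq_zero_iff]
    have h1 : ∀ᵐ z ∂Pr, ∀ k t, ‖WithLp.toLp 2 (S.traj K L (z k).2.2 t)‖ ^ 2 ≤ s := by
      refine ae_all_iff.2 fun k => ?_
      have := (measurePreserving_eval (fun _ : Fin M => (S.drawLaw : Measure (Draw m n N)))
        k).quasiMeasurePreserving.ae (S.ae_drawLaw hn hm hN)
      filter_upwards [this] with z hz t using hL _ hz.2.2 t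
    exact h1
  have hsub : {z | ¬ S.Accurate K r (σ + ((n * m * N : ℕ) : ℝ) * (c * r)) σ₂ s L z}
      ⊆ (⋃ q, A q) ∪ ((⋃ p, B p) ∪ Z) := by
    intro z hz
    simp only [Set.mem_ofPred_eq, Accurate, not_and_or, not_forall, not_lt] at hz
    rcases hz with ⟨q, hq⟩ | ⟨t, i, j, h⟩ | hz
    · exact Or.inl (Set.mem_iUnion.2 ⟨q, hq⟩)
    · exact Or.inr (Or.inl (Set.mem_iUnion.2 ⟨(t, i, j), h⟩))
    · refine Or.inr (Or.inr ?_)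
      simpa [Z] using hz
  have hA : Pr.real (⋃ q, A q) ≤ ((n * m * N : ℕ) : ℝ) * (2 * Real.exp (-b)) := by
    refine (measureReal_iUnion_fintype_le A).trans ?_
    refine (Finset.sum_le_sum fun q _ => (measureReal_gradEst_ge_le hn hm hN hg hr hcost hfr hM
      hσ q).trans (mul_le_mul_of_nonneg_left (Real.exp_le_exp.2 (neg_le_neg hb₁)) two_pos.le)).trans
      (le_of_eq ?_)
    simp only [Finset.sum_const, Finset.card_univ, Fintype.card_prod, Fintype.card_fin,
      nsmul_eq_mul]
    push_cast; ring
  have hB : Pr.real (⋃ p, B p) ≤ ((m ^ 2 * (N + 1) : ℕ) : ℝ) * (2 * Real.exp (-b)) := by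
    refine (measureReal_iUnion_fintype_le B).trans ?_
    refine (Finset.sum_le_sum fun q _ => (measureReal_covEst_ge_le hn hm hN hs hL hM
      hσ₂ _ _ _).trans (mul_le_mul_of_nonneg_left (Real.exp_le_exp.2 (neg_le_neg hb₂))
        two_pos.le)).trans (le_of_eq ?_)
    simp only [Finset.sum_const, Finset.card_univ, Fintype.card_prod, Fintype.card_fin,
      nsmul_eq_mul]
    push_cast; ring
  have h1 : ((n * m * N : ℕ) : ℝ) ≤ ((max (n * m * N) (m ^ 2 * (N + 1)) : ℕ) : ℝ) :=
    Nat.cast_le.2 (le_max_left _ _)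
  have h2 : ((m ^ 2 * (N + 1) : ℕ) : ℝ) ≤ ((max (n * m * N) (m ^ 2 * (N + 1)) : ℕ) : ℝ) :=
    Nat.cast_le.2 (le_max_right _ _)
  have he := Real.exp_pos (-b)
  calc _ ≤ Pr.real ((⋃ q, A q) ∪ ((⋃ p, B p) ∪ Z)) := measureReal_mono hsub
    _ ≤ Pr.real (⋃ q, A q) + (Pr.real (⋃ p, B p) + Pr.real Z) :=
        (measureReal_union_le _ _).trans (add_le_add le_rfl (measureReal_union_le _ _))
    _ ≤ _ := by rw [hZ]; nlinarith

end LQGame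

/-! ### Accuracy along a whole run -/

namespace LQGame

variable {m n d N : ℕ} {S : LQGame m n d N} {K : Gain d m N}

lemma continuous_gradEst (r : ℝ) (M : ℕ) :
    Continuous fun p : Gain n m N × (Fin M → Draw m n N) => S.gradEst K r p.1 p.2 := by
  unfold gradEst
  apply Continuous.fun_const_smul
  refine continuous_finsetSum _ fun i _ => ?_
  have h1 : Continuous fun p : Gain n m N × (Fin M → Draw m n N) =>
      S.cost K (p.1 + r • (p.2 i).1) (p.2 i).2.1 :=
    (S.continuous_cost (n := n) K).comp
      (f := fun p : Gain n m N × (Fin M → Draw m n N) => (p.1 + r • (p.2 i).1, (p.2 i).2.1))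
      (by fun_prop)
  have h2 : Continuous fun p : Gain n m N × (Fin M → Draw m n N) => (p.2 i).1 := by fun_prop
  exact (continuous_const.mul h1).smul h2

lemma continuous_traj_draw (M : ℕ) (k : Fin M) (t : Fin (N + 1)) :
    Continuous fun p : Gain n m N × (Fin M → Draw m n N) => S.traj K p.1 (p.2 k).2.2 t :=
  (S.continuous_traj K t).comp
    (f := fun p : Gain n m N × (Fin M → Draw m n N) => (p.1, (p.2 k).2.2)) (by fun_prop)

lemma continuous_covEst (M : ℕ) (t : Fin (N + 1)) :
    Continuous fun p : Gain n m N × (Fin M → Draw m n N) => S.covEst K p.1 p.2 t := by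
  unfold covEst
  apply Continuous.fun_const_smul
  refine continuous_finsetSum _ fun i _ => ?_
  exact (continuous_traj_draw M i t).matrix_vecMulVec (continuous_traj_draw M i t)

instance (M : ℕ) : OpensMeasurableSpace (Fin M → Draw m n N) := Pi.opensMeasurableSpace

lemma measurable_matrix_inv_apply {X : Type*} [MeasurableSpace X] [TopologicalSpace X]
    [OpensMeasurableSpace X] {f : X → Matrix (Fin m) (Fin m) ℝ} (hf : Continuous f)
    (i j : Fin m) : Measurable fun x => (f x)⁻¹ i j := by
  simp only [Matrix.inv_def, Ring.inverse_eq_inv', Matrix.smul_apply, smul_eq_mul]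
  exact hf.matrix_det.measurable.inv.mul
    ((hf.matrix_adjugate).matrix_elem i j).measurable

lemma measurable_npgStep (r η : ℝ) (M : ℕ) :
    Measurable fun p : Gain n m N × (Fin M → Draw m n N) => S.npgStep K r η p.1 p.2 := by
  unfold npgStep
  refine measurable_fst.add (Measurable.const_smul ?_ η)
  unfold Gain.ofBlocks
  refine (WithLp.measurable_toLp 2 _).comp (measurable_pi_lambda _ fun q => ?_)
  simp only [Matrix.mul_apply]
  refine Finset.measurable_sum _ fun l _ => Measurable.mul ?_ ?_
  · have := (continuous_block q.1).comp (continuous_gradEst (S := S) (K := K) r M)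
    exact (this.matrix_elem q.2.1 l).measurable
  · exact measurable_matrix_inv_apply (continuous_covEst M _) l q.2.2

lemma measurableSet_accurate (r σ₁ σ₂ s : ℝ) (M : ℕ) :
    MeasurableSet {p : Gain n m N × (Fin M → Draw m n N) | S.Accurate K r σ₁ σ₂ s p.1 p.2} := by
  have hgrad : Continuous fun L : Gain n m N => gradient (S.G K) L := by
    unfold gradient
    exact (LinearIsometryEquiv.continuous _).comp
      (contDiff_G.continuous_fderiv (by norm_num))
  have hg : ∀ q : Fin N × Fin n × Fin m, Continuous fun p : Gain n m N × (Fin M → Draw m n N) =>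
      |S.gradEst K r p.1 p.2 q - gradient (S.G K) p.1 q| := fun q => by
    have h1 := continuous_gradEst (S := S) (K := K) r M
    have h2 := hgrad.comp (continuous_fst (X := Gain n m N) (Y := Fin M → Draw m n N))
    exact Continuous.abs (((PiLp.continuous_apply 2 _ q).comp h1).sub
      ((PiLp.continuous_apply 2 _ q).comp h2))
  have hc : ∀ t i j, Continuous fun p : Gain n m N × (Fin M → Draw m n N) =>
      |S.covEst K p.1 p.2 t i j - S.stateCov K p.1 t i j| := fun t i j =>
    (((continuous_covEst M t).matrix_elem i j).sub
      (((continuous_stateCov t).comp continuous_fst).matrix_elem i j)).abs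
  have hx : ∀ k t, Continuous fun p : Gain n m N × (Fin M → Draw m n N) =>
      ‖WithLp.toLp 2 (S.traj K p.1 (p.2 k).2.2 t)‖ ^ 2 := fun k t =>
    (((PiLp.continuous_toLp 2 _).comp (continuous_traj_draw M k t)).norm).pow 2
  simp only [Accurate, Set.ofPred_and, Set.ofPred_forall]
  refine MeasurableSet.inter (MeasurableSet.iInter fun q => ?_)
    (MeasurableSet.inter (MeasurableSet.iInter fun t => MeasurableSet.iInter fun i =>
      MeasurableSet.iInter fun j => ?_)
      (MeasurableSet.iInter fun k => MeasurableSet.iInter fun t => ?_))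
  · exact measurableSet_lt (hg q).measurable measurable_const
  · exact measurableSet_lt (hc t i j).measurable measurable_const
  · exact measurableSet_le (hx k t).measurable measurable_const

variable {T M : ℕ}

@[simp] lemma iterate_zero (r η : ℝ) (L₀ : Gain n m N) (ω : Fin T → Fin M → Draw m n N) :
    S.iterate K r η L₀ ω 0 = L₀ := rfl

@[simp] lemma iterate_succ (r η : ℝ) (L₀ : Gain n m N) (ω : Fin T → Fin M → Draw m n N)
    (j : Fin T) : S.iterate K r η L₀ ω j.succ
      = S.npgStep K r η (S.iterate K r η L₀ ω j.castSucc) (ω j) := by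
  simp [iterate]

lemma measurable_iterate (r η : ℝ) (L₀ : Gain n m N) (t : Fin (T + 1)) :
    Measurable fun ω : Fin T → Fin M → Draw m n N => S.iterate K r η L₀ ω t := by
  induction t using Fin.induction with
  | zero => exact measurable_const
  | succ t ih =>
    simp only [iterate_succ]
    exact (measurable_npgStep r η M).comp (ih.prodMk (measurable_pi_apply t))

/-- An iterate depends only on the draws of the earlier iterations. -/
lemma iterate_congr (r η : ℝ) (L₀ : Gain n m N) {ω ω' : Fin T → Fin M → Draw m n N}
    (t : Fin (T + 1)) (h : ∀ i : Fin T, i.castSucc < t → ω i = ω' i) :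
    S.iterate K r η L₀ ω t = S.iterate K r η L₀ ω' t := by
  induction t using Fin.induction with
  | zero => rw [iterate_zero, iterate_zero]
  | succ t ih =>
    rw [iterate_succ, iterate_succ, ih fun i hi => h i (hi.trans t.castSucc_lt_succ),
      h t t.castSucc_lt_succ]

/-- As the draws of an iteration are independent of the iterate they are used at, the probability
that they miss a set `B`, while the iterate lies in `I`, is bounded as for a fixed iterate. -/
lemma runLaw_iterate_mem_le (hn : 0 < n) (hm : 0 < m) (hN : 0 < N) (r η : ℝ) (L₀ : Gain n m N)
    {B : Set (Gain n m N × (Fin M → Draw m n N))} (hB : MeasurableSet B) {c : ENNReal}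
    (hc : ∀ L, (Measure.pi fun _ : Fin M => (S.drawLaw : Measure (Draw m n N))) {z | (L, z) ∈ B}
      ≤ c) (j : Fin T) :
    (S.runLaw T M : Measure (Fin T → Fin M → Draw m n N))
      {ω | (S.iterate K r η L₀ ω j.castSucc, ω j) ∈ B} ≤ c := by
  obtain ⟨T', rfl⟩ : ∃ T', T = T' + 1 := ⟨T - 1, by have := j.2; omega⟩
  have := S.isProbabilityMeasure_drawLaw hn hm hN
  set ν : Measure (Fin M → Draw m n N) := Measure.pi fun _ => S.drawLaw
  set A := {ω : Fin (T' + 1) → Fin M → Draw m n N |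
    (S.iterate K r η L₀ ω j.castSucc, ω j) ∈ B}
  have hA : MeasurableSet A :=
    ((measurable_iterate r η L₀ j.castSucc).prodMk (measurable_pi_apply j)) hB
  have hmp := (measurePreserving_piFinSuccAbove (fun _ : Fin (T' + 1) => ν) j).symm
  have h1 := hmp.measure_preimage hA.nullMeasurableSet
  have h2 : S.runLaw (T' + 1) M A = (Measure.pi fun _ : Fin (T' + 1) => ν) A := rfl
  rw [h2, ← h1, Measure.prod_apply_symm (hmp.measurable hA)]
  refine (lintegral_mono (g := fun _ => c) fun ω' => ?_).trans (by simp)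
  obtain ⟨z₀⟩ : Nonempty (Fin M → Draw m n N) :=
    ⟨fun _ => 0⟩
  refine le_trans (measure_mono fun z hz => ?_)
    (hc (S.iterate K r η L₀ (j.insertNth (α := fun _ => Fin M → Draw m n N) z₀ ω') j.castSucc))
  have hz' : (S.iterate K r η L₀ (j.insertNth (α := fun _ => Fin M → Draw m n N) z ω') j.castSucc,
      (j.insertNth (α := fun _ => Fin M → Draw m n N) z ω' : Fin (T' + 1) → _) j) ∈ B := hz
  rw [Fin.insertNth_apply_same] at hz'
  rw [Set.mem_ofPred_eq, iterate_congr r η L₀ (ω' := j.insertNth z ω')]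
  · exact hz'
  · intro i hi
    obtain ⟨k, rfl⟩ := Fin.exists_succAbove_eq (x := i) (y := j) (by
      rintro rfl; exact lt_irrefl _ hi)
    rw [Fin.insertNth_apply_succAbove, Fin.insertNth_apply_succAbove]

/-- A union bound over the iterations. -/
lemma one_sub_le_runLaw_accurate (hn : 0 < n) (hm : 0 < m) (hN : 0 < N) (r η : ℝ)
    (L₀ : Gain n m N) {I : Set (Gain n m N)} (hI : MeasurableSet I) {σ₁ σ₂ s c : ℝ}
    (hc : 0 ≤ c) (hacc : ∀ L ∈ I, (Measure.pi fun _ : Fin M =>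
      (S.drawLaw : Measure (Draw m n N))).real {z | ¬ S.Accurate K r σ₁ σ₂ s L z} ≤ c)
    {E : Set (Fin T → Fin M → Draw m n N)}
    (hE : ∀ ω, (∀ j : Fin T, S.iterate K r η L₀ ω j.castSucc ∈ I →
      S.Accurate K r σ₁ σ₂ s (S.iterate K r η L₀ ω j.castSucc) (ω j)) → ω ∈ E) :
    1 - T * c ≤ (S.runLaw T M).real E := by
  have := S.isProbabilityMeasure_drawLaw hn hm hN
  have hrun : IsProbabilityMeasure (S.runLaw T M : Measure (Fin T → Fin M → Draw m n N)) := by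
    unfold runLaw; infer_instance
  set B : Set (Gain n m N × (Fin M → Draw m n N)) :=
    (Prod.fst ⁻¹' I) ∩ {p | S.Accurate K r σ₁ σ₂ s p.1 p.2}ᶜ with hBdef
  have hB : MeasurableSet B :=
    (measurable_fst hI).inter (measurableSet_accurate r σ₁ σ₂ s M).compl
  have hBc : ∀ L, (Measure.pi fun _ : Fin M => (S.drawLaw : Measure (Draw m n N)))
      {z | (L, z) ∈ B} ≤ ENNReal.ofReal c := by
    intro L
    by_cases hL : L ∈ I
    · have h := hacc L hL
      rw [← ENNReal.ofReal_le_ofReal_iff hc, ofReal_measureReal] at h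
      refine (measure_mono fun z hz => ?_).trans h
      exact hz.2
    · have : {z | (L, z) ∈ B} = ∅ := by
        ext z; simp [hBdef, hL]
      rw [this]; simp
  have hbad : ∀ j : Fin T, (S.runLaw T M : Measure (Fin T → Fin M → Draw m n N)).real
      {ω | (S.iterate K r η L₀ ω j.castSucc, ω j) ∈ B} ≤ c := fun j => by
    rw [measureReal_def]
    exact ENNReal.toReal_le_of_le_ofReal hc (runLaw_iterate_mem_le hn hm hN r η L₀ hB hBc j)
  have hcov : (Set.univ : Set (Fin T → Fin M → Draw m n N))
      ⊆ E ∪ ⋃ j : Fin T, {ω | (S.iterate K r η L₀ ω j.castSucc, ω j) ∈ B} := by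
    intro ω _
    by_cases h : ∃ j : Fin T, (S.iterate K r η L₀ ω j.castSucc, ω j) ∈ B
    · exact Or.inr (Set.mem_iUnion.2 h)
    · refine Or.inl (hE ω fun j hj => ?_)
      by_contra hna
      exact h ⟨j, hj, hna⟩
  have h1 : (1 : ℝ) ≤ (S.runLaw T M).real E + T * c := by
    calc (1 : ℝ) = (S.runLaw T M : Measure (Fin T → Fin M → Draw m n N)).real Set.univ := by simp
      _ ≤ _ := (measureReal_mono hcov).trans (measureReal_union_le _ _)
      _ ≤ (S.runLaw T M).real E + ∑ j : Fin T, c := by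
          gcongr
          exact (measureReal_iUnion_fintype_le _).trans (Finset.sum_le_sum fun j _ => hbad j)
      _ = _ := by simp
  linarith

end LQGame

/-! ### Smoothness on balls and the ascent step -/

section Smooth

variable {E : Type*} [NormedAddCommGroup E] [InnerProductSpace ℝ E]

/-- A `C²` function is Lipschitz and smooth on every ball. -/
lemma exists_smoothness_constants [FiniteDimensional ℝ E] {f : E → ℝ} (hf : ContDiff ℝ 2 f)
    (ρ : ℝ) :
    ∃ l ψ : ℝ, 0 < l ∧ 0 < ψ ∧ ∀ x ∈ Metric.closedBall (0 : E) ρ, ‖gradient f x‖ ≤ l ∧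
      ∀ y ∈ Metric.closedBall (0 : E) ρ, |f y - f x| ≤ l * ‖y - x‖ ∧
        ‖gradient f y - gradient f x‖ ≤ ψ * ‖y - x‖ ∧
        |f y - f x - inner ℝ (gradient f x) (y - x)| ≤ ψ * ‖y - x‖ ^ 2 := by
  have hf1 : ContDiff ℝ 1 (fderiv ℝ f) := hf.fderiv_right (by norm_num)
  have hdf : Differentiable ℝ f := hf.differentiable (by norm_num)
  have hconv : Convex ℝ (Metric.closedBall (0 : E) ρ) := convex_closedBall _ _
  obtain ⟨l₀, hl₀⟩ := (isCompact_closedBall (0 : E) ρ).exists_bound_of_continuousOn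
    hf1.continuous.continuousOn
  obtain ⟨ψ₀, hψ₀⟩ := (isCompact_closedBall (0 : E) ρ).exists_bound_of_continuousOn
    (hf1.continuous_fderiv (by norm_num)).continuousOn
  have hgn : ∀ x, ‖gradient f x‖ = ‖fderiv ℝ f x‖ := fun x => by
    simp [gradient]
  have hgs : ∀ x y, ‖gradient f y - gradient f x‖ = ‖fderiv ℝ f y - fderiv ℝ f x‖ := fun x y => by
    rw [gradient, gradient, ← map_sub, LinearIsometryEquiv.norm_map]
  have hgi : ∀ x v, inner ℝ (gradient f x) v = fderiv ℝ f x v := fun x v => by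
    simp [gradient]
  have hlip : ∀ x ∈ Metric.closedBall (0 : E) ρ, ∀ y ∈ Metric.closedBall (0 : E) ρ,
      ‖fderiv ℝ f y - fderiv ℝ f x‖ ≤ max ψ₀ 1 * ‖y - x‖ := fun x hx y hy =>
    hconv.norm_image_sub_le_of_norm_fderiv_le
      (fun z _ => (hf1.differentiable (by norm_num)) z)
      (fun z hz => (hψ₀ z hz).trans (le_max_left _ _)) hx hy
  refine ⟨max l₀ 1, max ψ₀ 1, by positivity, by positivity, fun x hx => ⟨?_, fun y hy => ⟨?_, ?_, ?_⟩⟩⟩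
  · rw [hgn]; exact (hl₀ x hx).trans (le_max_left _ _)
  · exact hconv.norm_image_sub_le_of_norm_fderiv_le (fun z _ => hdf z)
      (fun z hz => (hl₀ z hz).trans (le_max_left _ _)) hx hy
  · rw [hgs]; exact hlip x hx y hy
  · rw [hgi]
    have hseg : segment ℝ x y ⊆ Metric.closedBall (0 : E) ρ := hconv.segment_subset hx hy
    have h := (convex_segment x y).norm_image_sub_le_of_norm_fderiv_le'
      (f := f) (φ := fderiv ℝ f x) (C := max ψ₀ 1 * ‖y - x‖) (fun z _ => hdf z)
      (fun z hz => (hlip x hx z (hseg hz)).trans ?_)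
      (left_mem_segment ℝ x y) (right_mem_segment ℝ x y)
    · rw [sq, ← mul_assoc]; exact h
    · have : ‖z - x‖ ≤ ‖y - x‖ := by
        obtain ⟨a, b, ha, hb, hab, rfl⟩ := hz
        have : a • x + b • y - x = b • (y - x) := by
          rw [smul_sub, ← sub_eq_zero]
          have : a = 1 - b := by linarith
          rw [this]; module
        rw [this, norm_smul, Real.norm_of_nonneg hb]
        exact mul_le_of_le_one_left (norm_nonneg _) (by linarith)
      gcongr

/-- Ascent along a preconditioned inexact gradient `v`, when `g` is within `e` of the gradient and
the preconditioner has its spectrum in `[1/s, 1/c]`. -/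
lemma ascent_step {g v grad : E} {c s e η ψ Δf : ℝ} (hc : 0 < c) (hs : 0 < s) (hη : 0 ≤ η)
    (he : ‖g - grad‖ ≤ e) (h₁ : c * ‖v‖ ^ 2 ≤ inner ℝ g v) (h₂ : ‖g‖ ^ 2 ≤ s * inner ℝ g v)
    (hηψ : η * ψ ≤ c / 4) (hf : |Δf - inner ℝ grad (η • v)| ≤ ψ * ‖η • v‖ ^ 2) :
    η * (‖grad‖ ^ 2 / (4 * s) - (1 / (2 * s) + 1 / c) * e ^ 2) ≤ Δf := by
  have he0 : 0 ≤ e := (norm_nonneg _).trans he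
  set β := inner ℝ g v with hβ
  have h3 : β - e * ‖v‖ ≤ inner ℝ grad v := by
    have h4 : inner ℝ grad v = β - inner ℝ (g - grad) v := by rw [inner_sub_left]; ring
    have h5 := (abs_le.1 (abs_real_inner_le_norm (g - grad) v)).2
    have h6 := mul_le_mul_of_nonneg_right he (norm_nonneg v)
    linarith
  have h4 : e * ‖v‖ ≤ β / 4 + e ^ 2 / c := by
    have h5 : 0 ≤ c * (‖v‖ / 2 - e / c) ^ 2 := by positivity
    have h6 : c * (‖v‖ / 2 - e / c) ^ 2 = c * ‖v‖ ^ 2 / 4 - e * ‖v‖ + e ^ 2 / c := by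
      field_simp; ring
    linarith
  have h5 : ‖grad‖ ^ 2 ≤ 2 * ‖g‖ ^ 2 + 2 * e ^ 2 := by
    have h6 : ‖grad‖ ≤ ‖g‖ + e := by
      have := norm_sub_le g (g - grad)
      rw [sub_sub_cancel] at this
      linarith
    nlinarith [norm_nonneg grad, norm_nonneg g, sq_nonneg (‖g‖ - e)]
  have h6 : ψ * ‖η • v‖ ^ 2 ≤ η * (β / 4) := by
    rw [norm_smul, Real.norm_of_nonneg hη, mul_pow]
    have : η * ψ * ‖v‖ ^ 2 ≤ c / 4 * ‖v‖ ^ 2 := mul_le_mul_of_nonneg_right hηψ (sq_nonneg _)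
    calc ψ * (η ^ 2 * ‖v‖ ^ 2) = η * (η * ψ * ‖v‖ ^ 2) := by ring
      _ ≤ η * (β / 4) := mul_le_mul_of_nonneg_left (by linarith) hη
  have h7 := (abs_le.1 hf).1
  rw [inner_smul_right] at h7
  have h8 : ‖grad‖ ^ 2 / (4 * s) - (1 / (2 * s) + 1 / c) * e ^ 2 ≤ β / 2 - e ^ 2 / c := by
    have h9 : ‖grad‖ ^ 2 / (4 * s) ≤ (2 * (s * β) + 2 * e ^ 2) / (4 * s) := by
      gcongr; linarith
    have h10 : (2 * (s * β) + 2 * e ^ 2) / (4 * s) = β / 2 + 1 / (2 * s) * e ^ 2 := by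
      field_simp; ring
    have h11 : (1 / (2 * s) + 1 / c) * e ^ 2 = 1 / (2 * s) * e ^ 2 + e ^ 2 / c := by ring
    linarith
  nlinarith [mul_le_mul_of_nonneg_left h8 hη, mul_le_mul_of_nonneg_left h3 hη,
    mul_le_mul_of_nonneg_left h4 hη]

end Smooth

section Preconditioner

variable {n m N : ℕ}

lemma Gain.inner_eq_sum_trace (X Y : Gain n m N) :
    inner ℝ X Y = ∑ t, (X.block t * (Y.block t)ᵀ).trace := by
  rw [PiLp.inner_apply, Fintype.sum_prod_type]
  refine Finset.sum_congr rfl fun t _ => ?_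
  rw [Fintype.sum_prod_type, Matrix.trace]
  refine Finset.sum_congr rfl fun i _ => ?_
  rw [Matrix.diag, Matrix.mul_apply]
  exact Finset.sum_congr rfl fun j _ => by simp [Gain.block, mul_comm]

lemma Matrix.posSemidef_smul_sub_mul_self {C : Matrix (Fin m) (Fin m) ℝ} {s : ℝ} (hs : 0 < s)
    (hC : C.PosSemidef) (hCs : (s • (1 : Matrix (Fin m) (Fin m) ℝ) - C).PosSemidef) :
    (s • C - C * C).PosSemidef := by
  refine posSemidef_of_quadForm_nonneg (by simp [hC.transpose_eq]) fun v => ?_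
  have h1 := hC.quadForm_nonneg (s • v - C *ᵥ v)
  have h2 := hCs.quadForm_nonneg (C *ᵥ v)
  have e1 : v ⬝ᵥ C *ᵥ (C *ᵥ v) = (C *ᵥ v) ⬝ᵥ (C *ᵥ v) := by
    rw [dotProduct_mulVec, ← mulVec_transpose, hC.transpose_eq]
  simp only [mulVec_sub, mulVec_smul, dotProduct_sub, sub_dotProduct, dotProduct_smul,
    smul_dotProduct, smul_eq_mul, sub_mulVec, smul_mulVec, one_mulVec, ← mulVec_mulVec, e1]
    at h1 h2 ⊢
  have h3 : 0 ≤ s * (s * (v ⬝ᵥ C *ᵥ v) - C *ᵥ v ⬝ᵥ C *ᵥ v) := by nlinarith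
  exact nonneg_of_mul_nonneg_right h3 hs

/-- Blockwise right multiplication by inverses of matrices between `c` and `s`. -/
lemma precondition_bounds {C : Fin N → Matrix (Fin m) (Fin m) ℝ} {c s : ℝ} (hc : 0 < c)
    (hs : 0 < s) (hCc : ∀ t, (C t - c • (1 : Matrix (Fin m) (Fin m) ℝ)).PosSemidef)
    (hCs : ∀ t, (s • (1 : Matrix (Fin m) (Fin m) ℝ) - C t).PosSemidef)
    (hu : ∀ t, IsUnit (C t)) (g : Gain n m N) :
    c * ‖Gain.ofBlocks fun t => g.block t * (C t)⁻¹‖ ^ 2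
        ≤ inner ℝ g (Gain.ofBlocks fun t => g.block t * (C t)⁻¹) ∧
      ‖g‖ ^ 2 ≤ s * inner ℝ g (Gain.ofBlocks fun t => g.block t * (C t)⁻¹) := by
  set V : Fin N → Matrix (Fin n) (Fin m) ℝ := fun t => g.block t * (C t)⁻¹ with hV
  have hgV : ∀ t, g.block t = V t * C t := fun t => by
    rw [hV, Matrix.nonsing_inv_mul_cancel_right _ _ ((Matrix.isUnit_iff_isUnit_det _).1 (hu t))]
  have hC0 : ∀ t, (C t).PosSemidef := fun t => by
    have := (hCc t).add ((PosSemidef.one (n := Fin m) (R := ℝ)).smul hc.le)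
    rwa [sub_add_cancel] at this
  rw [Gain.inner_eq_sum_trace, Gain.norm_sq_eq, Gain.norm_sq_eq]
  simp only [Gain.block_ofBlocks, Finset.mul_sum, hgV]
  constructor
  · refine Finset.sum_le_sum fun t _ => ?_
    have := ((hCc t).mul_mul_transpose_same (V t)).trace_nonneg
    simp only [Matrix.mul_sub, Matrix.sub_mul, trace_sub, Matrix.mul_smul, Matrix.smul_mul,
      trace_smul, smul_eq_mul, Matrix.mul_one] at this
    rw [Matrix.trace_mul_comm (V t)ᵀ]
    linarith
  · refine Finset.sum_le_sum fun t _ => ?_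
    have := ((posSemidef_smul_sub_mul_self hs (hC0 t) (hCs t)).mul_mul_transpose_same
      (V t)).trace_nonneg
    simp only [Matrix.mul_sub, Matrix.sub_mul, trace_sub, Matrix.mul_smul, Matrix.smul_mul,
      trace_smul, smul_eq_mul] at this
    rw [Matrix.trace_mul_comm, transpose_mul, (hC0 t).transpose_eq]
    simp only [Matrix.mul_assoc] at this ⊢
    linarith

end Preconditioner

namespace LQGame

variable {m n d N : ℕ} {S : LQGame m n d N} {K : Gain d m N}

lemma covEst_transpose {M : ℕ} (L : Gain n m N) (z : Fin M → Draw m n N) (t : Fin (N + 1)) :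
    (S.covEst K L z t)ᵀ = S.covEst K L z t := by
  ext i j
  rw [transpose_apply, covEst_apply, covEst_apply]
  simp only [mul_comm]

lemma covEst_sub_posSemidef {M : ℕ} {L : Gain n m N} {z : Fin M → Draw m n N}
    {r σ₁ σ₂ s : ℝ} (hσ₂ : m * σ₂ ≤ S.phi / 2) (h : S.Accurate K r σ₁ σ₂ s L z)
    (t : Fin (N + 1)) :
    (S.covEst K L z t - (S.phi / 2) • (1 : Matrix (Fin m) (Fin m) ℝ)).PosSemidef := by
  refine posSemidef_of_quadForm_nonneg (by simp [covEst_transpose]) fun v => ?_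
  have h1 := (S.stateCov_sub_phi_posSemidef K L t).quadForm_nonneg v
  have h2 := abs_quadForm_le_of_entries (E := S.covEst K L z t - S.stateCov K L t)
    (fun i j => (h.2.1 t i j).le) v
  have h3 := (abs_le.1 h2).1
  have hv : 0 ≤ v ⬝ᵥ v := by simpa using dotProduct_star_self_nonneg v
  simp only [sub_mulVec, smul_mulVec, one_mulVec, dotProduct_sub, dotProduct_smul,
    smul_eq_mul, Fintype.card_fin] at h1 h3 ⊢
  nlinarith [mul_le_mul_of_nonneg_right hσ₂ hv]

lemma smul_one_sub_covEst_posSemidef {M : ℕ} (hM : 0 < M) {L : Gain n m N}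
    {z : Fin M → Draw m n N} {r σ₁ σ₂ s : ℝ} (h : S.Accurate K r σ₁ σ₂ s L z) (t : Fin (N + 1)) :
    (s • (1 : Matrix (Fin m) (Fin m) ℝ) - S.covEst K L z t).PosSemidef := by
  have hM' : (0 : ℝ) < M := Nat.cast_pos.2 hM
  refine posSemidef_of_quadForm_nonneg (by simp [covEst_transpose]) fun v => ?_
  have h1 : v ⬝ᵥ S.covEst K L z t *ᵥ v
      = 1 / M * ∑ k, (v ⬝ᵥ S.traj K L (z k).2.2 t) ^ 2 := by
    simp only [covEst, smul_mulVec, dotProduct_smul, smul_eq_mul, Matrix.sum_mulVec,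
      dotProduct_sum]
    congr 1
    refine Finset.sum_congr rfl fun k _ => ?_
    rw [vecMulVec_mulVec]
    simp [dotProduct_comm, sq]
  have h2 : ∀ k, (v ⬝ᵥ S.traj K L (z k).2.2 t) ^ 2 ≤ s * (v ⬝ᵥ v) := by
    intro k
    have h3 := h.2.2 k t
    rw [EuclideanSpace.norm_sq_eq] at h3
    have h4 := Finset.sum_mul_sq_le_sq_mul_sq Finset.univ v (S.traj K L (z k).2.2 t)
    have hv : v ⬝ᵥ v = ∑ i, v i ^ 2 := by simp [dotProduct, sq]
    rw [hv]
    simp only [Real.norm_eq_abs, sq_abs] at h3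
    calc _ ≤ (∑ i, v i ^ 2) * ∑ i, S.traj K L (z k).2.2 t i ^ 2 := h4
      _ ≤ (∑ i, v i ^ 2) * s := mul_le_mul_of_nonneg_left h3 (by positivity)
      _ = _ := mul_comm _ _
  have h5 : 1 / M * ∑ k, (v ⬝ᵥ S.traj K L (z k).2.2 t) ^ 2 ≤ s * (v ⬝ᵥ v) := by
    calc _ ≤ 1 / (M : ℝ) * ∑ k : Fin M, s * (v ⬝ᵥ v) :=
          mul_le_mul_of_nonneg_left (Finset.sum_le_sum fun k _ => h2 k) (by positivity)
      _ = s * (v ⬝ᵥ v) := by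
          simp only [Finset.sum_const, Finset.card_univ, Fintype.card_fin, nsmul_eq_mul]
          field_simp
  simp only [sub_mulVec, smul_mulVec, one_mulVec, dotProduct_sub, dotProduct_smul, smul_eq_mul, h1]
  linarith

lemma isUnit_covEst (hm : 0 < m) {M : ℕ} {L : Gain n m N} {z : Fin M → Draw m n N}
    {r σ₁ σ₂ s : ℝ} (hσ₂ : m * σ₂ ≤ S.phi / 2) (h : S.Accurate K r σ₁ σ₂ s L z)
    (t : Fin (N + 1)) : IsUnit (S.covEst K L z t) := by
  have h1 := (PosDef.one (n := Fin m) (R := ℝ)).smul (half_pos (S.phi_pos hm))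
  have h2 := PosDef.posSemidef_add (covEst_sub_posSemidef hσ₂ h t) h1
  rw [sub_add_cancel] at h2
  exact h2.isUnit

/-- One step from accurate estimates contracts the optimality gap, up to the estimation error. -/
lemma gap_npgStep_le (hm : 0 < m) {M : ℕ} (hM : 0 < M)
    {L : Gain n m N} {z : Fin M → Draw m n N} {r σ₁ σ₂ s e η ψ l R μ : ℝ} (hs : 0 < s)
    (hη : 0 ≤ η) (hσ₂ : m * σ₂ ≤ S.phi / 2) (h : S.Accurate K r σ₁ σ₂ s L z)
    (he : ((n * m * N : ℕ) : ℝ) * σ₁ ≤ e) (hLR : ‖L‖ ≤ R) (hl : ‖gradient (S.G K) L‖ ≤ l)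
    (hψ : ∀ y ∈ Metric.closedBall (0 : Gain n m N) (R + 1),
      |S.G K y - S.G K L - inner ℝ (gradient (S.G K) L) (y - L)| ≤ ψ * ‖y - L‖ ^ 2)
    (hηψ : η * ψ ≤ S.phi / 8) (hηl : η * (l + e) ≤ S.phi / 2)
    (hμ : μ * S.gap K L ≤ ‖gradient (S.G K) L‖ ^ 2) :
    S.gap K (S.npgStep K r η L z)
      ≤ (1 - η * μ / (4 * s)) * S.gap K L + η * ((1 / (2 * s) + 2 / S.phi) * e ^ 2) := by
  have hφ := S.phi_pos hm
  have hc : 0 < S.phi / 2 := half_pos hφ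
  set g := S.gradEst K r L z with hg
  set v : Gain n m N :=
    Gain.ofBlocks fun t => g.block t * (S.covEst K L z t.castSucc)⁻¹ with hv
  have hstep : S.npgStep K r η L z = L + η • v := rfl
  obtain ⟨h₁, h₂⟩ := precondition_bounds hc hs
    (fun t : Fin N => covEst_sub_posSemidef hσ₂ h t.castSucc)
    (fun t => smul_one_sub_covEst_posSemidef hM h t.castSucc)
    (fun t => isUnit_covEst hm hσ₂ h t.castSucc) g
  have hge : ‖g - gradient (S.G K) L‖ ≤ e := by
    refine le_trans ?_ he
    calc ‖g - gradient (S.G K) L‖ ≤ ∑ q, ‖(g - gradient (S.G K) L) q‖ := by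
          rw [EuclideanSpace.norm_eq]
          refine Real.sqrt_le_iff.2 ⟨by positivity, ?_⟩
          exact Finset.sum_sq_le_sq_sum_of_nonneg fun q _ => norm_nonneg _
      _ ≤ ∑ q : Fin N × Fin n × Fin m, σ₁ :=
          Finset.sum_le_sum fun q _ => (h.1 q).le
      _ = _ := by
          simp only [Finset.sum_const, Finset.card_univ, Fintype.card_prod, Fintype.card_fin,
            nsmul_eq_mul]
          push_cast; ring
  have hvn : S.phi / 2 * ‖v‖ ≤ l + e := by
    have h3 : ‖g‖ ≤ l + e := by
      have := norm_add_le (g - gradient (S.G K) L) (gradient (S.G K) L)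
      rw [sub_add_cancel] at this
      linarith
    rcases (norm_nonneg v).eq_or_lt with h0 | h0
    · rw [← h0, mul_zero]; exact (norm_nonneg g).trans h3
    · have h4 : S.phi / 2 * ‖v‖ * ‖v‖ ≤ ‖g‖ * ‖v‖ := by
        rw [mul_assoc, ← sq]; exact h₁.trans (real_inner_le_norm g v)
      exact (le_of_mul_le_mul_right h4 h0).trans h3
  have hηv : ‖η • v‖ ≤ 1 := by
    rw [norm_smul, Real.norm_of_nonneg hη]
    have h3 := mul_le_mul_of_nonneg_left hvn hη
    have h4 : S.phi / 2 * (η * ‖v‖) ≤ S.phi / 2 * 1 := by linarith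
    exact le_of_mul_le_mul_left h4 hc
  have hmem : L + η • v ∈ Metric.closedBall (0 : Gain n m N) (R + 1) := by
    rw [mem_closedBall_zero_iff]
    exact (norm_add_le _ _).trans (add_le_add hLR hηv)
  have h3 := hψ _ hmem
  rw [add_sub_cancel_left] at h3
  have h4 := ascent_step hc hs hη hge h₁ h₂ (by linarith) h3
  have h5 : η * (μ * S.gap K L / (4 * s)) ≤ η * (‖gradient (S.G K) L‖ ^ 2 / (4 * s)) := by gcongr
  have h6 : S.gap K (L + η • v) = S.gap K L - (S.G K (L + η • v) - S.G K L) := by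
    unfold gap; ring
  have h7 : (1 : ℝ) / (S.phi / 2) = 2 / S.phi := by field_simp
  rw [h7] at h4
  rw [hstep, h6]
  have h8 : (1 - η * μ / (4 * s)) * S.gap K L = S.gap K L - η * (μ * S.gap K L / (4 * s)) := by ring
  rw [h8]
  nlinarith

end LQGame

/-! ### The covariance polynomial -/

/-- The polynomial `p = (2 + X₀ + X₁X₃ + X₂(1 + X₄) + X₄)^{4N}`. It is the square of a quantity
which bounds the squared state on a unit neighbourhood of the gain, so that `ϰ̄` exceeds the actual
size of the covariances by a factor that grows with the superlevel set. -/
noncomputable def covPoly (N : ℕ) : MvPolynomial (Fin 5) ℝ :=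
  (MvPolynomial.C 2 + MvPolynomial.X 0 + MvPolynomial.X 1 * MvPolynomial.X 3
    + MvPolynomial.X 2 * (1 + MvPolynomial.X 4) + MvPolynomial.X 4) ^ (4 * N)

namespace LQGame

variable {m n d N : ℕ} (S : LQGame m n d N) (K : Gain d m N)

/-- The square root of the covariance polynomial, as a function of `ℓ = ‖L‖`. -/
noncomputable def covRoot (ℓ : ℝ) : ℝ := (1 + S.growth K (1 + ℓ) + ℓ) ^ (2 * N)

lemma cSigma_covPoly (L : Gain n m N) :
    S.cSigma (covPoly N) K L = S.c0 * S.covRoot K ‖L‖ ^ 2 := by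
  rw [cSigma, covPoly, covRoot, ← pow_mul]
  simp only [map_pow, map_add, map_mul, MvPolynomial.eval_C, MvPolynomial.eval_X, map_one, growth]
  congr 1
  have : 2 * N * 2 = 4 * N := by ring
  rw [this]
  congr 1
  simp
  ring

variable {S K}

lemma growth_mono {ℓ ℓ' : ℝ} (h : ℓ ≤ ℓ') : S.growth K ℓ ≤ S.growth K ℓ' := by
  have := mul_le_mul_of_nonneg_left h (frobNorm_nonneg S.D)
  rw [growth, growth]; linarith

lemma covRoot_mono {ℓ ℓ' : ℝ} (h0 : 0 ≤ ℓ) (h : ℓ ≤ ℓ') : S.covRoot K ℓ ≤ S.covRoot K ℓ' := by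
  have h1 := S.one_le_growth K (ℓ := 1 + ℓ) (by linarith)
  have h2 : S.growth K (1 + ℓ) ≤ S.growth K (1 + ℓ') := growth_mono (by linarith)
  unfold covRoot
  gcongr

lemma growth_pow_le_covRoot {ℓ ℓ' : ℝ} (h0 : 0 ≤ ℓ) (h0' : 0 ≤ ℓ') (h : ℓ' ≤ 1 + ℓ) :
    S.growth K ℓ' ^ (2 * N) ≤ S.covRoot K ℓ := by
  have h1 := S.one_le_growth K h0'
  have h2 : S.growth K ℓ' ≤ S.growth K (1 + ℓ) := growth_mono h
  unfold covRoot
  gcongr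
  linarith

lemma one_le_covRoot {ℓ : ℝ} (h0 : 0 ≤ ℓ) : 1 ≤ S.covRoot K ℓ := by
  have h1 := S.one_le_growth K (ℓ := 1 + ℓ) (by linarith)
  exact one_le_pow₀ (by linarith)

lemma one_add_sq_le_covRoot (hN : 0 < N) {ℓ : ℝ} (h0 : 0 ≤ ℓ) : 1 + ℓ ^ 2 ≤ S.covRoot K ℓ := by
  have h1 := S.one_le_growth K (ℓ := 1 + ℓ) (by linarith)
  have h2 : (1 + ℓ) ^ 2 ≤ (1 + ℓ) ^ (2 * N) := pow_le_pow_right₀ (by linarith) (by omega)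
  have h3 : (1 + ℓ) ^ (2 * N) ≤ S.covRoot K ℓ := by
    unfold covRoot
    gcongr
    linarith
  nlinarith

lemma theta_nonneg : 0 ≤ S.ϑ := by
  obtain ⟨ξ, hξ⟩ := S.boundedPaths_nonempty
  exact (norm_nonneg _).trans (hξ 0)

lemma theta_pos (hm : 0 < m) : 0 < S.ϑ := by
  refine lt_of_le_of_ne theta_nonneg fun h => ?_
  have h1 : 0 < S.noiseCov ⟨0, hm⟩ ⟨0, hm⟩ := S.noise_cov.diag_pos
  have h2 : S.noiseCov ⟨0, hm⟩ ⟨0, hm⟩ = 0 := by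
    change ∫ x, x ⟨0, hm⟩ * x ⟨0, hm⟩ ∂S.noise = 0
    refine integral_eq_zero_of_ae ?_
    filter_upwards [S.noise_bounded] with x hx
    rw [← h] at hx
    have := (PiLp.norm_apply_le (WithLp.toLp 2 x) ⟨0, hm⟩).trans hx
    have h3 : x ⟨0, hm⟩ = 0 := by simpa using this
    simp [h3]
  linarith

lemma isCovBound_covPoly : S.IsCovBound (n := n) (covPoly N) K := by
  intro L
  filter_upwards [S.ae_mem_boundedPaths] with ξ hξ
  have hy := one_le_covRoot (S := S) (K := K) (norm_nonneg L)
  have h1 : ∀ t, ‖WithLp.toLp 2 (S.traj K L ξ t)‖ ^ 2 ≤ S.ϑ ^ 2 * S.covRoot K ‖L‖ := fun t =>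
    (S.norm_traj_sq_le K L hξ t).trans (mul_le_mul_of_nonneg_left
      (growth_pow_le_covRoot (norm_nonneg _) (norm_nonneg _) (by linarith)) (sq_nonneg _))
  have h2 : ∀ t, ∑ i, ∑ j, vecMulVec (S.traj K L ξ t) (S.traj K L ξ t) i j ^ 2
      = (‖WithLp.toLp 2 (S.traj K L ξ t)‖ ^ 2) ^ 2 := by
    intro t
    rw [EuclideanSpace.norm_sq_eq, sq (∑ i, _), Finset.sum_mul_sum]
    simp [vecMulVec_apply, mul_pow]
  have h3 : 0 ≤ S.ϑ ^ 2 * S.covRoot K ‖L‖ := by positivity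
  rw [cSigma_covPoly, frobNorm]
  refine Real.sqrt_le_iff.2 ⟨by unfold c0; positivity, ?_⟩
  simp only [h2]
  calc ∑ t, (‖WithLp.toLp 2 (S.traj K L ξ t)‖ ^ 2) ^ 2
      ≤ ∑ t : Fin (N + 1), (S.ϑ ^ 2 * S.covRoot K ‖L‖) ^ 2 :=
        Finset.sum_le_sum fun t _ => pow_le_pow_left₀ (sq_nonneg _) (h1 t) 2
    _ = (N + 1) * (S.ϑ ^ 2) ^ 2 * S.covRoot K ‖L‖ ^ 2 := by
        simp only [Finset.sum_const, Finset.card_univ, Fintype.card_fin, nsmul_eq_mul]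
        push_cast; ring
    _ ≤ (S.c0 * S.covRoot K ‖L‖ ^ 2) ^ 2 := by
        unfold c0
        have h4 : S.covRoot K ‖L‖ ^ 2 ≤ (S.covRoot K ‖L‖ ^ 2) ^ 2 := by
          have : 1 ≤ S.covRoot K ‖L‖ ^ 2 := one_le_pow₀ hy
          nlinarith
        have h5 : (N + 1 : ℝ) ≤ (N + 1) ^ 2 := by nlinarith [Nat.cast_nonneg (α := ℝ) N]
        calc _ ≤ (N + 1 : ℝ) ^ 2 * (S.ϑ ^ 2) ^ 2 * (S.covRoot K ‖L‖ ^ 2) ^ 2 := by gcongr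
          _ = _ := by ring

/-- The covariance of the state is at most `m` times the bound of the squared state. -/
lemma smul_one_sub_stateCov_posSemidef {L : Gain n m N} {ℓ : ℝ} (hℓ : 0 ≤ ℓ)
    (hL : ‖L‖ ≤ 1 + ℓ) (t : Fin (N + 1)) :
    ((m * (S.ϑ ^ 2 * S.covRoot K ℓ)) • (1 : Matrix (Fin m) (Fin m) ℝ)
      - S.stateCov K L t).PosSemidef := by
  have h := posSemidef_smul_one_sub_of_entries (E := S.stateCov K L t)
    (s := S.ϑ ^ 2 * S.covRoot K ℓ) (S.stateCov_posSemidef K L t).transpose_eq ?_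
  · simpa using h
  · intro i j
    rw [← S.integral_traj_mul_traj, ← Real.norm_eq_abs]
    have h1 : ∀ᵐ ξ ∂S.pathLaw, ‖S.traj K L ξ t i * S.traj K L ξ t j‖
        ≤ S.ϑ ^ 2 * S.covRoot K ℓ := by
      filter_upwards [S.ae_mem_boundedPaths] with ξ hξ
      exact abs_traj_mul_traj_le ((S.norm_traj_sq_le K L hξ t).trans
        (mul_le_mul_of_nonneg_left (growth_pow_le_covRoot hℓ (norm_nonneg _) hL)
          (sq_nonneg _))) i j
    simpa using norm_integral_le_of_norm_le_const h1

/-- The optimality gap grows at most like the covariance polynomial. -/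
lemma exists_gap_le (hN : 0 < N) (hK : S.Feasible K) :
    ∃ C : ℝ, 0 ≤ C ∧ ∀ L : Gain n m N, S.gap K L ≤ C * S.covRoot K ‖L‖ ^ 2 := by
  set h : ℝ := n * ∑ t, ∑ i, ∑ j, |S.Hblock K (S.innerSol K) t i j| with hh
  have hH : ∀ t, (h • (1 : Matrix (Fin n) (Fin n) ℝ)
      - S.Hblock K (S.innerSol K) t).PosSemidef := by
    intro t
    have := posSemidef_smul_one_sub_of_entries (E := S.Hblock K (S.innerSol K) t)
      (s := ∑ t, ∑ i, ∑ j, |S.Hblock K (S.innerSol K) t i j|)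
      (Hblock_innerSol_posDef hK t).posSemidef.transpose_eq fun i j => ?_
    · simpa using this
    · calc |S.Hblock K (S.innerSol K) t i j| ≤ ∑ j, |S.Hblock K (S.innerSol K) t i j| :=
            Finset.single_le_sum (f := fun j => |S.Hblock K (S.innerSol K) t i j|)
              (fun _ _ => abs_nonneg _) (Finset.mem_univ j)
        _ ≤ ∑ i, ∑ j, |S.Hblock K (S.innerSol K) t i j| :=
            Finset.single_le_sum (f := fun i => ∑ j, |S.Hblock K (S.innerSol K) t i j|)
              (fun _ _ => by positivity) (Finset.mem_univ i)
        _ ≤ _ := Finset.single_le_sum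
              (f := fun t => ∑ i, ∑ j, |S.Hblock K (S.innerSol K) t i j|)
              (fun _ _ => by positivity) (Finset.mem_univ t)
  have hh0 : 0 ≤ h := by positivity
  refine ⟨h * (m * S.ϑ ^ 2) * (2 * (1 + ‖S.innerSol K‖ ^ 2)), by positivity, fun L => ?_⟩
  have hy := one_le_covRoot (S := S) (K := K) (norm_nonneg L)
  set y := S.covRoot K ‖L‖
  have h1 : S.gap K L ≤ h * (m * (S.ϑ ^ 2 * y)) * ‖L - S.innerSol K‖ ^ 2 := by
    rw [gap_eq hK, Gain.norm_sq_eq, Finset.mul_sum]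
    refine Finset.sum_le_sum fun t _ => ?_
    set Δ := (L - S.innerSol K).block t
    have h2 : (h • (Δᵀ * Δ) - Δᵀ * S.Hblock K (S.innerSol K) t * Δ).PosSemidef := by
      have := (hH t).transpose_mul_mul_same Δ
      simpa [Matrix.mul_sub, Matrix.sub_mul] using this
    have h3 := trace_mul_le_of_sub_posSemidef h2 (S.stateCov_posSemidef K L t.castSucc)
    have h4 := trace_mul_le_mul_trace (posSemidef_transpose_mul_self Δ)
      (smul_one_sub_stateCov_posSemidef (S := S) (K := K) (L := L) (norm_nonneg L)
        (by linarith) t.castSucc)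
    rw [Matrix.smul_mul, trace_smul, smul_eq_mul] at h3
    calc _ ≤ h * (Δᵀ * Δ * S.stateCov K L t.castSucc).trace := h3
      _ ≤ h * (m * (S.ϑ ^ 2 * y) * (Δᵀ * Δ).trace) := mul_le_mul_of_nonneg_left h4 hh0
      _ = _ := by ring
  have h5 : ‖L - S.innerSol K‖ ^ 2 ≤ 2 * (1 + ‖S.innerSol K‖ ^ 2) * y := by
    have h6 := norm_sub_le L (S.innerSol K)
    have h7 := one_add_sq_le_covRoot (S := S) (K := K) hN (norm_nonneg L)
    calc ‖L - S.innerSol K‖ ^ 2 ≤ (‖L‖ + ‖S.innerSol K‖) ^ 2 := by gcongr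
      _ ≤ 2 * (1 + ‖S.innerSol K‖ ^ 2) * (1 + ‖L‖ ^ 2) := by
          nlinarith [sq_nonneg (‖L‖ - ‖S.innerSol K‖), sq_nonneg (‖L‖ * ‖S.innerSol K‖)]
      _ ≤ _ := mul_le_mul_of_nonneg_left h7 (by positivity)
  calc _ ≤ h * (m * (S.ϑ ^ 2 * y)) * (2 * (1 + ‖S.innerSol K‖ ^ 2) * y) :=
        h1.trans (mul_le_mul_of_nonneg_left h5 (by positivity))
    _ = _ := by ring

/-! ### Superlevel sets -/

lemma isClosed_superlevel (a : ℝ) : IsClosed (S.superlevel (n := n) K a) :=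
  isClosed_le continuous_const continuous_G

/-- Superlevel sets are compact, by the quadratic growth of the gap. -/
lemma isCompact_superlevel (hm : 0 < m) (hn : 0 < n) (hN : 0 < N) (hK : S.Feasible K) (a : ℝ) :
    IsCompact (S.superlevel (n := n) K a) := by
  have hφl : 0 < S.phi * S.lamH K := mul_pos (S.phi_pos hm) (lamH_pos hn hN hK)
  refine Metric.isCompact_of_isClosed_isBounded (isClosed_superlevel a) ?_
  refine (Metric.isBounded_closedBall (x := S.innerSol K)
    (r := Real.sqrt ((S.G K (S.innerSol K) - a) / (S.phi * S.lamH K)))).subset fun L hL => ?_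
  have h1 := mul_norm_sq_le_gap hK hn hN L
  have hL' : a ≤ S.G K L := hL
  rw [Metric.mem_closedBall, dist_eq_norm]
  refine Real.le_sqrt_of_sq_le ?_
  rw [le_div_iff₀ hφl]
  unfold gap at h1
  linarith

/-- A slightly larger superlevel set stays in a slightly larger ball. -/
lemma exists_superlevel_norm_le (hm : 0 < m) (hn : 0 < n) (hN : 0 < N) (hK : S.Feasible K)
    {a R : ℝ} (hR : ∀ L ∈ S.superlevel (n := n) K a, ‖L‖ ≤ R) :
    ∃ ν : ℝ, 0 < ν ∧ ∀ L ∈ S.superlevel (n := n) K (a - ν), ‖L‖ ≤ R + 1 := by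
  set F : Set (Gain n m N) := S.superlevel K (a - 1) ∩ {L | R + 1 ≤ ‖L‖}
  have hF : IsCompact F := (isCompact_superlevel hm hn hN hK (a - 1)).inter_right
    (isClosed_le continuous_const continuous_norm)
  rcases F.eq_empty_or_nonempty with hemp | hne
  · refine ⟨1, one_pos, fun L hL => ?_⟩
    by_contra! h
    have : L ∈ F := ⟨hL, h.le⟩
    rw [hemp] at this
    exact this
  · obtain ⟨L₁, hL₁, hmax⟩ := hF.exists_isMaxOn hne (continuous_G (S := S) (K := K)).continuousOn
    have hlt : S.G K L₁ < a := by
      by_contra! h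
      have h2 : R + 1 ≤ ‖L₁‖ := hL₁.2
      have := hR L₁ h
      linarith
    refine ⟨min 1 ((a - S.G K L₁) / 2), lt_min one_pos (by linarith), fun L hL => ?_⟩
    have hL' : a - min 1 ((a - S.G K L₁) / 2) ≤ S.G K L := hL
    have h1 := min_le_left 1 ((a - S.G K L₁) / 2)
    have h2 := min_le_right 1 ((a - S.G K L₁) / 2)
    by_contra! h
    have h3 : L ∈ F := ⟨show a - 1 ≤ S.G K L by linarith, h.le⟩
    have h4 : S.G K L ≤ S.G K L₁ := hmax h3
    linarith

lemma G_innerSol_nonneg (hK : S.Feasible K) : 0 ≤ S.G K (S.innerSol (n := n) K) := by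
  rw [G_eq_sum_trace_P]
  refine Finset.sum_nonneg fun t _ => ?_
  rw [P_innerSol hK]
  exact (hK.1 t).trace_mul_nonneg S.noiseCov_posDef.posSemidef

end LQGame

/-! ### Number of trajectories -/

lemma half_le_log_two_div {ε : ℝ} (h0 : 0 < ε) (h1 : ε < 1) : 1 / 2 ≤ Real.log (2 / ε) := by
  have h2 : Real.log 2 ≤ Real.log (2 / ε) :=
    Real.log_le_log two_pos (by rw [le_div_iff₀ h0]; linarith)
  linarith [Real.log_two_gt_d9]

lemma le_iterCount (κ η μ ε : ℝ) :
    8 * κ / (η * μ) * Real.log (2 / ε) ≤ iterCount κ η μ ε := Nat.le_ceil _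

lemma iterCount_pos {κ η μ ε : ℝ} (hκ : 0 < κ) (hη : 0 < η) (hμ : 0 < μ) (h0 : 0 < ε)
    (h1 : ε < 1) : 0 < iterCount κ η μ ε := by
  have := half_le_log_two_div h0 h1
  exact Nat.ceil_pos.2 (mul_pos (by positivity) (by linarith))

lemma iterCount_le {κ η μ ε : ℝ} (hκ : 0 < κ) (hη : 0 < η) (hμ : 0 < μ) (h0 : 0 < ε)
    (h1 : ε < 1) : (iterCount κ η μ ε : ℝ) ≤ (8 * κ / (η * μ) + 2) * Real.log (2 / ε) := by
  have h2 := half_le_log_two_div h0 h1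
  have h3 := (Nat.ceil_lt_add_one
    (show 0 ≤ 8 * κ / (η * μ) * Real.log (2 / ε) from mul_nonneg (by positivity) (by linarith))).le
  rw [iterCount, add_mul]
  linarith

/-- With the largest admissible radius up to constants, `r = c √ε`, the batchsize is of order
`(r² ε)⁻¹ = ε⁻²` up to logarithms. -/
lemma exists_sample_complexity {φ μ l ψ ρ κ η : ℝ} (hφ : 0 < φ) (hμ : 0 < μ) (hl : 0 < l)
    (hψ : 0 < ψ) (hρ : 0 < ρ) (hκ : 0 < κ) (hη : 0 < η) (Gopt : ℝ) {d₁ d₂ : ℕ}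
    (hd₁ : 0 < d₁) :
    ∃ C : ℝ, ∀ ε δ : ℝ, 0 < ε → ε < 1 → 0 < δ → δ < 1 → ∃ (r : ℝ) (M : ℕ), 0 < r ∧
      r ≤ radiusBound φ μ l ψ ρ κ ε ∧ 0 < M ∧
      batchBound d₁ d₂ (iterCount κ η μ ε) Gopt φ μ l ρ κ r ε δ ≤ M ∧
      (2 * M * iterCount κ η μ ε : ℝ)
        ≤ C * ε⁻¹ ^ 2 * Real.log (2 / ε) ^ 2 * Real.log (2 / δ) := by
  have hθ : 0 < thetaConst l ψ ρ := lt_min (by positivity) (by positivity)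
  set c := min (φ * Real.sqrt μ / (16 * κ * ψ))
    (min (φ * μ * thetaConst l ψ ρ * Real.sqrt (1 / 2) / (32 * κ * ψ)) ρ) with hc
  have hc0 : 0 < c := by
    have h1 : 0 < Real.sqrt μ := Real.sqrt_pos.2 hμ
    have h2 : 0 < Real.sqrt (1 / 2) := Real.sqrt_pos.2 (by norm_num)
    exact lt_min (by positivity) (lt_min (by positivity) hρ)
  set X := max ((Gopt + l / ρ) ^ 2 * (64 * (d₁ : ℝ) ^ 2 * (κ + 1) ^ 2 / (φ ^ 2 * c ^ 2 * μ)))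
    (2 * κ ^ 2 / φ ^ 2) with hX
  have hX0 : 0 ≤ X := le_max_of_le_right (by positivity)
  set Z := 8 * κ / (η * μ) + 2 with hZ
  have hZ0 : 0 < Z := by positivity
  set D : ℝ := ((max d₁ d₂ : ℕ) : ℝ) with hD
  have hD0 : 0 < D := Nat.cast_pos.2 (lt_max_of_lt_left hd₁)
  set W := 16 * Z * D + 4 with hW
  refine ⟨2 * (X * W + 8) * Z, fun ε δ hε hε1 hδ hδ1 => ?_⟩
  set a := Real.log (2 / ε)
  set b := Real.log (2 / δ)
  have ha : 1 / 2 ≤ a := half_le_log_two_div hε hε1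
  have hb : 1 / 2 ≤ b := half_le_log_two_div hδ hδ1
  have hab : 1 / 4 ≤ a * b := by
    have := mul_le_mul ha hb (by norm_num) (by linarith)
    linarith
  set T := iterCount κ η μ ε
  have hT : (T : ℝ) ≤ Z * a := iterCount_le hκ hη hμ hε hε1
  have hT0 : (0 : ℝ) < T := Nat.cast_pos.2 (iterCount_pos hκ hη hμ hε hε1)
  have hsε : 0 < Real.sqrt ε := Real.sqrt_pos.2 hε
  have hsε1 : Real.sqrt ε ≤ 1 := Real.sqrt_le_one.2 hε1.le
  have hε2 : 1 ≤ ε⁻¹ ^ 2 := one_le_pow₀ ((one_le_inv₀ hε).2 hε1.le)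
  set r := c * Real.sqrt ε
  have hr2 : r ^ 2 = c ^ 2 * ε := by rw [mul_pow, Real.sq_sqrt hε.le]
  have hlog : Real.log (4 * T * D / δ) ≤ W * a * b := by
    have h1 : Real.log (4 * T * D / δ) ≤ Real.log (4 * Z * D * a * (2 / δ)) := by
      refine Real.log_le_log (by positivity) ?_
      rw [mul_div_assoc', div_le_div_iff_of_pos_right hδ]
      have h2 : 4 * (T : ℝ) * D ≤ 4 * (Z * a) * D := by gcongr
      have h3 : 0 < Z * a * D := by positivity
      linarith
    have h2 : Real.log (4 * Z * D * a * (2 / δ)) = Real.log (4 * Z * D) + Real.log a + b := by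
      rw [Real.log_mul (by positivity) (by positivity), Real.log_mul (by positivity) (by positivity)]
    have h3 := Real.log_le_self (show 0 ≤ 4 * Z * D by positivity)
    have h4 := Real.log_le_self (show 0 ≤ a by linarith)
    have h5 : (1 : ℝ) ≤ 4 * (a * b) := by linarith
    have h6 : 4 * Z * D ≤ 4 * Z * D * (4 * (a * b)) :=
      le_mul_of_one_le_right (by positivity) h5
    have h7 := mul_le_mul_of_nonneg_left hb (show 0 ≤ a by linarith)
    have h8 := mul_le_mul_of_nonneg_right ha (show 0 ≤ b by linarith)
    have h9 : W * a * b = 4 * Z * D * (4 * (a * b)) + 2 * (a * b) + 2 * (a * b) := by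
      rw [hW]; ring
    linarith
  have hlog0 : 0 ≤ W * a * b := by positivity
  have hXr : max ((Gopt + l / ρ) ^ 2 * (64 * (d₁ : ℝ) ^ 2 * (κ + 1) ^ 2 / (φ ^ 2 * r ^ 2 * μ * ε)))
      (2 * κ ^ 2 / φ ^ 2) ≤ X * ε⁻¹ ^ 2 := by
    refine max_le ?_ ?_
    · have h1 : (Gopt + l / ρ) ^ 2 * (64 * (d₁ : ℝ) ^ 2 * (κ + 1) ^ 2 / (φ ^ 2 * r ^ 2 * μ * ε))
          = (Gopt + l / ρ) ^ 2 * (64 * (d₁ : ℝ) ^ 2 * (κ + 1) ^ 2 / (φ ^ 2 * c ^ 2 * μ))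
            * ε⁻¹ ^ 2 := by
        rw [hr2]; field_simp
      rw [h1]
      exact mul_le_mul_of_nonneg_right (le_max_left _ _) (by positivity)
    · exact (le_max_right _ _).trans (le_mul_of_one_le_right hX0 hε2)
  have hbatch : batchBound d₁ d₂ T Gopt φ μ l ρ κ r ε δ ≤ X * W * (ε⁻¹ ^ 2 * (a * b)) := by
    unfold batchBound
    have h0 : 0 ≤ max ((Gopt + l / ρ) ^ 2
        * (64 * (d₁ : ℝ) ^ 2 * (κ + 1) ^ 2 / (φ ^ 2 * r ^ 2 * μ * ε))) (2 * κ ^ 2 / φ ^ 2) :=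
      le_max_of_le_right (by positivity)
    calc _ ≤ max ((Gopt + l / ρ) ^ 2
        * (64 * (d₁ : ℝ) ^ 2 * (κ + 1) ^ 2 / (φ ^ 2 * r ^ 2 * μ * ε))) (2 * κ ^ 2 / φ ^ 2)
          * (W * a * b) := mul_le_mul_of_nonneg_left hlog h0
      _ ≤ X * ε⁻¹ ^ 2 * (W * a * b) := mul_le_mul_of_nonneg_right hXr hlog0
      _ = _ := by ring
  have hB0 : 0 ≤ X * W * (ε⁻¹ ^ 2 * (a * b)) := by positivity
  refine ⟨r, ⌈X * W * (ε⁻¹ ^ 2 * (a * b))⌉₊ + 1, by positivity, ?_, Nat.succ_pos _, ?_, ?_⟩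
  · refine le_min ?_ (le_min ?_ ?_)
    · calc c * Real.sqrt ε ≤ φ * Real.sqrt μ / (16 * κ * ψ) * Real.sqrt ε := by
            gcongr; exact min_le_left _ _
        _ = _ := by rw [Real.sqrt_mul hμ.le]; ring
    · calc c * Real.sqrt ε
          ≤ φ * μ * thetaConst l ψ ρ * Real.sqrt (1 / 2) / (32 * κ * ψ) * Real.sqrt ε := by
            gcongr; exact (min_le_right _ _).trans (min_le_left _ _)
        _ = _ := by
            rw [show ε / 2 = 1 / 2 * ε by ring, Real.sqrt_mul (by norm_num)]; ring
    · calc c * Real.sqrt ε ≤ ρ * 1 := by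
            gcongr; exact (min_le_right _ _).trans (min_le_right _ _)
        _ = ρ := mul_one _
  · push_cast
    linarith [Nat.le_ceil (X * W * (ε⁻¹ ^ 2 * (a * b)))]
  · have h1 := (Nat.ceil_lt_add_one hB0).le
    have h2 : (1 : ℝ) ≤ 4 * (ε⁻¹ ^ 2 * (a * b)) := by
      have h3 := mul_le_mul hε2 hab (by norm_num) (by linarith)
      linarith
    have h3 : ((⌈X * W * (ε⁻¹ ^ 2 * (a * b))⌉₊ + 1 : ℕ) : ℝ)
        ≤ (X * W + 8) * (ε⁻¹ ^ 2 * (a * b)) := by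
      push_cast
      linarith
    calc _ ≤ 2 * ((X * W + 8) * (ε⁻¹ ^ 2 * (a * b))) * (Z * a) := by gcongr
      _ = _ := by ring

/-! ### Convergence of the method -/

/-- The number of iterations suffices to contract an initial gap of size `C y²`, since the exponent
`2 k y log (2/ε)` grows linearly with `y`. -/
lemma one_sub_pow_mul_le {q k y C Γ ν ε : ℝ} {T : ℕ} (hq1 : q ≤ 1) (hε : 0 < ε) (hε1 : ε < 1)
    (hy : 1 ≤ y) (hC : 0 ≤ C) (hν : 0 < ν) (hk : k = 1 + 8 * C / ν)
    (hqT : 2 * k * y * Real.log (2 / ε) ≤ q * T) (hΓ : Γ ≤ C * y ^ 2) :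
    (1 - q) ^ T * Γ ≤ ν * ε / 2 := by
  have hlam := half_le_log_two_div hε hε1
  set lam := Real.log (2 / ε)
  have hk1 : 1 ≤ k := by rw [hk]; linarith [show 0 ≤ 8 * C / ν by positivity]
  have hky : 1 ≤ k * y := one_le_mul_of_one_le_of_one_le hk1 hy
  have h1 : (1 - q) ^ T ≤ Real.exp (-(q * T)) := by
    calc (1 - q) ^ T ≤ Real.exp (-q) ^ T :=
          pow_le_pow_left₀ (by linarith) (Real.one_sub_le_exp_neg q) T
      _ = _ := by rw [← Real.exp_nat_mul]; ring_nf
  have h2 : Real.exp (-(q * T)) ≤ Real.exp (-lam) * Real.exp (-(k * y / 2)) := by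
    rw [← Real.exp_add]
    refine Real.exp_le_exp.2 ?_
    nlinarith
  have h3 : Real.exp (-lam) = ε / 2 := by
    rw [Real.exp_neg, Real.exp_log (by positivity), inv_div]
  have h4 : Real.exp (-(k * y / 2)) ≤ 8 / (k * y) ^ 2 := by
    have h5 := Real.quadratic_le_exp_of_nonneg (show 0 ≤ k * y / 2 by positivity)
    rw [Real.exp_neg, inv_le_comm₀ (Real.exp_pos _) (by positivity), inv_div]
    nlinarith
  have h6 : 8 * C ≤ ν * k ^ 2 := by
    have h7 : 8 * C = ν * (k - 1) := by rw [hk]; field_simp; ring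
    rw [h7]
    exact mul_le_mul_of_nonneg_left (by nlinarith) hν.le
  have hp : 0 ≤ (1 - q) ^ T := pow_nonneg (by linarith) _
  calc (1 - q) ^ T * Γ ≤ (1 - q) ^ T * (C * y ^ 2) := mul_le_mul_of_nonneg_left hΓ hp
    _ ≤ ε / 2 * (8 / (k * y) ^ 2) * (C * y ^ 2) := by
        refine mul_le_mul_of_nonneg_right ?_ (by positivity)
        rw [← h3]
        exact h1.trans (h2.trans (mul_le_mul_of_nonneg_left h4 (Real.exp_pos _).le))
    _ = ε / 2 * (8 * C / k ^ 2) := by field_simp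
    _ ≤ ε / 2 * ν := by
        refine mul_le_mul_of_nonneg_left ?_ (by positivity)
        rw [div_le_iff₀ (by positivity)]
        exact h6
    _ = _ := by ring

namespace LQGame

variable {m n d N : ℕ} {S : LQGame m n d N} {K : Gain d m N}

/-- If every step from the enlarged superlevel set is accurate, the iterates never leave it and
their optimality gap contracts down to the error level `E`. -/
lemma gap_iterate_le {T M : ℕ} {r η q E a ν : ℝ} {L₀ : Gain n m N} (hq0 : 0 ≤ q) (hq1 : q ≤ 1)
    (hE : 0 ≤ E) (hEν : E ≤ ν) (hL₀ : a ≤ S.G K L₀) (hgap : 0 ≤ S.gap K L₀)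
    {ω : Fin T → Fin M → Draw m n N}
    (hstep : ∀ j : Fin T, S.iterate K r η L₀ ω j.castSucc ∈ S.superlevel K (a - ν) →
      S.gap K (S.iterate K r η L₀ ω j.succ)
        ≤ (1 - q) * S.gap K (S.iterate K r η L₀ ω j.castSucc) + q * E) (t : Fin (T + 1)) :
    S.iterate K r η L₀ ω t ∈ S.superlevel K (a - ν) ∧
      S.gap K (S.iterate K r η L₀ ω t) ≤ (1 - q) ^ (t : ℕ) * S.gap K L₀ + E := by
  have key : ∀ t : Fin (T + 1), S.gap K (S.iterate K r η L₀ ω t)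
      ≤ (1 - q) ^ (t : ℕ) * S.gap K L₀ + E →
      S.iterate K r η L₀ ω t ∈ S.superlevel K (a - ν) := by
    intro t ht
    have h1 : (1 - q) ^ (t : ℕ) ≤ 1 := pow_le_one₀ (by linarith) (by linarith)
    have h2 := mul_le_of_le_one_left hgap h1
    change a - ν ≤ S.G K _
    unfold gap at h2 ht
    linarith
  have main : S.gap K (S.iterate K r η L₀ ω t) ≤ (1 - q) ^ (t : ℕ) * S.gap K L₀ + E := by
    induction t using Fin.induction with
    | zero => simpa using hE
    | succ t ih =>
      have h1 := hstep t (key _ ih)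
      have h2 := mul_le_mul_of_nonneg_left ih (by linarith : 0 ≤ 1 - q)
      rw [Fin.val_succ, pow_succ]
      rw [Fin.val_castSucc] at h2
      nlinarith
  exact ⟨key t main, main⟩

end LQGame

lemma log_union_nonneg {d₁ d₂ T : ℕ} (hd₁ : 0 < d₁) (hT : 0 < T) {δ : ℝ} (hδ : 0 < δ)
    (hδ1 : δ < 1) : 0 ≤ Real.log (4 * (T : ℝ) * ((max d₁ d₂ : ℕ) : ℝ) / δ) := by
  refine Real.log_nonneg ?_
  rw [le_div_iff₀ hδ]
  have h1 : (1 : ℝ) ≤ T := Nat.one_le_cast.2 hT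
  have h2 : (1 : ℝ) ≤ ((max d₁ d₂ : ℕ) : ℝ) := Nat.one_le_cast.2 (lt_max_of_lt_left hd₁)
  have h3 := one_le_mul_of_one_le_of_one_le h1 h2
  linarith

/-- The batchsize dominates any multiple of `(r² ε)⁻¹` times the logarithm, once `l` is large. -/
lemma mul_log_le_of_batchBound_le {d₁ d₂ T M : ℕ} {Gopt φ μ l κ r ε δ Y : ℝ} (hd₁ : 0 < d₁)
    (hT : 0 < T) (hG : 0 ≤ Gopt) (hφ : 0 < φ) (hμ : 0 < μ) (hκ : 0 < κ) (hr : 0 < r)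
    (hε : 0 < ε) (hδ : 0 < δ) (hδ1 : δ < 1) (hl : 1 ≤ l)
    (hY : Y / (64 * (d₁ : ℝ) ^ 2 * (κ + 1) ^ 2 / (φ ^ 2 * μ)) ≤ l)
    (h : batchBound d₁ d₂ T Gopt φ μ l 1 κ r ε δ ≤ M) :
    Y * Real.log (4 * (T : ℝ) * ((max d₁ d₂ : ℕ) : ℝ) / δ) ≤ M * (r ^ 2 * ε) := by
  have hlg0 := log_union_nonneg (d₂ := d₂) hd₁ hT hδ hδ1
  unfold batchBound at h
  set lg := Real.log (4 * (T : ℝ) * ((max d₁ d₂ : ℕ) : ℝ) / δ)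
  have hd : (0 : ℝ) < d₁ := Nat.cast_pos.2 hd₁
  set w := 64 * (d₁ : ℝ) ^ 2 * (κ + 1) ^ 2 / (φ ^ 2 * μ) with hw
  have hw0 : 0 < w := by positivity
  have h1 : Y ≤ (Gopt + l / 1) ^ 2 * w := by
    have h2 : l ≤ (Gopt + l / 1) ^ 2 := by
      rw [div_one]
      nlinarith
    rw [div_le_iff₀ hw0] at hY
    exact hY.trans (mul_le_mul_of_nonneg_right h2 hw0.le)
  have h4 : (Gopt + l / 1) ^ 2 * (64 * (d₁ : ℝ) ^ 2 * (κ + 1) ^ 2 / (φ ^ 2 * r ^ 2 * μ * ε)) * lg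
      ≤ M := le_trans (mul_le_mul_of_nonneg_right (le_max_left _ _) hlg0) h
  have h5 : (Gopt + l / 1) ^ 2 * (64 * (d₁ : ℝ) ^ 2 * (κ + 1) ^ 2 / (φ ^ 2 * r ^ 2 * μ * ε)) * lg
      * (r ^ 2 * ε) = (Gopt + l / 1) ^ 2 * w * lg := by
    rw [hw]; field_simp
  calc Y * lg ≤ (Gopt + l / 1) ^ 2 * w * lg := mul_le_mul_of_nonneg_right h1 hlg0
    _ ≤ _ := by rw [← h5]; exact mul_le_mul_of_nonneg_right h4 (by positivity)

namespace LQGame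

variable {m n d N : ℕ} {S : LQGame m n d N} {K : Gain d m N}

/-- With high probability a run contracts the optimality gap at the rate `η μ₀ / (4 s)`, up to the
error level `E`, provided that the estimates concentrate at the required accuracy `e`. -/
lemma one_sub_le_runLaw_contraction (hm : 0 < m) (hn : 0 < n) (hN : 0 < N) (hK : S.Feasible K)
    {a ν R l₀ ψ₀ gmax s e E μ₀ η r δ : ℝ} (hs : 0 < s)
    (hν : ∀ L ∈ S.superlevel (n := n) K (a - ν), ‖L‖ ≤ R + 1)
    (hsq : ∀ L : Gain n m N, ‖L‖ ≤ R + 1 → ∀ ξ ∈ S.boundedPaths, ∀ t,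
      ‖WithLp.toLp 2 (S.traj K L ξ t)‖ ^ 2 ≤ s)
    (hl₀ : ∀ x ∈ Metric.closedBall (0 : Gain n m N) (R + 2), ‖gradient (S.G K) x‖ ≤ l₀)
    (hψ₀ : ∀ x ∈ Metric.closedBall (0 : Gain n m N) (R + 2),
      ∀ y ∈ Metric.closedBall (0 : Gain n m N) (R + 2),
      |S.G K y - S.G K x - inner ℝ (gradient (S.G K) x) (y - x)| ≤ ψ₀ * ‖y - x‖ ^ 2)
    (hcost : ∀ x ∈ Metric.closedBall (0 : Gain n m N) (R + 2), ∀ ξ ∈ S.boundedPaths,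
      |S.cost K x ξ| ≤ gmax) (hgmax : 0 < gmax) (hμ₀ : 0 < μ₀)
    (hPL : ∀ L : Gain n m N, μ₀ * S.gap K L ≤ ‖gradient (S.G K) L‖ ^ 2) (he : 0 < e)
    (hE0 : 0 ≤ E) (hEν : E ≤ ν) (hE : (1 / (2 * s) + 2 / S.phi) * e ^ 2 ≤ μ₀ / (4 * s) * E)
    (hη : 0 < η) (hηψ : η * ψ₀ ≤ S.phi / 8) (hηl : η * (l₀ + e) ≤ S.phi / 2)
    (hημ : η * μ₀ / (4 * s) ≤ 1) (hr : 0 < r) (hr1 : r ≤ 1)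
    (hbias : ((n * m * N : ℕ) : ℝ) * (((n * m * N : ℕ) : ℝ) * (ψ₀ * r)) ≤ e / 2)
    {T M : ℕ} (hT : 0 < T) (hM : 0 < M) (hδ : 0 < δ)
    (hb₁ : Real.log (4 * (T : ℝ) * ((max (n * m * N) (m ^ 2 * (N + 1)) : ℕ) : ℝ) / δ)
      ≤ M * (e / (2 * ((n * m * N : ℕ) : ℝ))) ^ 2
        / (2 * (((n * m * N : ℕ) : ℝ) / r * gmax) ^ 2))
    (hb₂ : Real.log (4 * (T : ℝ) * ((max (n * m * N) (m ^ 2 * (N + 1)) : ℕ) : ℝ) / δ)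
      ≤ M * (S.phi / (2 * m)) ^ 2 / (2 * s ^ 2))
    {L₀ : Gain n m N} (hL₀ : a ≤ S.G K L₀) :
    1 - δ ≤ (S.runLaw T M).real {ω : Fin T → Fin M → Draw m n N |
      (∀ (j : Fin T) (t : Fin (N + 1)),
        IsUnit (S.covEst K (S.iterate K r η L₀ ω j.castSucc) (ω j) t)) ∧
      S.gap K (S.iterate K r η L₀ ω (Fin.last T))
        ≤ (1 - η * μ₀ / (4 * s)) ^ T * S.gap K L₀ + E} := by
  have hφ := S.phi_pos hm
  have hd₁ : 0 < ((n * m * N : ℕ) : ℝ) := by positivity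
  have hm' : (0 : ℝ) < m := Nat.cast_pos.2 hm
  have hT' : (0 : ℝ) < T := Nat.cast_pos.2 hT
  set d₁ : ℝ := ((n * m * N : ℕ) : ℝ)
  set Dm : ℝ := ((max (n * m * N) (m ^ 2 * (N + 1)) : ℕ) : ℝ) with hDm
  have hDm0 : 0 < Dm := hd₁.trans_le (Nat.cast_le.2 (le_max_left _ _))
  set b := Real.log (4 * (T : ℝ) * Dm / δ) with hb
  have hδeq : (T : ℝ) * (4 * Dm * Real.exp (-b)) = δ := by
    rw [hb, Real.exp_neg, Real.exp_log (by positivity)]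
    field_simp
  rw [← hδeq]
  have hball : ∀ L ∈ S.superlevel (n := n) K (a - ν),
      L ∈ Metric.closedBall (0 : Gain n m N) (R + 2) := fun L hL => by
    rw [mem_closedBall_zero_iff]; linarith [hν L hL]
  have hballU : ∀ L ∈ S.superlevel (n := n) K (a - ν), ∀ U : Gain n m N, ‖U‖ = 1 →
      L + r • U ∈ Metric.closedBall (0 : Gain n m N) (R + 2) := fun L hL U hU => by
    rw [mem_closedBall_zero_iff]
    have h1 := norm_add_le L (r • U)
    rw [norm_smul, hU, mul_one, Real.norm_of_nonneg hr.le] at h1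
    linarith [hν L hL]
  refine one_sub_le_runLaw_accurate (K := K) hn hm hN r η L₀ (I := S.superlevel K (a - ν))
    (σ₁ := e / (2 * d₁) + d₁ * (ψ₀ * r)) (σ₂ := S.phi / (2 * m)) (s := s)
    (isClosed_superlevel _).measurableSet (by positivity) ?_ ?_
  · intro L hL
    refine measureReal_not_accurate_le hn hm hN hgmax hr hs (hsq L (hν L hL))
      (fun ξ hξ U hU => hcost _ (hballU L hL U hU) ξ hξ) (fun U hU => ?_) hM
      (by positivity) (by positivity) hb₁ hb₂
    have h1 := hψ₀ L (hball L hL) _ (hballU L hL U hU)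
    rwa [add_sub_cancel_left, inner_smul_right, norm_smul, hU, mul_one,
      Real.norm_of_nonneg hr.le] at h1
  · intro ω hω
    have hσ₂ : m * (S.phi / (2 * m)) ≤ S.phi / 2 := by
      apply le_of_eq; field_simp
    have hσ₁ : d₁ * (e / (2 * d₁) + d₁ * (ψ₀ * r)) ≤ e := by
      have : d₁ * (e / (2 * d₁)) = e / 2 := by field_simp
      rw [mul_add, this]
      linarith
    have hstep : ∀ j : Fin T,
        S.iterate K r η L₀ ω j.castSucc ∈ S.superlevel (n := n) K (a - ν) →
        S.gap K (S.iterate K r η L₀ ω j.succ)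
          ≤ (1 - η * μ₀ / (4 * s)) * S.gap K (S.iterate K r η L₀ ω j.castSucc)
            + η * μ₀ / (4 * s) * E := by
      intro j hj
      rw [iterate_succ]
      refine (gap_npgStep_le hm hM hs hη.le hσ₂ (hω j hj) hσ₁ (hν _ hj) (hl₀ _ (hball _ hj))
        (fun y hy => hψ₀ _ (hball _ hj) y ?_) hηψ hηl (hPL _)).trans ?_
      · rwa [add_assoc, one_add_one_eq_two] at hy
      · have := mul_le_mul_of_nonneg_left hE hη.le
        have h2 : η * (μ₀ / (4 * s) * E) = η * μ₀ / (4 * s) * E := by ring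
        linarith
    have hall := gap_iterate_le (by positivity) hημ hE0 hEν hL₀
      (gap_nonneg hm hK hn hN L₀) hstep
    refine ⟨fun j t => isUnit_covEst hm hσ₂ (hω j (hall j.castSucc).1) t, ?_⟩
    simpa using (hall (Fin.last T)).2

set_option maxHeartbeats 1000000 in
/-- The curvature constants and the convergence guarantee on a superlevel set. The constant `μ` is
smaller than the gradient domination constant `μ₀` by a factor `k` that accounts for the size of the
initial gap, and the final gap `ε min(1, φ)` is small enough for both the value and the distance. -/
lemma exists_curvature_and_convergence (hm : 0 < m) (hn : 0 < n) (hN : 0 < N)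
    (hK : S.Feasible K) {μ₀ C k μ : ℝ} (hμ₀ : 0 < μ₀)
    (hPL : ∀ L : Gain n m N, μ₀ * S.gap K L ≤ ‖gradient (S.G K) L‖ ^ 2) (hC : 0 ≤ C)
    (hgap : ∀ L : Gain n m N, S.gap K L ≤ C * S.covRoot K ‖L‖ ^ 2)
    (hk : k = 1 + 8 * C / min 1 S.phi) (hμ : μ = μ₀ / k) {a : ℝ}
    (hne : (S.superlevel (n := n) K a).Nonempty) :
    BddAbove (S.kappa (covPoly N) K '' S.superlevel (n := n) K a) ∧
    0 < S.kappaInf (n := n) (covPoly N) K a ∧ 0 < S.kappaSup (n := n) (covPoly N) K a ∧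
    ∃ l ψ ρ : ℝ, S.IsCurvature (n := n) K a l ψ ρ ∧
      ∀ η : ℝ, 0 < η → η ≤ 1 / (2 * ψ) →
      ∀ L₀ : Gain n m N, a ≤ S.G K L₀ →
      ∀ ε δ : ℝ, 0 < ε → ε < 1 → 0 < δ → δ < 1 →
      ∀ r : ℝ, 0 < r →
        r ≤ radiusBound S.phi μ l ψ ρ (S.kappaSup (n := n) (covPoly N) K a) ε →
      ∀ T : ℕ, T = iterCount (S.kappaSup (n := n) (covPoly N) K a) η μ ε →
      ∀ M : ℕ, 0 < M →
        batchBound (n * m * N) (m ^ 2 * (N + 1)) T (S.G K (S.innerSol (n := n) K)) S.phi μ l ρ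
          (S.kappaSup (n := n) (covPoly N) K a) r ε δ ≤ M →
        1 - δ ≤ (S.runLaw T M).real {ω : Fin T → Fin M → Draw m n N |
          (∀ (j : Fin T) (t : Fin (N + 1)),
            IsUnit (S.covEst K (S.iterate K r η L₀ ω j.castSucc) (ω j) t)) ∧
          S.gap K (S.iterate K r η L₀ ω (Fin.last T)) ≤ min 1 S.phi * ε} := by
  have hφ := S.phi_pos hm
  have hϑ := S.theta_pos hm
  have hν' : 0 < min 1 S.phi := lt_min one_pos hφ
  have hk1 : 1 ≤ k := by rw [hk]; linarith [show 0 ≤ 8 * C / min 1 S.phi by positivity]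
  have hμ0 : 0 < μ := by rw [hμ]; positivity
  -- the largest gain of the superlevel set determines the bound `s` of the squared state
  obtain ⟨Lmax, hLmax, hmax⟩ := (isCompact_superlevel hm hn hN hK a).exists_isMaxOn hne
    continuous_norm.continuousOn
  set R := ‖Lmax‖ with hR
  have hRa : ∀ L ∈ S.superlevel (n := n) K a, ‖L‖ ≤ R := fun L hL => hmax hL
  have hR0 : 0 ≤ R := norm_nonneg _
  set y := S.covRoot K R with hy
  have hy1 : 1 ≤ y := one_le_covRoot hR0
  set s := S.ϑ ^ 2 * y with hs
  have hs0 : 0 < s := by positivity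
  have hc0 : 0 ≤ S.c0 := by unfold c0; positivity
  have hkap : ∀ L : Gain n m N, S.kappa (covPoly N) K L
      = S.c0 * S.covRoot K ‖L‖ ^ 2 + S.phi / 2 := fun L => by
    rw [kappa, cSigma_covPoly]
  have hbdd : BddAbove (S.kappa (covPoly N) K '' S.superlevel (n := n) K a) := by
    refine ⟨S.c0 * y ^ 2 + S.phi / 2, ?_⟩
    rintro _ ⟨L, hL, rfl⟩
    rw [hkap]
    have h1 : S.covRoot K ‖L‖ ≤ y := covRoot_mono (norm_nonneg _) (hRa L hL)
    have h2 := one_le_covRoot (S := S) (K := K) (norm_nonneg L)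
    gcongr
  have hinf : 0 < S.kappaInf (n := n) (covPoly N) K a := by
    refine (half_pos hφ).trans_le (le_csInf (hne.image _) ?_)
    rintro _ ⟨L, hL, rfl⟩
    rw [hkap]
    have : 0 ≤ S.c0 * S.covRoot K ‖L‖ ^ 2 := by positivity
    linarith
  set κ := S.kappaSup (n := n) (covPoly N) K a with hκ
  have hκs : s * y ≤ κ := by
    refine le_trans ?_ (le_csSup hbdd ⟨Lmax, hLmax, rfl⟩)
    rw [hkap, hs]
    have h1 : S.ϑ ^ 2 ≤ S.c0 := by
      unfold c0
      nlinarith [sq_nonneg S.ϑ, Nat.cast_nonneg (α := ℝ) N]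
    have h2 : S.ϑ ^ 2 * y ^ 2 ≤ S.c0 * y ^ 2 := by gcongr
    linarith [show S.ϑ ^ 2 * y * y = S.ϑ ^ 2 * y ^ 2 by ring]
  have hκ0 : 0 < κ := lt_of_lt_of_le (by positivity) hκs
  refine ⟨hbdd, hinf, hκ0, ?_⟩
  obtain ⟨ν, hν0, hν⟩ := exists_superlevel_norm_le hm hn hN hK hRa
  obtain ⟨l₀, ψ₀, hl₀0, hψ₀0, hsmooth⟩ := exists_smoothness_constants
    (contDiff_G (S := S) (K := K) (n := n)) (R + 2)
  obtain ⟨g₁, hg₁⟩ := ((isCompact_closedBall (0 : Gain n m N) (R + 2)).prod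
    S.isCompact_boundedPaths).exists_bound_of_continuousOn (S.continuous_cost K).continuousOn
  set gmax := max g₁ 1 with hgmax
  have hgmax0 : 0 < gmax := lt_max_of_lt_right one_pos
  set d₁ : ℝ := ((n * m * N : ℕ) : ℝ) with hd₁
  have hd₁0 : 0 < d₁ := by positivity
  have hm' : (0 : ℝ) < m := Nat.cast_pos.2 hm
  -- the tolerated error of the gradient estimates is `e₀ √ε`
  set ν₁ := min ν (min 1 S.phi / 2) with hν₁
  have hν₁0 : 0 < ν₁ := lt_min hν0 (half_pos hν')
  set Ce := 1 / (2 * s) + 2 / S.phi with hCe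
  have hCe0 : 0 < Ce := by positivity
  set e₀ := min 1 (μ₀ * ν₁ / (4 * s * Ce)) with he₀
  have he₀0 : 0 < e₀ := lt_min one_pos (by positivity)
  have he₀1 : e₀ ≤ 1 := min_le_left _ _
  have he₀C : Ce * e₀ ^ 2 ≤ μ₀ / (4 * s) * ν₁ := by
    have h1 : e₀ ≤ μ₀ * ν₁ / (4 * s * Ce) := min_le_right _ _
    have h2 : e₀ ^ 2 ≤ e₀ := by nlinarith
    calc Ce * e₀ ^ 2 ≤ Ce * (μ₀ * ν₁ / (4 * s * Ce)) := by gcongr; exact h2.trans h1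
      _ = _ := by field_simp
  -- `ψ` is large enough for the stepsize and the bias, `l` for the batchsize
  set ψ := ψ₀ + d₁ ^ 2 * ψ₀ * S.phi * Real.sqrt μ / (8 * κ * e₀) + 4 * ψ₀ / S.phi
    + (l₀ + 1) / S.phi + μ₀ / (8 * s) with hψ
  have hψa : 0 ≤ d₁ ^ 2 * ψ₀ * S.phi * Real.sqrt μ / (8 * κ * e₀) := by positivity
  have hψb : 0 < 4 * ψ₀ / S.phi := by positivity
  have hψc : 0 < (l₀ + 1) / S.phi := by positivity
  have hψd : 0 < μ₀ / (8 * s) := by positivity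
  have hψ0 : 0 < ψ := by linarith
  set w := 64 * d₁ ^ 2 * (κ + 1) ^ 2 / (S.phi ^ 2 * μ) with hw
  have hw0 : 0 < w := by positivity
  -- the two summands are what the gradient and the covariance estimates require
  set Y := 8 * d₁ ^ 4 * gmax ^ 2 / e₀ ^ 2 + 8 * m ^ 2 * s ^ 2 / S.phi ^ 2 with hY
  have hY0 : 0 ≤ Y := by positivity
  set l := l₀ + 1 + Y / w with hl
  have hYw : 0 ≤ Y / w := by positivity
  have hl1 : 1 ≤ l := by linarith
  refine ⟨l, ψ, 1, ⟨by linarith, hψ0, one_pos, ?_⟩, ?_⟩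
  · intro L hL L' hL'
    have hLR := hRa L hL
    have h1 : ‖L'‖ ≤ R + 1 := by
      rcases hL' with h | h
      · have := norm_add_le L (L' - L)
        rw [add_sub_cancel] at this
        linarith
      · linarith [hRa L' h]
    obtain ⟨h2, h3, _⟩ := (hsmooth L (mem_closedBall_zero_iff.2 (by linarith))).2 L'
      (mem_closedBall_zero_iff.2 (by linarith))
    exact ⟨h2.trans (mul_le_mul_of_nonneg_right (by linarith) (norm_nonneg _)),
      h3.trans (mul_le_mul_of_nonneg_right (by linarith) (norm_nonneg _))⟩
  · intro η hη hηψ L₀ hL₀ ε δ hε hε1 hδ hδ1 r hr hrb T hT M hM hbatch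
    have hsε : 0 < Real.sqrt ε := Real.sqrt_pos.2 hε
    have hsε1 : Real.sqrt ε ≤ 1 := Real.sqrt_le_one.2 hε1.le
    have hT0 : 0 < T := hT ▸ iterCount_pos hκ0 hη hμ0 hε hε1
    have hηψ' : η * ψ ≤ 1 / 2 := by
      rw [le_div_iff₀ (by positivity)] at hηψ
      linarith
    have hr1 : r ≤ 1 := hrb.trans ((min_le_right _ _).trans (min_le_right _ _))
    have hrψ : r * (16 * κ * ψ) ≤ S.phi * (Real.sqrt μ * Real.sqrt ε) := by
      have h1 := hrb.trans (min_le_left _ _)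
      rwa [le_div_iff₀ (by positivity), Real.sqrt_mul hμ0.le] at h1
    have hMY := mul_log_le_of_batchBound_le (Nat.mul_pos (Nat.mul_pos hn hm) hN) hT0
      (G_innerSol_nonneg (n := n) hK) hφ hμ0 hκ0 hr hε hδ hδ1 hl1
      (Y := Y) (by rw [← hd₁, ← hw]; linarith) hbatch
    set lg := Real.log (4 * (T : ℝ) * ((max (n * m * N) (m ^ 2 * (N + 1)) : ℕ) : ℝ) / δ) with hlg
    have hlg0 : 0 ≤ lg := log_union_nonneg (Nat.mul_pos (Nat.mul_pos hn hm) hN) hT0 hδ hδ1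
    have hY1 : 8 * d₁ ^ 4 * gmax ^ 2 / e₀ ^ 2 * lg ≤ M * (r ^ 2 * ε) :=
      le_trans (mul_le_mul_of_nonneg_right
        (le_add_of_nonneg_right (by positivity)) hlg0) hMY
    have hY2 : 8 * m ^ 2 * s ^ 2 / S.phi ^ 2 * lg ≤ M := by
      refine (le_trans (mul_le_mul_of_nonneg_right
        (le_add_of_nonneg_left (by positivity)) hlg0) hMY).trans ?_
      have h1 : r ^ 2 * ε ≤ 1 := mul_le_one₀ (pow_le_one₀ hr.le hr1) hε.le hε1.le
      exact mul_le_of_le_one_right (Nat.cast_nonneg _) h1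
    have hmain := one_sub_le_runLaw_contraction hm hn hN hK (a := a) (ν := ν) (R := R)
      (l₀ := l₀) (ψ₀ := ψ₀) (gmax := gmax) (s := s) (e := e₀ * Real.sqrt ε) (E := ν₁ * ε)
      (μ₀ := μ₀) (η := η) (r := r) (δ := δ) (T := T) (M := M) (L₀ := L₀) hs0 hν
      (fun L hL ξ hξ t => (S.norm_traj_sq_le K L hξ t).trans (mul_le_mul_of_nonneg_left
        (growth_pow_le_covRoot hR0 (norm_nonneg _) (by linarith)) (sq_nonneg _)))
      (fun x hx => (hsmooth x hx).1) (fun x hx y hy => ((hsmooth x hx).2 y hy).2.2)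
      (fun x hx ξ hξ => (hg₁ (x, ξ) ⟨hx, hξ⟩).trans (le_max_left _ _)) hgmax0 hμ₀ hPL
      (by positivity) (by positivity) ?_ ?_ hη ?_ ?_ ?_ hr hr1 ?_ hT0 hM hδ ?_ ?_ hL₀
    · refine hmain.trans (measureReal_mono ?_ ?_)
      · intro ω hω
        refine ⟨hω.1, hω.2.trans ?_⟩
        have hq1 : η * μ₀ / (4 * s) ≤ 1 := by
          rw [div_le_one (by positivity)]
          have h1 : η * (μ₀ / (8 * s)) ≤ 1 / 2 :=
            (mul_le_mul_of_nonneg_left (by linarith) hη.le).trans hηψ'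
          rw [mul_div_assoc', div_le_iff₀ (by positivity)] at h1
          linarith
        have hqT : 2 * k * y * Real.log (2 / ε) ≤ η * μ₀ / (4 * s) * T := by
          have h1 := le_iterCount κ η μ ε
          rw [← hT] at h1
          have h2 := half_le_log_two_div hε hε1
          have h3 : η * μ₀ / (4 * s) * (8 * κ / (η * μ) * Real.log (2 / ε))
              = 2 * k * (κ / s) * Real.log (2 / ε) := by
            rw [hμ]; field_simp; ring
          calc 2 * k * y * Real.log (2 / ε) ≤ 2 * k * (κ / s) * Real.log (2 / ε) := by
                refine mul_le_mul_of_nonneg_right ?_ (by linarith)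
                refine mul_le_mul_of_nonneg_left ?_ (by linarith)
                rw [le_div_iff₀ hs0]; linarith
            _ ≤ _ := by
                rw [← h3]
                exact mul_le_mul_of_nonneg_left h1 (by positivity)
        have hΓ : S.gap K L₀ ≤ C * y ^ 2 := by
          have h1 : S.covRoot K ‖L₀‖ ≤ y := covRoot_mono (norm_nonneg _) (hRa L₀ hL₀)
          have h2 := one_le_covRoot (S := S) (K := K) (norm_nonneg L₀)
          exact (hgap L₀).trans (by gcongr)
        have h1 := one_sub_pow_mul_le hq1 hε hε1 hy1 hC hν' hk hqT hΓ
        have h2 : ν₁ * ε ≤ min 1 S.phi / 2 * ε :=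
          mul_le_mul_of_nonneg_right (min_le_right _ _) hε.le
        linarith
      · have := S.isProbabilityMeasure_drawLaw hn hm hN
        have : IsProbabilityMeasure (S.runLaw T M : Measure (Fin T → Fin M → Draw m n N)) := by
          unfold runLaw; infer_instance
        exact measure_ne_top _ _
    · exact (mul_le_of_le_one_right hν₁0.le hε1.le).trans (min_le_left _ _)
    · have h1 := mul_le_mul_of_nonneg_right he₀C hε.le
      calc _ = Ce * e₀ ^ 2 * ε := by rw [mul_pow, Real.sq_sqrt hε.le, ← mul_assoc]
        _ ≤ μ₀ / (4 * s) * ν₁ * ε := h1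
        _ = _ := by rw [mul_assoc]
    · have h1 : η * (4 * ψ₀ / S.phi) ≤ 1 / 2 :=
        (mul_le_mul_of_nonneg_left (by linarith) hη.le).trans hηψ'
      rw [mul_div_assoc', div_le_iff₀ hφ] at h1
      linarith
    · have h1 : η * ((l₀ + 1) / S.phi) ≤ 1 / 2 :=
        (mul_le_mul_of_nonneg_left (by linarith) hη.le).trans hηψ'
      rw [mul_div_assoc', div_le_iff₀ hφ] at h1
      have h2 : e₀ * Real.sqrt ε ≤ 1 := mul_le_one₀ he₀1 hsε.le hsε1
      have h3 : η * (l₀ + e₀ * Real.sqrt ε) ≤ η * (l₀ + 1) := by gcongr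
      linarith
    · rw [div_le_one (by positivity)]
      have h1 : η * (μ₀ / (8 * s)) ≤ 1 / 2 :=
        (mul_le_mul_of_nonneg_left (by linarith) hη.le).trans hηψ'
      rw [mul_div_assoc', div_le_iff₀ (by positivity)] at h1
      linarith
    · have h1 : d₁ ^ 2 * ψ₀ * S.phi * Real.sqrt μ ≤ ψ * (8 * κ * e₀) := by
        rw [← div_le_iff₀ (by positivity)]
        linarith
      have h2 : (d₁ * (d₁ * (ψ₀ * r))) * (16 * κ * ψ)
          ≤ e₀ * Real.sqrt ε / 2 * (16 * κ * ψ) := by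
        calc (d₁ * (d₁ * (ψ₀ * r))) * (16 * κ * ψ) = d₁ ^ 2 * ψ₀ * (r * (16 * κ * ψ)) := by ring
          _ ≤ d₁ ^ 2 * ψ₀ * (S.phi * (Real.sqrt μ * Real.sqrt ε)) := by gcongr
          _ = d₁ ^ 2 * ψ₀ * S.phi * Real.sqrt μ * Real.sqrt ε := by ring
          _ ≤ ψ * (8 * κ * e₀) * Real.sqrt ε := by gcongr
          _ = _ := by ring
      exact le_of_mul_le_mul_right h2 (by positivity)
    · rw [le_div_iff₀ (by positivity), div_pow, mul_pow e₀, Real.sq_sqrt hε.le]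
      rw [div_mul_eq_mul_div, div_le_iff₀ (by positivity)] at hY1
      have h1 : lg * (2 * (d₁ / r * gmax) ^ 2)
          = (8 * d₁ ^ 4 * gmax ^ 2 * lg) / (4 * d₁ ^ 2 * r ^ 2) := by field_simp; ring
      have h2 : M * (e₀ ^ 2 * ε / (2 * d₁) ^ 2)
          = (M * (r ^ 2 * ε) * e₀ ^ 2) / (4 * d₁ ^ 2 * r ^ 2) := by field_simp; ring
      rw [h1, h2]
      gcongr
    · rw [le_div_iff₀ (by positivity), div_pow]
      rw [div_mul_eq_mul_div, div_le_iff₀ (by positivity)] at hY2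
      have h2 : M * (S.phi ^ 2 / (2 * m) ^ 2) = M * S.phi ^ 2 / (4 * m ^ 2) := by
        field_simp; ring
      rw [h2, le_div_iff₀ (by positivity)]
      linarith

end LQGame

theorem theorem4p2 (m n d N : ℕ) (hm : 0 < m) (hn : 0 < n) (hd : 0 < d) (hN : 0 < N) :
    ∃ p : MvPolynomial (Fin 5) ℝ,
      ∀ (S : LQGame m n d N) (K : Gain d m N), S.Feasible K →
        (∀ L : Gain n m N, L ≠ S.innerSol K → S.G K L < S.G K (S.innerSol K)) ∧
        S.IsCovBound p K ∧
        ∃ μ : ℝ, S.IsPL K μ ∧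
          ∀ a : ℝ, (S.superlevel K a).Nonempty →
            BddAbove (S.kappa p K '' S.superlevel K a) ∧ 0 < S.kappaInf p K a ∧
            ∃ l ψ ρ : ℝ, S.IsCurvature K a l ψ ρ ∧
              ∀ η : ℝ, 0 < η →
                η ≤ stepBound S.phi μ l ψ ρ (S.kappaSup p K a) (S.kappaInf p K a) →
                -- convergence with high probability
                (∀ L₀ : Gain n m N, a ≤ S.G K L₀ →
                  ∀ ε₁ δ₁ : ℝ, 0 < ε₁ → ε₁ < 1 → 0 < δ₁ → δ₁ < 1 →
                  ∀ r₁ : ℝ, 0 < r₁ →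
                    r₁ ≤ radiusBound S.phi μ l ψ ρ (S.kappaSup p K a) ε₁ →
                  ∀ T : ℕ, T = iterCount (S.kappaSup p K a) η μ ε₁ →
                  ∀ M₁ : ℕ, 0 < M₁ →
                    batchBound (n * m * N) (m ^ 2 * (N + 1)) T (S.G K (S.innerSol K)) S.phi μ l ρ
                      (S.kappaSup p K a) r₁ ε₁ δ₁ ≤ M₁ →
                    1 - δ₁ ≤ (S.runLaw T M₁).real
                      {ω | (∀ (j : Fin T) (t : Fin (N + 1)),
                              IsUnit (S.covEst K (S.iterate K r₁ η L₀ ω j.castSucc) (ω j) t)) ∧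
                            S.G K (S.innerSol K) - ε₁
                              ≤ S.G K (S.iterate K r₁ η L₀ ω (Fin.last T)) ∧
                            ‖S.innerSol K - S.iterate K r₁ η L₀ ω (Fin.last T)‖
                              ≤ Real.sqrt ((lambdaMin (S.H K (S.innerSol K)))⁻¹ * ε₁)}) ∧
                -- total number of sampled trajectories
                (∃ C : ℝ, ∀ ε₁ δ₁ : ℝ, 0 < ε₁ → ε₁ < 1 → 0 < δ₁ → δ₁ < 1 →
                  ∃ (r₁ : ℝ) (M₁ : ℕ), 0 < r₁ ∧
                    r₁ ≤ radiusBound S.phi μ l ψ ρ (S.kappaSup p K a) ε₁ ∧ 0 < M₁ ∧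
                    batchBound (n * m * N) (m ^ 2 * (N + 1))
                      (iterCount (S.kappaSup p K a) η μ ε₁) (S.G K (S.innerSol K)) S.phi μ l ρ
                      (S.kappaSup p K a) r₁ ε₁ δ₁ ≤ M₁ ∧
                    (2 * M₁ * iterCount (S.kappaSup p K a) η μ ε₁ : ℝ)
                      ≤ C * ε₁⁻¹ ^ 2 * Real.log (2 / ε₁) ^ 2 * Real.log (2 / δ₁)) := by
  refine ⟨covPoly N, fun S K hK => ?_⟩
  have hφ := S.phi_pos hm
  have hϑ := S.theta_pos hm
  have hν : 0 < min 1 S.phi := lt_min one_pos hφ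
  have hm' : (0 : ℝ) < m := Nat.cast_pos.2 hm
  have hlam : 0 < S.lamH K (n := n) := LQGame.lamH_pos hn hN hK
  have hy : 1 ≤ S.covRoot K ‖S.innerSol K‖ := LQGame.one_le_covRoot (norm_nonneg _)
  obtain ⟨C, hC, hgap⟩ := LQGame.exists_gap_le (S := S) hN hK
  -- `s` bounds the covariances of the states under the maximizing gain
  set s := m * (S.ϑ ^ 2 * S.covRoot K ‖S.innerSol K‖) with hs
  have hs0 : 0 < s := by positivity
  set μ₀ := 4 * S.phi ^ 2 * S.lamH K / s with hμ₀
  have hμ₀0 : 0 < μ₀ := by positivity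
  have hPL : ∀ L : Gain n m N, μ₀ * S.gap K L ≤ ‖gradient (S.G K) L‖ ^ 2 :=
    LQGame.phi_sq_mul_gap_le_norm_gradient_sq hm hK hn hN hs0 fun t =>
      LQGame.smul_one_sub_stateCov_posSemidef (norm_nonneg _) (by linarith) t
  -- `μ₀ / k` is still a gradient domination constant, and it raises the number of iterations
  -- enough to contract the largest initial gap
  set k := 1 + 8 * C / min 1 S.phi with hk
  have hk1 : 1 ≤ k := by rw [hk]; linarith [show 0 ≤ 8 * C / min 1 S.phi by positivity]
  have hμ0 : 0 < μ₀ / k := by positivity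
  refine ⟨fun L hL => LQGame.G_lt_G_innerSol hm hK hn hN hL, LQGame.isCovBound_covPoly,
    μ₀ / k, ⟨hμ0, fun L => ?_⟩, fun a hne => ?_⟩
  · refine le_trans ?_ (hPL L)
    exact mul_le_mul_of_nonneg_right (div_le_self hμ₀0.le hk1)
      (LQGame.gap_nonneg hm hK hn hN L)
  obtain ⟨hbdd, hinf, hsup, l, ψ, ρ, hcurv, hconv⟩ :=
    LQGame.exists_curvature_and_convergence hm hn hN hK hμ₀0 hPL hC hgap hk rfl hne
  refine ⟨hbdd, hinf, l, ψ, ρ, hcurv, fun η hη hηb => ⟨?_, ?_⟩⟩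
  · intro L₀ hL₀ ε δ hε hε1 hδ hδ1 r hr hrb T hT M hM hbatch
    refine (hconv η hη (hηb.trans ((min_le_right _ _).trans (min_le_left _ _))) L₀ hL₀ ε δ hε hε1
      hδ hδ1 r hr hrb T hT M hM hbatch).trans (measureReal_mono ?_ ?_)
    · rintro ω ⟨hunit, hω⟩
      refine ⟨hunit, ?_, ?_⟩
      · have h1 : min 1 S.phi * ε ≤ 1 * ε := mul_le_mul_of_nonneg_right (min_le_left _ _) hε.le
        unfold LQGame.gap at hω
        linarith
      · have h1 : min 1 S.phi * ε ≤ S.phi * ε :=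
          mul_le_mul_of_nonneg_right (min_le_right _ _) hε.le
        have h2 := (LQGame.mul_norm_sq_le_gap hK hn hN
          (S.iterate K r η L₀ ω (Fin.last T))).trans (hω.trans h1)
        rw [mul_assoc, mul_le_mul_iff_right₀ hφ] at h2
        rw [norm_sub_rev]
        refine Real.le_sqrt_of_sq_le ?_
        change _ ≤ (S.lamH K)⁻¹ * ε
        rwa [inv_mul_eq_div, le_div_iff₀' hlam]
    · have := S.isProbabilityMeasure_drawLaw hn hm hN
      have : IsProbabilityMeasure (S.runLaw T M : Measure (Fin T → Fin M → LQGame.Draw m n N)) := by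
        unfold LQGame.runLaw; infer_instance
      exact measure_ne_top _ _
  · obtain ⟨hl, hψ, hρ, -⟩ := hcurv
    exact exists_sample_complexity hφ hμ0 hl hψ hρ hsup hη _
      (Nat.mul_pos (Nat.mul_pos hn hm) hN)
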